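/- Let $\mathbb K$ be $\mathbb R$ or $\mathbb C$, let $H$ be an infinite-dimensional separable Hilbert space over $\mathbb K$, and let $A:\operatorname{dom}(A)\to H$ be a densely defined self-adjoint (possibly unbounded) operator on $H$. Fix any $\aleph_1$-saturated nonstandard extension ${}^*$ (of a universe of sets containing $\mathbb K$ and $H$), and write $\simeq$ for "infinitely close" and $\operatorname{st}$ for the standard part. Inner products $(x,y)$ are linear in $x$. A *sampling* for $A$ is an internal triple $(\tilde H,\tilde A,\tilde\Omega)$, where $\tilde H$ is a subspace of ${}^*H$ of hyperfinite dimension, $\tilde A:\tilde H\to\tilde H$ is a ${}^*$linear symmetric operator, and $\tilde\Omega$ is an orthonormal ${}^*$basis of $\tilde H$ consisting of eigenvectors of $\tilde A$, such that for each $x\in\operatorname{dom}(A)$ there is $\tilde x\in\tilde H$ with $\tilde x\simeq x$ and $\tilde A\tilde x\simeq Ax$. A *standard-biased scale* consists of internal sequences $(\tilde e_j)_{1\le j\le N}$ in ${}^*H$ and $(\tilde c_j)_{1\le j\le N}$ in ${}^*\mathbb R_{\ge0}$, with $N\in{}^*\mathbb N$ infinite, such that: for each standard $j$, $\tilde e_j$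 and $\tilde c_j$ are nearstandard and $\operatorname{st}(\tilde c_j\tilde e_j)\ne0$; the vectors $\operatorname{st}(\tilde e_j)$, $j\in\mathbb N$, span a dense subspace of $H$; $\sum_{j\le N}\tilde c_j\|\tilde e_j\|^2=1$; and $\sum_{K<j\le N}\tilde c_j\|\tilde e_j\|^2\simeq0$ for each infinite $K$. It is *compatible* with the sampling if $\tilde e_j\in\tilde H$ for all $j\le N$, $\tilde A\tilde e_j$ is nearstandard for all standard $j$, and for each $f\in\tilde\Omega$ there is $j\le N$ with $\tilde c_j>0$ and $(\tilde e_j,f)\neq0$. Given a sampling and a compatible standard-biased scale, for internal $V\subseteq\tilde\Omega$ let $\tilde\mu(V)=\sum_{j\le N}\tilde c_j\sum_{f\in V}|(\tilde e_j,f)|^2$, and let $(\Omega_L,\mathcal A_L,\mu_L)$ be the Loeb probability space on $\Omega_L=\tilde\Omega$ induced by $\tilde\mu$. For $x\in{}^*H$ and $f\in\tilde\Omega$ let $(\tilde U x)(f)=(x,f)/\sqrt{\tilde\mu(\{f\})}$, and let $$\tilde d(f,g)=\sum_{j\le N}\tilde c_j^{3/2}\|\tilde e_j\|^2\,|(\tilde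 U\tilde e_j)(f)-(\tilde U\tilde e_j)(g)| .$$ Let $\hat\Omega$ be the quotient of $\Omega_L$ by the relation $\tilde d(f,g)\simeq0$, with the metric induced by $\operatorname{st}\tilde d$ and its Borel $\sigma$-algebra; let $\hat\nu:\Omega_L\to\hat\Omega$ be the quotient map and $\hat\mu$ the image of $\mu_L$ under $\hat\nu$. The *induced isometry* is the unique linear isometry $\hat U:H\to L_2(\hat\Omega,\hat\mu)$ such that, for each $x\in H$, $(\hat Ux)(\hat\nu(f))=\operatorname{st}\big((\tilde U\,{}^*x)(f)\big)$ for $\mu_L$-almost every $f$ (in particular the standard part exists for almost every $f$). **Theorem.** There exist a sampling for $A$ and a standard-biased scale compatible with it for which the induced isometry $\hat U:H\to L_2(\hat\Omega,\hat\mu)$ exists and is surjective. -/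

import Mathlib

open scoped NNReal ENNReal Topology InnerProductSpace
open MeasureTheory

universe w

noncomputable section

/-! ## Nonstandard extensions -/

/-- A nonstandard extension: it sends every standard set `X` to `*X` (`star X`), every function
`f : X → Y` to `*f : *X → *Y` (`map f`), and every `x : X` to its copy `*x` (`std x`).
The laws are the transfer principle, in functorial form: `*` respects composition and constants,
`*(X × Y) = *X × *Y`, the star of the equality relation is equality, and the star of the set of
truth values has exactly the two elements `*True ≠ *False`. As predicates are maps into `Prop` and
existential quantifiers are computed by Skolem functions, every first-order statement about
standard sets, functions and relations (including membership in power sets) transfers.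
Elements of `*(Set X)`, `*(X → Y)`, … are the internal sets, functions, … . -/
structure NonstandardExtension where
  star : Type → Type w
  map : ∀ {X Y : Type}, (X → Y) → star X → star Y
  std : ∀ {X : Type}, X → star X
  pair : ∀ {X Y : Type}, star X → star Y → star (X × Y)
  map_id : ∀ {X : Type} (ξ : star X), map (fun x => x) ξ = ξ
  map_map : ∀ {X Y Z : Type} (g : Y → Z) (f : X → Y) (ξ : star X),
    map g (map f ξ) = map (fun x => g (f x)) ξ
  map_const : ∀ {X Y : Type} (y : Y) (ξ : star X), map (fun _ => y) ξ = std y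
  map_fst_pair : ∀ {X Y : Type} (ξ : star X) (η : star Y), map Prod.fst (pair ξ η) = ξ
  map_snd_pair : ∀ {X Y : Type} (ξ : star X) (η : star Y), map Prod.snd (pair ξ η) = η
  pair_map : ∀ {X Y : Type} (ζ : star (X × Y)), pair (map Prod.fst ζ) (map Prod.snd ζ) = ζ
  map_eq : ∀ {X Y : Type} (f g : X → Y) (ξ : star X), map f ξ = map g ξ →
    map (fun x => f x = g x) ξ = std True
  eq_true_or_eq_false : ∀ p : star Prop, p = std True ∨ p = std False
  true_ne_false : (std True : star Prop) ≠ std False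

namespace NonstandardExtension

/-- The star of the predicate `p` holds at `ξ`, i.e. `ξ ∈ *{x | p x}`. -/
def Holds (S : NonstandardExtension.{w}) {X : Type} (p : X → Prop) (ξ : S.star X) : Prop :=
  S.map p ξ = S.std True

/-- The star of the binary relation `r` holds between `ξ` and `η`. -/
def Holds₂ (S : NonstandardExtension.{w}) {X Y : Type} (r : X → Y → Prop)
    (ξ : S.star X) (η : S.star Y) : Prop :=
  S.Holds (fun p : X × Y => r p.1 p.2) (S.pair ξ η)

/-- `ℵ₁`-saturation: a countable family of internal sets with the finite intersection property
has a common element. -/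
def IsSaturated (S : NonstandardExtension.{w}) : Prop :=
  ∀ (X : Type) (B : ℕ → S.star (Set X)),
    (∀ n : ℕ, ∃ ξ : S.star X, ∀ k < n, S.Holds₂ (fun x b => x ∈ b) ξ (B k)) →
      ∃ ξ : S.star X, ∀ k, S.Holds₂ (fun x b => x ∈ b) ξ (B k)

/-- The hypernatural `K` is infinite. -/
def IsInfinite (S : NonstandardExtension.{w}) (K : S.star ℕ) : Prop :=
  ∀ n : ℕ, S.Holds (fun k => n < k) K

/-- `ξ ≃ x`: the point `ξ` of `*X` is infinitely close to the standard point `x`. -/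
def IsSt (S : NonstandardExtension.{w}) {X : Type} [TopologicalSpace X]
    (ξ : S.star X) (x : X) : Prop :=
  ∀ u ∈ 𝓝 x, S.Holds (fun y => y ∈ u) ξ

/-- `ξ` is nearstandard. -/
def IsNearstandard (S : NonstandardExtension.{w}) {X : Type} [TopologicalSpace X]
    (ξ : S.star X) : Prop :=
  ∃ x : X, S.IsSt ξ x

open Classical in
/-- The standard part of `ξ` (with the value `0` if `ξ` is not nearstandard). -/
def st (S : NonstandardExtension.{w}) {X : Type} [TopologicalSpace X] [Zero X]
    (ξ : S.star X) : X :=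
  if h : S.IsNearstandard ξ then h.choose else 0

/-! ### Elementary transfer facts -/

theorem map_eq_of_holds (S : NonstandardExtension.{w}) {X Y : Type} {f : X → Y} {ξ : S.star X}
    {η : S.star Y} (h : S.map f ξ = η) {Z : Type} (k : Y → X → Z) :
    S.map (fun x => k (f x) x) ξ = S.map (fun q : Y × X => k q.1 q.2) (S.pair η ξ) := by
  have : S.pair η ξ = S.map (fun x => (f x, x)) ξ := by
    rw [← S.pair_map (S.map (fun x => (f x, x)) ξ), S.map_map, S.map_map]
    simp only [S.map_id]
    rw [h]
  rw [this, S.map_map]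

theorem pair_std_left (S : NonstandardExtension.{w}) {X Y : Type} (y : Y) (ξ : S.star X) :
    S.pair (S.std y) ξ = S.map (fun x => (y, x)) ξ := by
  rw [← S.pair_map (S.map (fun x => (y, x)) ξ), S.map_map, S.map_map]
  simp only [S.map_id, S.map_const]

theorem Holds.mono {S : NonstandardExtension.{w}} {X : Type} {p q : X → Prop} {ξ : S.star X}
    (hp : S.Holds p ξ) (h : ∀ x, p x → q x) : S.Holds q ξ := by
  have h1 := S.map_eq_of_holds hp (fun a x => a ∨ q x)
  rw [S.pair_std_left, S.map_map] at h1
  have h2 : (fun x => p x ∨ q x) = q := by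
    funext x
    exact propext ⟨fun hx => hx.elim (h x) id, Or.inr⟩
  simp only [true_or] at h1
  rw [h2, S.map_const] at h1
  exact h1

theorem Holds.and {S : NonstandardExtension.{w}} {X : Type} {p q : X → Prop} {ξ : S.star X}
    (hp : S.Holds p ξ) (hq : S.Holds q ξ) : S.Holds (fun x => p x ∧ q x) ξ := by
  have h1 := S.map_eq_of_holds hp (fun a x => a ∧ q x)
  rw [S.pair_std_left, S.map_map] at h1
  simp only [true_and] at h1
  exact h1.trans hq

theorem holds_of_forall (S : NonstandardExtension.{w}) {X : Type} {p : X → Prop}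
    (h : ∀ x, p x) (ξ : S.star X) : S.Holds p ξ := by
  have : p = fun _ => True := funext fun x => propext ⟨fun _ => trivial, fun _ => h x⟩
  rw [this]
  exact S.map_const True ξ

theorem holds_not_iff (S : NonstandardExtension.{w}) {X : Type} (p : X → Prop) (ξ : S.star X) :
    S.Holds (fun x => ¬ p x) ξ ↔ ¬ S.Holds p ξ := by
  constructor
  · intro h1 h2
    have h3 := h1.and h2
    have h4 : (fun x => ¬ p x ∧ p x) = fun _ => False := funext fun x => by simp
    rw [Holds, h4, S.map_const] at h3
    exact S.true_ne_false h3.symm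
  · intro h
    have h1 : S.map p ξ = S.std False := (S.eq_true_or_eq_false _).resolve_left h
    have h2 := S.map_eq_of_holds h1 (fun a _ => ¬ a)
    rw [S.pair_std_left, S.map_map] at h2
    simp only [not_false_eq_true, S.map_const] at h2
    exact h2

theorem holds_map (S : NonstandardExtension.{w}) {X Y : Type} (f : X → Y) (p : Y → Prop)
    (ξ : S.star X) : S.Holds p (S.map f ξ) ↔ S.Holds (fun x => p (f x)) ξ := by
  rw [Holds, Holds, S.map_map]

/-- The ultrafilter of all `a ⊆ X` with `ξ ∈ *a`. -/
def ultrafilter (S : NonstandardExtension.{w}) {X : Type} (ξ : S.star X) : Ultrafilter X :=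
  Ultrafilter.ofComplNotMemIff
    { sets := {a | S.Holds (fun x => x ∈ a) ξ}
      univ_sets := S.holds_of_forall (fun x => Set.mem_univ x) ξ
      sets_of_superset := fun ha hab => Holds.mono ha (fun _ hx => hab hx)
      inter_sets := fun ha hb => Holds.and ha hb }
    (fun a => by
      change ¬ S.Holds (fun x => ¬ x ∈ a) ξ ↔ S.Holds (fun x => x ∈ a) ξ
      rw [S.holds_not_iff, not_not])

theorem mem_ultrafilter (S : NonstandardExtension.{w}) {X : Type} (ξ : S.star X) (a : Set X) :
    a ∈ S.ultrafilter ξ ↔ S.Holds (fun x => x ∈ a) ξ := Iff.rfl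

theorem isSt_map_iff (S : NonstandardExtension.{w}) {X Y : Type} [TopologicalSpace Y]
    (f : X → Y) (ξ : S.star X) (y : Y) :
    S.IsSt (S.map f ξ) y ↔ Filter.Tendsto f (S.ultrafilter ξ) (𝓝 y) := by
  refine forall₂_congr fun u _ => ?_
  rw [S.holds_map]
  rfl

theorem isSt_st (S : NonstandardExtension.{w}) {X : Type} [TopologicalSpace X] [Zero X]
    {ξ : S.star X} (h : S.IsNearstandard ξ) : S.IsSt ξ (S.st ξ) := by
  rw [st, dif_pos h]
  exact h.choose_spec

theorem isNearstandard_map_of_mem_Icc (S : NonstandardExtension.{w}) {X : Type} (f : X → ℝ)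
    (ξ : S.star X) (a b : ℝ) (h : ∀ x, f x ∈ Set.Icc a b) : S.IsNearstandard (S.map f ξ) := by
  obtain ⟨y, -, hy⟩ := (isCompact_Icc (a := a) (b := b)).ultrafilter_le_nhds
    ((S.ultrafilter ξ).map f) (by
      rw [Filter.le_principal_iff]
      exact S.holds_of_forall (p := fun x => f x ∈ Set.Icc a b) h ξ)
  exact ⟨y, (S.isSt_map_iff f ξ y).2 hy⟩

end NonstandardExtension

/-! ## Samplings and scales -/

/-- A triple `(V, A, Ω)` of a finite-dimensional subspace `V` of `H`, a symmetric operator `A` on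
`V`, and an orthonormal basis `Ω` of `V` that consists of eigenvectors of `A`.
By transfer, a point of `*(FiniteSampling 𝕜 H)` is an internal triple `(H̃, Ã, Ω̃)` of a
hyperfinite-dimensional subspace of `*H`, a `*`-linear symmetric operator on it, and an orthonormal
`*`-basis of eigenvectors. -/
structure FiniteSampling (𝕜 H : Type) [RCLike 𝕜] [NormedAddCommGroup H]
    [InnerProductSpace 𝕜 H] where
  V : Submodule 𝕜 H
  finiteDimensional : FiniteDimensional 𝕜 V
  A : V →ₗ[𝕜] V
  isSymmetric : A.IsSymmetric
  Ω : Finset H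
  orthonormal : Orthonormal 𝕜 (fun f : Ω => (f : H))
  span_eq : Submodule.span 𝕜 (Ω : Set H) = V
  hasEigenvector : ∀ (f : H) (hf : f ∈ V), f ∈ Ω →
    ∃ lam : 𝕜, Module.End.HasEigenvector A lam ⟨f, hf⟩

/-- The graph of the operator of a finite sampling. -/
def FiniteSampling.graph {𝕜 H : Type} [RCLike 𝕜] [NormedAddCommGroup H] [InnerProductSpace 𝕜 H]
    (σ : FiniteSampling 𝕜 H) : Set (H × H) :=
  {p | ∃ x : σ.V, p = ((x : H), (σ.A x : H))}

/-- Finite sequences `(e_j)` in `H` and `(c_j)` in `[0, ∞)` of the same length `N`, indexed by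
`0 ≤ j < N` (values at other indices are irrelevant), with `∑ c_j ‖e_j‖² = 1`.
A point of `*(FiniteScale H)` is a pair of hyperfinite sequences with this property. -/
structure FiniteScale (H : Type) [NormedAddCommGroup H] where
  N : ℕ
  e : ℕ → H
  c : ℕ → ℝ≥0
  sum_eq_one : ∑ j ∈ Finset.range N, (c j : ℝ) * ‖e j‖ ^ 2 = 1

/-- The internal triple `σ` is a sampling for `A`: `G(A) ⊆ st(G(Ã))`. -/
def IsSampling (S : NonstandardExtension.{w}) {𝕜 H : Type} [RCLike 𝕜] [NormedAddCommGroup H]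
    [InnerProductSpace 𝕜 H] (A : H →ₗ.[𝕜] H) (σ : S.star (FiniteSampling 𝕜 H)) : Prop :=
  ∀ x : A.domain, ∃ ξ η : S.star H,
    S.Holds₂ (fun p τ => p ∈ FiniteSampling.graph τ) (S.pair ξ η) σ ∧
      S.IsSt ξ (x : H) ∧ S.IsSt η (A x)

/-- The hyperfinite sequences in `s` form a standard-biased scale. -/
structure IsStandardBiasedScale (S : NonstandardExtension.{w}) (𝕜 : Type) {H : Type} [RCLike 𝕜]
    [NormedAddCommGroup H] [InnerProductSpace 𝕜 H] (s : S.star (FiniteScale H)) : Prop where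
  infinite : S.IsInfinite (S.map (fun t => t.N) s)
  nearstandard_e : ∀ j : ℕ, S.IsNearstandard (S.map (fun t => t.e j) s)
  nearstandard_c : ∀ j : ℕ, S.IsNearstandard (S.map (fun t => (t.c j : ℝ)) s)
  st_ne_zero : ∀ j : ℕ, S.st (S.map (fun t => ((t.c j : ℝ) : 𝕜) • t.e j) s) ≠ 0
  dense_span : Dense (Submodule.span 𝕜
    (Set.range fun j : ℕ => S.st (S.map (fun t : FiniteScale H => t.e j) s)) : Set H)
  bias : ∀ K : S.star ℕ, S.IsInfinite K →
    S.IsSt (S.map (fun p : FiniteScale H × ℕ =>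
      ∑ j ∈ Finset.Ico p.2 p.1.N, (p.1.c j : ℝ) * ‖p.1.e j‖ ^ 2) (S.pair s K)) 0

/-- The scale `s` is compatible with the sampling `σ`. -/
structure IsCompatible (S : NonstandardExtension.{w}) {𝕜 H : Type} [RCLike 𝕜]
    [NormedAddCommGroup H] [InnerProductSpace 𝕜 H] (σ : S.star (FiniteSampling 𝕜 H))
    (s : S.star (FiniteScale H)) : Prop where
  mem : S.Holds₂ (fun (τ : FiniteSampling 𝕜 H) (t : FiniteScale H) =>
    ∀ j < t.N, t.e j ∈ τ.V) σ s
  nearstandard : ∀ j : ℕ, ∃ η : S.star H,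
    S.Holds₂ (fun p τ => p ∈ FiniteSampling.graph τ) (S.pair (S.map (fun t => t.e j) s) η) σ ∧
      S.IsNearstandard η
  detects : S.Holds₂ (fun (τ : FiniteSampling 𝕜 H) (t : FiniteScale H) =>
    ∀ f ∈ τ.Ω, ∃ j < t.N, 0 < t.c j ∧ ⟪f, t.e j⟫_𝕜 ≠ 0) σ s

/-! ## The internal measure, transform and pseudometric (before taking stars) -/

namespace FiniteScale

/-- `μ(F) = ∑_j c_j ∑_{f ∈ F} |(e_j, f)|²`. -/
def mass (𝕜 : Type) {H : Type} [RCLike 𝕜] [NormedAddCommGroup H] [InnerProductSpace 𝕜 H]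
    (t : FiniteScale H) (F : Finset H) : ℝ :=
  ∑ j ∈ Finset.range t.N, (t.c j : ℝ) * ∑ f ∈ F, ‖⟪f, t.e j⟫_𝕜‖ ^ 2

/-- `(U x)(f) = (x, f) / √μ({f})`, where `(x, f)` is linear in `x`. -/
def transform (𝕜 : Type) {H : Type} [RCLike 𝕜] [NormedAddCommGroup H] [InnerProductSpace 𝕜 H]
    (t : FiniteScale H) (x f : H) : 𝕜 :=
  ⟪f, x⟫_𝕜 / ((√(t.mass 𝕜 {f}) : ℝ) : 𝕜)

/-- `d(f, g) = ∑_j c_j^{3/2} ‖e_j‖² |(U e_j)(f) - (U e_j)(g)|`. -/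
def pdist (𝕜 : Type) {H : Type} [RCLike 𝕜] [NormedAddCommGroup H] [InnerProductSpace 𝕜 H]
    (t : FiniteScale H) (f g : H) : ℝ :=
  ∑ j ∈ Finset.range t.N, (t.c j : ℝ) ^ (3 / 2 : ℝ) * ‖t.e j‖ ^ 2 *
    ‖t.transform 𝕜 (t.e j) f - t.transform 𝕜 (t.e j) g‖

theorem sqrt_mul_norm_transform_le (𝕜 : Type) {H : Type} [RCLike 𝕜] [NormedAddCommGroup H]
    [InnerProductSpace 𝕜 H] (t : FiniteScale H) (f : H) {j : ℕ} (hj : j < t.N) :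
    √(t.c j : ℝ) * ‖t.transform 𝕜 (t.e j) f‖ ≤ 1 := by
  have hle : (t.c j : ℝ) * ‖⟪f, t.e j⟫_𝕜‖ ^ 2 ≤ t.mass 𝕜 {f} := by
    simp only [mass, Finset.sum_singleton]
    exact Finset.single_le_sum (f := fun j => (t.c j : ℝ) * ‖⟪f, t.e j⟫_𝕜‖ ^ 2)
      (fun i _ => by positivity) (Finset.mem_range.2 hj)
  have h1 : √(t.c j : ℝ) * ‖⟪f, t.e j⟫_𝕜‖ ≤ √(t.mass 𝕜 {f}) := by
    refine Real.le_sqrt_of_sq_le ?_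
    rwa [mul_pow, Real.sq_sqrt (t.c j).coe_nonneg]
  rw [transform, norm_div, RCLike.norm_ofReal, abs_of_nonneg (Real.sqrt_nonneg _), ← mul_div_assoc]
  exact div_le_one_of_le₀ h1 (Real.sqrt_nonneg _)

theorem pdist_mem_Icc (𝕜 : Type) {H : Type} [RCLike 𝕜] [NormedAddCommGroup H]
    [InnerProductSpace 𝕜 H] (t : FiniteScale H) (f g : H) : t.pdist 𝕜 f g ∈ Set.Icc 0 2 := by
  refine ⟨Finset.sum_nonneg fun j _ => by positivity, ?_⟩
  calc t.pdist 𝕜 f g ≤ ∑ j ∈ Finset.range t.N, 2 * ((t.c j : ℝ) * ‖t.e j‖ ^ 2) := by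
        refine Finset.sum_le_sum fun j hj => ?_
        have hf := t.sqrt_mul_norm_transform_le 𝕜 f (Finset.mem_range.1 hj)
        have hg := t.sqrt_mul_norm_transform_le 𝕜 g (Finset.mem_range.1 hj)
        have h1 : √(t.c j : ℝ) * ‖t.transform 𝕜 (t.e j) f - t.transform 𝕜 (t.e j) g‖ ≤ 2 := by
          have := mul_le_mul_of_nonneg_left
            (norm_sub_le (t.transform 𝕜 (t.e j) f) (t.transform 𝕜 (t.e j) g))
            (Real.sqrt_nonneg (t.c j : ℝ))
          linarith
        have h2 : (t.c j : ℝ) ^ (3 / 2 : ℝ) = t.c j * √(t.c j : ℝ) := by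
          rw [Real.sqrt_eq_rpow, show (3 / 2 : ℝ) = 1 + 1 / 2 by norm_num,
            Real.rpow_add_of_nonneg (t.c j).coe_nonneg (by norm_num) (by norm_num), Real.rpow_one]
        have h3 : (0 : ℝ) ≤ (t.c j : ℝ) * ‖t.e j‖ ^ 2 := by positivity
        rw [h2]
        nlinarith [mul_le_mul_of_nonneg_left h1 h3]
    _ = 2 := by rw [← Finset.mul_sum, t.sum_eq_one, mul_one]

theorem pdist_self (𝕜 : Type) {H : Type} [RCLike 𝕜] [NormedAddCommGroup H]
    [InnerProductSpace 𝕜 H] (t : FiniteScale H) (f : H) : t.pdist 𝕜 f f = 0 := by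
  simp [pdist]

theorem pdist_comm (𝕜 : Type) {H : Type} [RCLike 𝕜] [NormedAddCommGroup H]
    [InnerProductSpace 𝕜 H] (t : FiniteScale H) (f g : H) : t.pdist 𝕜 f g = t.pdist 𝕜 g f := by
  simp only [pdist, norm_sub_rev]

theorem pdist_triangle (𝕜 : Type) {H : Type} [RCLike 𝕜] [NormedAddCommGroup H]
    [InnerProductSpace 𝕜 H] (t : FiniteScale H) (f g h : H) :
    t.pdist 𝕜 f h ≤ t.pdist 𝕜 f g + t.pdist 𝕜 g h := by
  simp only [pdist]
  rw [← Finset.sum_add_distrib]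
  refine Finset.sum_le_sum fun j _ => ?_
  rw [← mul_add]
  exact mul_le_mul_of_nonneg_left (norm_sub_le_norm_sub_add_norm_sub _ _ _) (by positivity)

end FiniteScale

/-! ## The Loeb space -/

/-- The underlying set of the Loeb space: the points of the internal orthonormal basis `Ω̃`. -/
def LoebSpace (S : NonstandardExtension.{w}) {𝕜 H : Type} [RCLike 𝕜] [NormedAddCommGroup H]
    [InnerProductSpace 𝕜 H] (σ : S.star (FiniteSampling 𝕜 H)) (_s : S.star (FiniteScale H)) :
    Type w :=
  {f : S.star H // S.Holds₂ (fun f τ => f ∈ FiniteSampling.Ω τ) f σ}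

namespace LoebSpace

variable {S : NonstandardExtension.{w}} {𝕜 H : Type} [RCLike 𝕜] [NormedAddCommGroup H]
  [InnerProductSpace 𝕜 H]

/-- The Loeb outer measure: the largest outer measure whose value on each internal subset
`F ⊆ Ω̃` is at most `st(μ̃(F))`. -/
def outerMeasure (σ : S.star (FiniteSampling 𝕜 H)) (s : S.star (FiniteScale H)) :
    OuterMeasure (LoebSpace S σ s) :=
  OuterMeasure.boundedBy fun E =>
    ⨅ (F : S.star (Finset H)) (_ : S.Holds₂ (fun F τ => F ⊆ FiniteSampling.Ω τ) F σ)
      (_ : E = {f : LoebSpace S σ s | S.Holds₂ (fun f F => f ∈ F) f.1 F}),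
      ENNReal.ofReal (S.st (S.map (fun p : FiniteScale H × Finset H => p.1.mass 𝕜 p.2)
        (S.pair s F)))

/-- The Loeb-measurable sets. -/
instance (σ : S.star (FiniteSampling 𝕜 H)) (s : S.star (FiniteScale H)) :
    MeasurableSpace (LoebSpace S σ s) :=
  (outerMeasure σ s).caratheodory

/-- The Loeb measure `μ_L`. -/
def measure (σ : S.star (FiniteSampling 𝕜 H)) (s : S.star (FiniteScale H)) :
    Measure (LoebSpace S σ s) :=
  (outerMeasure σ s).toMeasure le_rfl

/-- The value `(Ũ x)(f)` of the internal transform at an internal point `x` of `*H`. -/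
def transform {σ : S.star (FiniteSampling 𝕜 H)} {s : S.star (FiniteScale H)} (x : S.star H)
    (f : LoebSpace S σ s) : S.star 𝕜 :=
  S.map (fun p : FiniteScale H × H × H => p.1.transform 𝕜 p.2.1 p.2.2) (S.pair s (S.pair x f.1))

/-- The internal pseudometric `d̃`. -/
def idist {σ : S.star (FiniteSampling 𝕜 H)} {s : S.star (FiniteScale H)}
    (f g : LoebSpace S σ s) : S.star ℝ :=
  S.map (fun p : FiniteScale H × H × H => p.1.pdist 𝕜 p.2.1 p.2.2) (S.pair s (S.pair f.1 g.1))

theorem exists_common {σ : S.star (FiniteSampling 𝕜 H)} {s : S.star (FiniteScale H)}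
    (f g h : LoebSpace S σ s) : ∃ ζ : S.star (FiniteScale H × H × H × H),
      S.map (fun p => p.1) ζ = s ∧ S.map (fun p => p.2.1) ζ = f.1 ∧
        S.map (fun p => p.2.2.1) ζ = g.1 ∧ S.map (fun p => p.2.2.2) ζ = h.1 := by
  refine ⟨S.pair s (S.pair f.1 (S.pair g.1 h.1)), S.map_fst_pair _ _, ?_, ?_, ?_⟩
  · rw [← S.map_map Prod.fst Prod.snd, S.map_snd_pair, S.map_fst_pair]
  · rw [← S.map_map (fun q : H × H × H => q.2.1) Prod.snd, S.map_snd_pair,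
      ← S.map_map Prod.fst Prod.snd, S.map_snd_pair, S.map_fst_pair]
  · rw [← S.map_map (fun q : H × H × H => q.2.2) Prod.snd, S.map_snd_pair,
      ← S.map_map Prod.snd Prod.snd, S.map_snd_pair, S.map_snd_pair]

theorem isSt_idist {σ : S.star (FiniteSampling 𝕜 H)} {s : S.star (FiniteScale H)}
    (f g : LoebSpace S σ s) {P : Type} (ζ : S.star P) (t : P → FiniteScale H) (a b : P → H)
    (ht : S.map t ζ = s) (ha : S.map a ζ = f.1) (hb : S.map b ζ = g.1) :
    Filter.Tendsto (fun p => (t p).pdist 𝕜 (a p) (b p)) (S.ultrafilter ζ)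
      (𝓝 (S.st (idist f g))) := by
  have h1 : S.pair s (S.pair f.1 g.1) = S.map (fun p => (t p, a p, b p)) ζ := by
    rw [← S.pair_map (S.map (fun p => (t p, a p, b p)) ζ), S.map_map, S.map_map,
      ← S.pair_map (S.map (fun p => (a p, b p)) ζ), S.map_map, S.map_map]
    simp only [ht, ha, hb]
  rw [← S.isSt_map_iff]
  have h2 : S.map (fun p => (t p).pdist 𝕜 (a p) (b p)) ζ = idist f g := by
    rw [idist, h1, S.map_map]
  rw [h2]
  exact S.isSt_st (S.isNearstandard_map_of_mem_Icc _ _ 0 2 fun p => p.1.pdist_mem_Icc 𝕜 _ _)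

/-- The pseudometric `st ∘ d̃` on the Loeb space. -/
instance (σ : S.star (FiniteSampling 𝕜 H)) (s : S.star (FiniteScale H)) :
    PseudoMetricSpace (LoebSpace S σ s) where
  dist f g := S.st (idist f g)
  dist_self f := by
    obtain ⟨ζ, h0, h1, -, -⟩ := exists_common f f f
    refine tendsto_nhds_unique (isSt_idist f f ζ _ _ _ h0 h1 h1) ?_
    simp only [FiniteScale.pdist_self]
    exact tendsto_const_nhds
  dist_comm f g := by
    obtain ⟨ζ, h0, h1, h2, -⟩ := exists_common f g g
    refine tendsto_nhds_unique (isSt_idist f g ζ _ _ _ h0 h1 h2) ?_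
    simpa only [FiniteScale.pdist_comm] using isSt_idist g f ζ _ _ _ h0 h2 h1
  dist_triangle f g h := by
    obtain ⟨ζ, h0, h1, h2, h3⟩ := exists_common f g h
    exact le_of_tendsto_of_tendsto' (isSt_idist f h ζ _ _ _ h0 h1 h3)
      ((isSt_idist f g ζ _ _ _ h0 h1 h2).add (isSt_idist g h ζ _ _ _ h0 h2 h3))
      (fun p => p.1.pdist_triangle 𝕜 _ _ _)

end LoebSpace

/-! ## The hull space and the induced isometry -/

/-- The hull space `Ω̂`: the quotient of the Loeb space by `f ∼ g ↔ d̃(f, g) ≃ 0`, with the metric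
induced by `st ∘ d̃`. -/
def HullSpace (S : NonstandardExtension.{w}) {𝕜 H : Type} [RCLike 𝕜] [NormedAddCommGroup H]
    [InnerProductSpace 𝕜 H] (σ : S.star (FiniteSampling 𝕜 H)) (s : S.star (FiniteScale H)) :
    Type w :=
  SeparationQuotient (LoebSpace S σ s)

namespace HullSpace

variable {S : NonstandardExtension.{w}} {𝕜 H : Type} [RCLike 𝕜] [NormedAddCommGroup H]
  [InnerProductSpace 𝕜 H]

instance (σ : S.star (FiniteSampling 𝕜 H)) (s : S.star (FiniteScale H)) :
    MetricSpace (HullSpace S σ s) :=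
  inferInstanceAs (MetricSpace (SeparationQuotient (LoebSpace S σ s)))

instance (σ : S.star (FiniteSampling 𝕜 H)) (s : S.star (FiniteScale H)) :
    MeasurableSpace (HullSpace S σ s) :=
  borel _

instance (σ : S.star (FiniteSampling 𝕜 H)) (s : S.star (FiniteScale H)) :
    BorelSpace (HullSpace S σ s) :=
  ⟨rfl⟩

/-- The natural map `ν̂` from the Loeb space to the hull space. -/
def proj {σ : S.star (FiniteSampling 𝕜 H)} {s : S.star (FiniteScale H)}
    (f : LoebSpace S σ s) : HullSpace S σ s :=
  SeparationQuotient.mk f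

/-- The pushforward `μ̂` of the Loeb measure to the Borel sets of the hull space. -/
def measure (σ : S.star (FiniteSampling 𝕜 H)) (s : S.star (FiniteScale H)) :
    Measure (HullSpace S σ s) :=
  (LoebSpace.measure σ s).map proj

end HullSpace

/-- `U : H → L₂(Ω̂, μ̂)` is the isometry induced by `σ` and `s`, i.e. the unique one with
`(U x) ∘ ν̂ = U_L x = st ∘ Ũ(*x)` `μ_L`-almost everywhere for all `x`; almost everywhere in this
equation, `Ũ(*x)` has a standard part. -/
def IsInducedIsometry (S : NonstandardExtension.{w}) {𝕜 H : Type} [RCLike 𝕜]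
    [NormedAddCommGroup H] [InnerProductSpace 𝕜 H] (σ : S.star (FiniteSampling 𝕜 H))
    (s : S.star (FiniteScale H)) (U : H →ₗᵢ[𝕜] Lp 𝕜 2 (HullSpace.measure σ s)) : Prop :=
  ∀ x : H, ∀ᵐ f ∂(LoebSpace.measure σ s),
    S.IsSt (LoebSpace.transform (S.std x) f) (U x (HullSpace.proj f))

end

/-!
The sampling and the scale are built so that the hull space embeds into the space of sign sequences
and `U` sends the scale vectors to Walsh functions.

*Spectral part.* For self-adjoint `A`, the operators `T = (1 + A²)⁻¹` and `C = A T` are bounded,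
self-adjoint and commute, and the range of `T` is a core for `A` (`exists_boundedTransform`). They
lie in a maximal family `M` of commuting self-adjoint operators. Such a family contains the spectral
projections of its members (`exists_spectral_splitting`, proved with real polynomials only, hence
over both fields), so the reflections `R = 2 P - 1` in `M` span enough operators to generate the
same closed subspaces as `M`, and on a separable space `M` has a cyclic vector `z`
(`exists_cyclicSubspace_eq_top`). Countably many reflections `R j`, closed under multiplication,
suffice. Put `e j = T (R j z)`, normalised. Splitting `z` by the joint eigenspaces of
`R 0, …, R n` and applying `T` to the pieces gives a finite orthonormal set `Ω n`, along which the
coordinates of `e j`, `j ≤ n`, agree with those of `e 0` up to sign. This is the structure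
`SignSystem` (`nonempty_signSystem`).

*Nonstandard part.* The sampling is the span of `Ω n` with the compression of `A`, and the scale
consists of `e 0, …, e n` with weights `2⁻ʲ⁻¹` (the last one doubled), both taken at an infinite
`n = K`. As all `e j` have the same absolute coordinates, `μ̃ {f} = |(e 0, f)|²`, and the transforms
`Ũ (e j)` take only the values `1` and `-1`. Therefore the hull space embeds into the Cantor space
`ℕ → Bool` (`SignSystem.isInducing_hullSign`), and the transform of `e j` becomes the `j`-th
coordinate sign, a Walsh function. The Loeb measure of an internal set is the standard part of its
mass (`SignSystem.measure_ext`, from saturation), so the Walsh functions have the same Gram matrix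
as the `e j` (`SignSystem.inner_walsh`); this gives an isometry `U`. It is the induced one on
`span e` by construction, and everywhere by Chebyshev's inequality, used for `Ũ` and for `U`
(`SignSystem.isInducedIsometry`).

*Surjectivity.* The Walsh functions are closed under multiplication and generate the Borel sets of
the hull space, so by a π-λ argument a function orthogonal to all of them vanishes
(`SignSystem.ae_eq_zero_of_integral_walsh_mul_eq_zero`). The range of `U` is closed, hence it is
everything.
-/

noncomputable section

/-! ### Real polynomials of a bounded self-adjoint operator -/

section SelfAdjoint

variable {𝕜 H : Type*} [RCLike 𝕜] [NormedAddCommGroup H] [InnerProductSpace 𝕜 H]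

/-- The operator `q(S)` for a real polynomial `q`. -/
def realPolyOp (S : H →L[𝕜] H) (q : Polynomial ℝ) : H →L[𝕜] H :=
  Polynomial.aeval S (q.map (algebraMap ℝ 𝕜))

theorem realPolyOp_sub (S : H →L[𝕜] H) (p q : Polynomial ℝ) :
    realPolyOp S (p - q) = realPolyOp S p - realPolyOp S q := by
  simp [realPolyOp]

theorem realPolyOp_mul (S : H →L[𝕜] H) (p q : Polynomial ℝ) :
    realPolyOp S (p * q) = realPolyOp S p * realPolyOp S q := by
  simp [realPolyOp]

theorem realPolyOp_X (S : H →L[𝕜] H) : realPolyOp S Polynomial.X = S := by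
  simp [realPolyOp]

theorem realPolyOp_C (S : H →L[𝕜] H) (c : ℝ) :
    realPolyOp S (Polynomial.C c) = (c : 𝕜) • (1 : H →L[𝕜] H) := by
  simp [realPolyOp, Algebra.algebraMap_eq_smul_one]

theorem Commute.realPolyOp_right {L S : H →L[𝕜] H} (h : Commute L S) (q : Polynomial ℝ) :
    Commute L (realPolyOp S q) := by
  unfold realPolyOp
  generalize q.map (algebraMap ℝ 𝕜) = r
  induction r using Polynomial.induction_on' with
  | add p q hp hq => simpa using hp.add_right hq
  | monomial n a =>
    rw [Polynomial.aeval_monomial]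
    exact (show Commute L _ from (Algebra.commutes a L).symm).mul_right (h.pow_right n)

theorem IsSelfAdjoint.realPolyOp [CompleteSpace H] {S : H →L[𝕜] H} (hS : IsSelfAdjoint S)
    (q : Polynomial ℝ) : IsSelfAdjoint (realPolyOp S q) := by
  induction q using Polynomial.induction_on' with
  | add p q hp hq =>
    have : _root_.realPolyOp S (p + q) = _root_.realPolyOp S p + _root_.realPolyOp S q := by
      simp [_root_.realPolyOp]
    rw [this]
    exact hp.add hq
  | monomial n a =>
    have : _root_.realPolyOp S (Polynomial.monomial n a) = (a : 𝕜) • S ^ n := by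
      rw [_root_.realPolyOp, Polynomial.map_monomial, Polynomial.aeval_monomial,
        Algebra.algebraMap_eq_smul_one, smul_mul_assoc, one_mul]
    rw [this]
    exact IsSelfAdjoint.smul (RCLike.conj_ofReal a) (hS.pow n)

/-- A polynomial that is nonnegative on an interval containing the spectrum of `S` gives a
positive operator. The vectors `x, S x, …, S ^ d x` span a finite-dimensional space on which the
compression of `S` agrees with `S` up to degree `d`, so that the finite-dimensional spectral
theorem applies. -/
theorem re_inner_realPolyOp_nonneg {S : H →L[𝕜] H} (hS : (S : H →ₗ[𝕜] H).IsSymmetric)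
    {q : Polynomial ℝ} (hq : ∀ t ∈ Set.Icc (-‖S‖) ‖S‖, 0 ≤ q.eval t) (x : H) :
    0 ≤ RCLike.re ⟪realPolyOp S q x, x⟫_𝕜 := by
  set d := q.natDegree
  set W : Submodule 𝕜 H := Submodule.span 𝕜 ((fun k : ℕ => (S ^ k) x) '' Set.Iic d) with hW
  have : FiniteDimensional 𝕜 W := by
    rw [hW]
    exact FiniteDimensional.span_of_finite 𝕜 ((Set.finite_Iic d).image _)
  have hmem : ∀ k ≤ d, (S ^ k) x ∈ W := fun k hk => Submodule.subset_span ⟨k, hk, rfl⟩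
  let R : W →ₗ[𝕜] W := (W.orthogonalProjectionOnto : H →ₗ[𝕜] W) ∘ₗ (S : H →ₗ[𝕜] H) ∘ₗ W.subtype
  have hR : R.IsSymmetric := by
    intro a b
    have h1 := hS (a : H) (b : H)
    simp only [R, LinearMap.comp_apply, ContinuousLinearMap.coe_coe, Submodule.subtype_apply]
      at h1 ⊢
    rw [Submodule.inner_orthogonalProjectionOnto_eq_of_mem_right,
      Submodule.inner_orthogonalProjectionOnto_eq_of_mem_left]
    exact h1
  let y : W := ⟨x, by simpa using hmem 0 (Nat.zero_le _)⟩
  have hpow : ∀ k ≤ d, (((R ^ k) y : W) : H) = (S ^ k) x := by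
    intro k
    induction k with
    | zero => intro _; simp [y]
    | succ k ih =>
      intro hk
      have h1 := ih (by omega)
      rw [pow_succ', pow_succ', Module.End.mul_apply, mul_apply_eq_comp]
      simp only [R, LinearMap.comp_apply, ContinuousLinearMap.coe_coe, Submodule.subtype_apply]
      simp only [R] at h1
      rw [h1]
      have h2 : S ((S ^ k) x) ∈ W := by
        have := hmem (k + 1) hk
        rwa [pow_succ', mul_apply_eq_comp] at this
      exact Submodule.starProjection_eq_self_iff.2 h2
  set r : Polynomial 𝕜 := q.map (algebraMap ℝ 𝕜) with hr
  have hdeg : r.natDegree = d := Polynomial.natDegree_map _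
  have hpoly : ((Polynomial.aeval R r y : W) : H) = realPolyOp S q x := by
    rw [realPolyOp, ← hr, Polynomial.aeval_eq_sum_range, Polynomial.aeval_eq_sum_range,
      LinearMap.sum_apply, _root_.sum_apply, AddSubmonoidClass.coe_finsetSum]
    refine Finset.sum_congr rfl fun k hk => ?_
    have hk' : k ≤ d := by rw [Finset.mem_range, hdeg] at hk; omega
    simp [hpow k hk']
  let b := hR.eigenvectorBasis rfl
  have hev := hR.hasEigenvector_eigenvectorBasis (n := Module.finrank 𝕜 W) rfl
  have hbound : ∀ i, hR.eigenvalues rfl i ∈ Set.Icc (-‖S‖) ‖S‖ := by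
    intro i
    rw [Set.mem_Icc, ← abs_le]
    have h1 : R (b i) = (hR.eigenvalues rfl i : 𝕜) • b i := hR.apply_eigenvectorBasis rfl i
    have h2 : ‖R (b i)‖ = |hR.eigenvalues rfl i| := by
      rw [h1, norm_smul, RCLike.norm_ofReal, b.norm_eq_one, mul_one]
    rw [← h2]
    calc ‖R (b i)‖ ≤ ‖S (b i)‖ := Submodule.norm_orthogonalProjectionOnto_apply_le W _
      _ ≤ ‖S‖ * ‖(b i : H)‖ := S.le_opNorm _
      _ = ‖S‖ := by rw [Submodule.norm_coe, b.norm_eq_one, mul_one]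
  have hb : ∀ i, (Polynomial.aeval R r) (b i)
      = ((q.eval (hR.eigenvalues rfl i) : ℝ) : 𝕜) • b i := by
    intro i
    rw [Module.End.aeval_apply_of_hasEigenvector (hev i), hr]
    congr 1
    have := Polynomial.eval_map_apply (p := q) (algebraMap ℝ 𝕜) (hR.eigenvalues rfl i)
    simpa using this
  have hsum : Polynomial.aeval R r y
      = ∑ i, ⟪b i, y⟫_𝕜 • ((q.eval (hR.eigenvalues rfl i) : ℝ) : 𝕜) • b i := by
    conv_lhs => rw [← b.sum_repr' y]
    simp only [map_sum, map_smul, hb]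
  have hfin : ⟪realPolyOp S q x, x⟫_𝕜 = ⟪Polynomial.aeval R r y, y⟫_𝕜 := by
    rw [← hpoly, Submodule.coe_inner]
  rw [hfin, hsum, sum_inner, map_sum]
  refine Finset.sum_nonneg fun i _ => ?_
  rw [inner_smul_left, inner_smul_left, RCLike.conj_ofReal, mul_left_comm, RCLike.conj_mul,
    ← RCLike.ofReal_pow, ← RCLike.ofReal_mul, RCLike.ofReal_re]
  exact mul_nonneg (hq _ (hbound i)) (by positivity)

theorem IsSelfAdjoint.inner_apply_left [CompleteSpace H] {S : H →L[𝕜] H} (hS : IsSelfAdjoint S)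
    (x y : H) : ⟪S x, y⟫_𝕜 = ⟪x, S y⟫_𝕜 :=
  hS.isSymmetric x y

/-- Positivity of `ε² - q(S)²`. -/
theorem norm_realPolyOp_apply_le [CompleteSpace H] {S : H →L[𝕜] H} (hS : IsSelfAdjoint S)
    {q : Polynomial ℝ} {ε : ℝ} (hε : 0 ≤ ε) (hq : ∀ t ∈ Set.Icc (-‖S‖) ‖S‖, |q.eval t| ≤ ε)
    (x : H) : ‖realPolyOp S q x‖ ≤ ε * ‖x‖ := by
  have h1 := re_inner_realPolyOp_nonneg hS.isSymmetric (q := Polynomial.C (ε ^ 2) - q * q)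
    (fun t ht => by
      have := sq_le_sq' (abs_le.1 (hq t ht)).1 (abs_le.1 (hq t ht)).2
      simp only [Polynomial.eval_sub, Polynomial.eval_C, Polynomial.eval_mul]
      nlinarith) x
  rw [realPolyOp_sub, realPolyOp_C, realPolyOp_mul, _root_.sub_apply, inner_sub_left, map_sub,
    mul_apply_eq_comp, (hS.realPolyOp q).inner_apply_left, inner_self_eq_norm_sq,
    _root_.smul_apply, inner_smul_left, RCLike.conj_ofReal, RCLike.re_ofReal_mul,
    one_apply_eq_self, inner_self_eq_norm_sq, ← mul_pow] at h1
  exact (sq_le_sq₀ (norm_nonneg _) (by positivity)).1 (by linarith)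

theorem norm_realPolyOp_le [CompleteSpace H] {S : H →L[𝕜] H} (hS : IsSelfAdjoint S)
    {q : Polynomial ℝ} {ε : ℝ} (hε : 0 ≤ ε) (hq : ∀ t ∈ Set.Icc (-‖S‖) ‖S‖, |q.eval t| ≤ ε) :
    ‖realPolyOp S q‖ ≤ ε :=
  ContinuousLinearMap.opNorm_le_bound _ hε (norm_realPolyOp_apply_le hS hε hq)

/-! ### Positive part and spectral splitting -/

/-- The positive part of a bounded self-adjoint operator, as a norm limit of polynomials. -/
theorem exists_positive_part [CompleteSpace H] {S : H →L[𝕜] H} (hS : IsSelfAdjoint S) :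
    ∃ B : H →L[𝕜] H, IsSelfAdjoint B ∧ (∀ L, Commute L S → Commute L B) ∧
      (∀ x, 0 ≤ RCLike.re ⟪B x, x⟫_𝕜) ∧ (∀ x, 0 ≤ RCLike.re ⟪(B - S) x, x⟫_𝕜) ∧
      B * (B - S) = 0 := by
  set r := ‖S‖
  have hr : 0 ≤ r := norm_nonneg _
  have happrox : ∀ n : ℕ, ∃ p : Polynomial ℝ, ∀ t ∈ Set.Icc (-r) r,
      |p.eval t - max t 0| < 1 / ((n : ℝ) + 1) := fun n =>
    exists_polynomial_near_of_continuousOn (-r) r (fun t => max t 0)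
      (by fun_prop) _ (by positivity)
  choose p hp using happrox
  have hlim : Filter.Tendsto (fun n : ℕ => 1 / ((n : ℝ) + 1)) Filter.atTop (𝓝 0) :=
    tendsto_one_div_add_atTop_nhds_zero_nat
  have hcauchy : CauchySeq fun n => realPolyOp S (p n) := by
    refine cauchySeq_of_le_tendsto_0 (fun n : ℕ => 2 * (1 / ((n : ℝ) + 1))) (fun n m N hn hm => ?_)
      (by simpa using hlim.const_mul 2)
    rw [dist_eq_norm, ← realPolyOp_sub]
    refine norm_realPolyOp_le hS (by positivity) fun t ht => ?_
    have h1 := (hp n t ht).le.trans (one_div_le_one_div_of_le (by positivity)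
      (by exact_mod_cast Nat.succ_le_succ hn : (N : ℝ) + 1 ≤ n + 1))
    have h2 := (hp m t ht).le.trans (one_div_le_one_div_of_le (by positivity)
      (by exact_mod_cast Nat.succ_le_succ hm : (N : ℝ) + 1 ≤ m + 1))
    rw [Polynomial.eval_sub]
    rw [abs_le] at h1 h2 ⊢
    constructor <;> linarith [h1.1, h1.2, h2.1, h2.2]
  obtain ⟨B, hB⟩ := cauchySeq_tendsto_of_complete hcauchy
  have happly : ∀ x, Filter.Tendsto (fun n => realPolyOp S (p n) x) Filter.atTop (𝓝 (B x)) :=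
    fun x => ((ContinuousLinearMap.apply 𝕜 H x).continuous.tendsto B).comp hB
  refine ⟨B, ?_, fun L hL => ?_, fun x => ?_, fun x => ?_, ?_⟩
  · exact (isClosed_eq continuous_star continuous_id :
      IsClosed {T : H →L[𝕜] H | star T = T}).mem_of_tendsto hB
      (Filter.Eventually.of_forall fun n => hS.realPolyOp (p n))
  · exact tendsto_nhds_unique ((hB.const_mul L).congr fun n => (hL.realPolyOp_right (p n)).eq)
      (hB.mul_const L)
  · have h1 : Filter.Tendsto (fun n : ℕ => RCLike.re ⟪realPolyOp S (p n) x, x⟫_𝕜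
        + 1 / ((n : ℝ) + 1) * ‖x‖ ^ 2) Filter.atTop
        (𝓝 (RCLike.re ⟪B x, x⟫_𝕜 + 0 * ‖x‖ ^ 2)) :=
      ((RCLike.continuous_re.tendsto _).comp ((happly x).inner tendsto_const_nhds)).add
        (hlim.mul_const _)
    rw [zero_mul, add_zero] at h1
    refine ge_of_tendsto' h1 fun n => ?_
    have h2 := re_inner_realPolyOp_nonneg hS.isSymmetric
      (q := p n - Polynomial.C (-(1 / ((n : ℝ) + 1)))) (fun t ht => by
        have := (abs_lt.1 (hp n t ht)).1
        have := le_max_right t 0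
        simp only [Polynomial.eval_sub, Polynomial.eval_C]
        linarith) x
    rw [realPolyOp_sub, realPolyOp_C, _root_.sub_apply, inner_sub_left, map_sub,
      _root_.smul_apply, inner_smul_left, RCLike.conj_ofReal, RCLike.re_ofReal_mul,
      one_apply_eq_self, inner_self_eq_norm_sq] at h2
    linarith
  · have h1 : Filter.Tendsto (fun n : ℕ => RCLike.re ⟪(realPolyOp S (p n) - S) x, x⟫_𝕜
        + 1 / ((n : ℝ) + 1) * ‖x‖ ^ 2) Filter.atTop
        (𝓝 (RCLike.re ⟪(B - S) x, x⟫_𝕜 + 0 * ‖x‖ ^ 2)) :=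
      ((RCLike.continuous_re.tendsto _).comp
        (((happly x).sub_const (S x)).inner tendsto_const_nhds)).add (hlim.mul_const _)
    rw [zero_mul, add_zero] at h1
    refine ge_of_tendsto' h1 fun n => ?_
    have h2 := re_inner_realPolyOp_nonneg hS.isSymmetric
      (q := p n - Polynomial.X - Polynomial.C (-(1 / ((n : ℝ) + 1)))) (fun t ht => by
        have := (abs_lt.1 (hp n t ht)).1
        have := le_max_left t 0
        simp only [Polynomial.eval_sub, Polynomial.eval_C, Polynomial.eval_X]
        linarith) x
    rw [realPolyOp_sub, realPolyOp_sub, realPolyOp_X, realPolyOp_C, _root_.sub_apply,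
      inner_sub_left, map_sub,
      _root_.smul_apply, inner_smul_left, RCLike.conj_ofReal, RCLike.re_ofReal_mul,
      one_apply_eq_self, inner_self_eq_norm_sq] at h2
    linarith
  · have h1 : Filter.Tendsto (fun n => realPolyOp S (p n * (p n - Polynomial.X))) Filter.atTop
        (𝓝 (B * (B - S))) := by
      simp only [realPolyOp_mul, realPolyOp_sub, realPolyOp_X]
      exact hB.mul (hB.sub_const S)
    refine tendsto_nhds_unique h1 (squeeze_zero_norm (a := fun n : ℕ =>
      (2 * r + 2) * (1 / ((n : ℝ) + 1))) (fun n => ?_) (by simpa using hlim.const_mul (2 * r + 2)))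
    refine norm_realPolyOp_le hS (by positivity) fun t ht => ?_
    have h2 := (hp n t ht).le
    set δ := 1 / ((n : ℝ) + 1)
    have hδ : δ ≤ 1 := by
      rw [div_le_one (by positivity)]
      linarith [(n.cast_nonneg : (0 : ℝ) ≤ n)]
    have hδ0 : 0 ≤ δ := by positivity
    rw [Polynomial.eval_mul, Polynomial.eval_sub, Polynomial.eval_X, abs_mul]
    -- one factor is at most `δ`, and the other at most `2 r + δ ≤ 2 r + 2`
    rcases le_total t 0 with h0 | h0
    · rw [max_eq_right h0, sub_zero] at h2
      have h3 : |(p n).eval t - t| ≤ 2 * r + 2 := by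
        rw [abs_le] at h2 ⊢
        constructor <;> linarith [h2.1, h2.2, ht.1, ht.2]
      calc _ ≤ δ * (2 * r + 2) := mul_le_mul h2 h3 (abs_nonneg _) hδ0
        _ = _ := mul_comm _ _
    · rw [max_eq_left h0] at h2
      have h3 : |(p n).eval t| ≤ 2 * r + 2 := by
        rw [abs_le] at h2 ⊢
        constructor <;> linarith [h2.1, h2.2, ht.1, ht.2]
      exact mul_le_mul h3 h2 (abs_nonneg _) (by positivity)

/-- The orthogonal projection onto a closed subspace invariant under a self-adjoint operator
commutes with it. -/
theorem IsSelfAdjoint.commute_starProjection [CompleteSpace H] {L : H →L[𝕜] H}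
    (hL : IsSelfAdjoint L) (K : Submodule 𝕜 H) [K.HasOrthogonalProjection]
    (h : ∀ x ∈ K, L x ∈ K) : Commute L K.starProjection := by
  ext x
  rw [mul_apply_eq_comp, mul_apply_eq_comp]
  refine (Submodule.eq_starProjection_of_mem_of_inner_eq_zero
    (h _ (Submodule.starProjection_apply_mem K x)) fun y hy => ?_).symm
  rw [← map_sub, hL.inner_apply_left]
  exact Submodule.starProjection_inner_eq_zero x _ (h y hy)

/-- A bounded self-adjoint operator `S` is nonnegative on the range of a projection and
nonpositive on the orthogonal complement; the projection commutes with every self-adjoint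
operator that commutes with `S`. -/
theorem exists_spectral_splitting [CompleteSpace H] {S : H →L[𝕜] H} (hS : IsSelfAdjoint S) :
    ∃ P : H →L[𝕜] H, IsSelfAdjoint P ∧ P * P = P ∧
      (∀ L, IsSelfAdjoint L → Commute L S → Commute L P) ∧
      (∀ x, 0 ≤ RCLike.re ⟪S (P x), P x⟫_𝕜) ∧
      (∀ x, RCLike.re ⟪S (x - P x), x - P x⟫_𝕜 ≤ 0) := by
  obtain ⟨B, hB, hcomm, hpos, hneg, hmul⟩ := exists_positive_part hS
  let K : Submodule 𝕜 H := LinearMap.ker (B : H →ₗ[𝕜] H)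
  have hK : IsClosed (K : Set H) := B.isClosed_ker
  have : CompleteSpace K := hK.completeSpace_coe
  have hmem : ∀ x, x ∈ K ↔ B x = 0 := fun x => LinearMap.mem_ker
  have hQ : IsSelfAdjoint K.starProjection := isSelfAdjoint_starProjection K
  have hQQ : K.starProjection * K.starProjection = K.starProjection :=
    K.isIdempotentElem_starProjection
  -- the splitting projection is the one onto the closure of the range of `B`
  refine ⟨1 - K.starProjection, (IsSelfAdjoint.one _).sub hQ, ?_, fun L hL hLS => ?_, fun x => ?_,
    fun x => ?_⟩
  · rw [sub_mul, one_mul, mul_sub, mul_one, hQQ, sub_self, sub_zero]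
  · refine (Commute.one_right L).sub_right (hL.commute_starProjection K fun x hx => ?_)
    rw [hmem] at hx ⊢
    have := congrArg (fun T : H →L[𝕜] H => T x) (hcomm L hLS).eq
    simp only [mul_apply_eq_comp, hx, map_zero] at this
    exact this.symm
  · set y := (1 - K.starProjection) x with hy
    have horth : ∀ z ∈ K, ⟪y, z⟫_𝕜 = 0 := fun z hz =>
      Submodule.starProjection_inner_eq_zero x z hz
    have h0 : (B - S) y = 0 := by
      refine ext_inner_right 𝕜 fun z => ?_
      rw [(hB.sub hS).inner_apply_left, inner_zero_left]
      refine horth _ ((hmem _).2 ?_)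
      rw [← mul_apply_eq_comp, hmul, _root_.zero_apply]
    have h1 : S y = B y := by
      rw [_root_.sub_apply, sub_eq_zero] at h0
      exact h0.symm
    rw [h1]
    exact hpos y
  · have h1 : x - (1 - K.starProjection) x = K.starProjection x := by simp
    rw [h1]
    have h2 : B (K.starProjection x) = 0 := (hmem _).1 (Submodule.starProjection_apply_mem K x)
    have h3 := hneg (K.starProjection x)
    rw [_root_.sub_apply, h2, zero_sub, inner_neg_left, map_neg] at h3
    linarith

end SelfAdjoint

/-! ### Maximal commuting families and cyclic vectors -/

section MaximalCommuting

variable {𝕜 H : Type*} [RCLike 𝕜] [NormedAddCommGroup H] [InnerProductSpace 𝕜 H] [CompleteSpace H]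

/-- `M` is a maximal set of pairwise commuting bounded self-adjoint operators. -/
structure IsMaximalCommuting (M : Set (H →L[𝕜] H)) : Prop where
  isSelfAdjoint : ∀ S ∈ M, IsSelfAdjoint S
  commute : ∀ S ∈ M, ∀ L ∈ M, Commute S L
  mem_of_commute : ∀ S, IsSelfAdjoint S → (∀ L ∈ M, Commute L S) → S ∈ M

theorem exists_isMaximalCommuting_superset {M₀ : Set (H →L[𝕜] H)}
    (hsa : ∀ S ∈ M₀, IsSelfAdjoint S) (hcomm : ∀ S ∈ M₀, ∀ L ∈ M₀, Commute S L) :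
    ∃ M, M₀ ⊆ M ∧ IsMaximalCommuting M := by
  obtain ⟨M, hM0, hM⟩ := zorn_subset_nonempty
    {M : Set (H →L[𝕜] H) | (∀ S ∈ M, IsSelfAdjoint S) ∧ ∀ S ∈ M, ∀ L ∈ M, Commute S L}
    (fun c hc hchain _ => ⟨⋃₀ c, ⟨fun S ⟨s, hs, hS⟩ => (hc hs).1 S hS,
      fun S ⟨s, hs, hS⟩ L ⟨t, ht, hL⟩ => by
        rcases hchain.total hs ht with h | h
        · exact (hc ht).2 S (h hS) L hL
        · exact (hc hs).2 S hS L (h hL)⟩, fun s hs => Set.subset_sUnion_of_mem hs⟩) M₀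
    ⟨hsa, hcomm⟩
  refine ⟨M, hM0, hM.prop.1, hM.prop.2, fun S hS hSM => ?_⟩
  refine hM.le_of_ge (y := insert S M) ⟨?_, ?_⟩ (Set.subset_insert S M) (Set.mem_insert S M)
  · rintro L (rfl | hL)
    exacts [hS, hM.prop.1 L hL]
  · rintro L (rfl | hL) L' (rfl | hL')
    exacts [Commute.refl _, (hSM _ hL').symm, hSM _ hL, hM.prop.2 _ hL _ hL']

namespace IsMaximalCommuting

variable {M : Set (H →L[𝕜] H)} (hM : IsMaximalCommuting M)
include hM

theorem one_mem : (1 : H →L[𝕜] H) ∈ M :=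
  hM.mem_of_commute _ (IsSelfAdjoint.one _) fun L _ => Commute.one_right L

theorem mul_mem {S L : H →L[𝕜] H} (hS : S ∈ M) (hL : L ∈ M) : S * L ∈ M :=
  hM.mem_of_commute _
    (((hM.isSelfAdjoint S hS).commute_iff (hM.isSelfAdjoint L hL)).1 (hM.commute S hS L hL))
    fun X hX => (hM.commute X hX S hS).mul_right (hM.commute X hX L hL)

theorem add_mem {S L : H →L[𝕜] H} (hS : S ∈ M) (hL : L ∈ M) : S + L ∈ M :=
  hM.mem_of_commute _ ((hM.isSelfAdjoint S hS).add (hM.isSelfAdjoint L hL))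
    fun X hX => (hM.commute X hX S hS).add_right (hM.commute X hX L hL)

theorem smul_mem (c : ℝ) {S : H →L[𝕜] H} (hS : S ∈ M) : (c : 𝕜) • S ∈ M :=
  hM.mem_of_commute _ (IsSelfAdjoint.smul (RCLike.conj_ofReal c) (hM.isSelfAdjoint S hS))
    fun X hX => (hM.commute X hX S hS).smul_right _

theorem sub_mem {S L : H →L[𝕜] H} (hS : S ∈ M) (hL : L ∈ M) : S - L ∈ M :=
  hM.mem_of_commute _ ((hM.isSelfAdjoint S hS).sub (hM.isSelfAdjoint L hL))
    fun X hX => (hM.commute X hX S hS).sub_right (hM.commute X hX L hL)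

end IsMaximalCommuting

/-- The reflections `R = R⁻¹ = R*` in a maximal commuting family form a monoid. -/
def reflections {M : Set (H →L[𝕜] H)} (hM : IsMaximalCommuting M) : Submonoid (H →L[𝕜] H) where
  carrier := {R | R ∈ M ∧ R * R = 1}
  one_mem' := ⟨hM.one_mem, one_mul 1⟩
  mul_mem' := by
    rintro R R' ⟨hR, hRR⟩ ⟨hR', hRR'⟩
    refine ⟨hM.mul_mem hR hR', ?_⟩
    rw [(hM.commute R' hR' R hR).mul_mul_mul_comm, hRR, hRR', one_mul]

variable {M : Set (H →L[𝕜] H)} (hM : IsMaximalCommuting M)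

theorem two_smul_sub_one_mem_reflections {P : H →L[𝕜] H} (hP : P ∈ M) (hPP : P * P = P) :
    (2 : 𝕜) • P - 1 ∈ reflections hM := by
  refine ⟨?_, ?_⟩
  · have := hM.sub_mem (hM.smul_mem 2 hP) hM.one_mem
    rwa [RCLike.ofReal_ofNat] at this
  · rw [sub_mul, one_mul, mul_sub, mul_one, smul_mul_smul_comm, hPP]
    module

theorem projection_mem_span_reflections {P : H →L[𝕜] H} (hP : P ∈ M) (hPP : P * P = P) :
    P ∈ Submodule.span 𝕜 (reflections hM : Set (H →L[𝕜] H)) := by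
  have h : P = (1 / 2 : 𝕜) • ((2 : 𝕜) • P - 1) + (1 / 2 : 𝕜) • 1 := by
    module
  rw [h]
  exact Submodule.add_mem _ (Submodule.smul_mem _ _ (Submodule.subset_span
    (two_smul_sub_one_mem_reflections hM hP hPP)))
    (Submodule.smul_mem _ _ (Submodule.subset_span (reflections hM).one_mem))

/-- Binary expansion of an operator `0 ≤ S ≤ t` by spectral projections: splitting `S` at `t / 2`
removes the projection for the upper half and halves the range of the rest. -/
theorem exists_dyadic_approx (n : ℕ) : ∀ {S : H →L[𝕜] H} {t : ℝ}, S ∈ M →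
    (∀ x, 0 ≤ RCLike.re ⟪S x, x⟫_𝕜) → (∀ x, RCLike.re ⟪S x, x⟫_𝕜 ≤ t * ‖x‖ ^ 2) →
    ∃ D ∈ Submodule.span 𝕜 (reflections hM : Set (H →L[𝕜] H)), S - D ∈ M ∧
      (∀ x, 0 ≤ RCLike.re ⟪(S - D) x, x⟫_𝕜) ∧
      (∀ x, RCLike.re ⟪(S - D) x, x⟫_𝕜 ≤ t / 2 ^ n * ‖x‖ ^ 2) := by
  induction n with
  | zero =>
    intro S t hS h0 h1
    exact ⟨0, Submodule.zero_mem _, by simpa using hS, by simpa using h0, by simpa using h1⟩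
  | succ n ih =>
    intro S t hS h0 h1
    have hSt : S - ((t / 2 : ℝ) : 𝕜) • (1 : H →L[𝕜] H) ∈ M :=
      hM.sub_mem hS (hM.smul_mem _ hM.one_mem)
    obtain ⟨P, hP, hPP, hcomm, hup, hlow⟩ := exists_spectral_splitting (hM.isSelfAdjoint _ hSt)
    have hPM : P ∈ M := hM.mem_of_commute P hP fun L hL =>
      hcomm L (hM.isSelfAdjoint L hL) (hM.commute L hL _ hSt)
    have hform : ∀ y, RCLike.re ⟪(S - ((t / 2 : ℝ) : 𝕜) • (1 : H →L[𝕜] H)) y, y⟫_𝕜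
        = RCLike.re ⟪S y, y⟫_𝕜 - t / 2 * ‖y‖ ^ 2 := by
      intro y
      rw [_root_.sub_apply, inner_sub_left, map_sub, _root_.smul_apply, inner_smul_left,
        RCLike.conj_ofReal, RCLike.re_ofReal_mul, one_apply_eq_self, inner_self_eq_norm_sq]
    have hPx : ∀ x, P (P x) = P x := fun x => by rw [← mul_apply_eq_comp, hPP]
    have horth : ∀ x y, ⟪P x, y - P y⟫_𝕜 = 0 := fun x y => by
      rw [hP.inner_apply_left, map_sub, hPx, sub_self, inner_zero_right]
    have hSP : ∀ x, S (P x) = P (S x) := fun x => by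
      rw [← mul_apply_eq_comp, ← mul_apply_eq_comp, (hM.commute S hS P hPM).eq]
    have hsplit : ∀ x, RCLike.re ⟪(S - ((t / 2 : ℝ) : 𝕜) • P) x, x⟫_𝕜
        = RCLike.re ⟪S (P x), P x⟫_𝕜 + RCLike.re ⟪S (x - P x), x - P x⟫_𝕜
          - t / 2 * ‖P x‖ ^ 2 := by
      intro x
      have h2 : ⟪S x, x⟫_𝕜 = ⟪S (P x), P x⟫_𝕜 + ⟪S (x - P x), x - P x⟫_𝕜 := by
        have h3 : ⟪S (P x), x - P x⟫_𝕜 = 0 := by rw [hSP]; exact horth _ _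
        have h4 : ⟪S (x - P x), P x⟫_𝕜 = 0 := by
          rw [← hP.inner_apply_left, ← hSP, map_sub, hPx, sub_self, map_zero, inner_zero_left]
        conv_lhs => rw [← add_sub_cancel (P x) x]
        rw [map_add, inner_add_left, inner_add_right, inner_add_right, h3, h4]
        ring
      have h5 : ⟪P x, x⟫_𝕜 = ⟪P x, P x⟫_𝕜 := by
        rw [← hPx x, hP.inner_apply_left, hPx]
      rw [_root_.sub_apply, inner_sub_left, map_sub, h2, map_add,
        _root_.smul_apply, inner_smul_left, RCLike.conj_ofReal, RCLike.re_ofReal_mul, h5,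
        inner_self_eq_norm_sq]
    have hpyth : ∀ x, ‖x‖ ^ 2 = ‖P x‖ ^ 2 + ‖x - P x‖ ^ 2 := by
      intro x
      have := norm_add_sq_eq_norm_sq_add_norm_sq_of_inner_eq_zero _ _ (horth x x)
      rw [add_sub_cancel] at this
      nlinarith
    have hPM' := hM.sub_mem hS (hM.smul_mem (t / 2) hPM)
    obtain ⟨D, hD, hDM, hD0, hD1⟩ := ih hPM' (t := t / 2)
      (fun x => by
        rw [hsplit]
        have := hup x
        rw [hform] at this
        linarith [h0 (x - P x)])
      (fun x => by
        rw [hsplit, hpyth x]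
        have := hlow x
        rw [hform] at this
        linarith [h1 (P x)])
    refine ⟨((t / 2 : ℝ) : 𝕜) • P + D, Submodule.add_mem _ (Submodule.smul_mem _ _
      (projection_mem_span_reflections hM hPM hPP)) hD, ?_, ?_, ?_⟩
    · rwa [← sub_sub]
    · rwa [← sub_sub]
    · rw [← sub_sub]
      convert hD1 using 3
      rw [pow_succ]
      ring

/-- The closed subspace generated by `x` under a maximal commuting family; the reflections alone
generate it. -/
def cyclicSubspace (x : H) : Submodule 𝕜 H :=
  (Submodule.span 𝕜 ((fun R : H →L[𝕜] H => R x) '' reflections hM)).topologicalClosure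

theorem isClosed_cyclicSubspace (x : H) : IsClosed (cyclicSubspace hM x : Set H) :=
  Submodule.isClosed_topologicalClosure _

instance (x : H) : CompleteSpace (cyclicSubspace hM x) :=
  (isClosed_cyclicSubspace hM x).completeSpace_coe

/-- The dyadic approximations of `S` converge weakly: the remainders are nonnegative operators with
quadratic forms of size `2⁻ⁿ`, so a vector orthogonal to all `R x` is orthogonal to `S x`. -/
theorem apply_mem_cyclicSubspace {S : H →L[𝕜] H} (hS : S ∈ M) (x : H) :
    S x ∈ cyclicSubspace hM x := by
  rw [cyclicSubspace, ← Submodule.orthogonal_orthogonal_eq_closure]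
  set K := Submodule.span 𝕜 ((fun R : H →L[𝕜] H => R x) '' reflections hM)
  have hD : ∀ D ∈ Submodule.span 𝕜 (reflections hM : Set (H →L[𝕜] H)), D x ∈ K := by
    intro D hD
    induction hD using Submodule.span_induction with
    | mem R hR => exact Submodule.subset_span ⟨R, hR, rfl⟩
    | zero => exact Submodule.zero_mem _
    | add D D' _ _ h h' => exact Submodule.add_mem _ h h'
    | smul c D _ h => exact Submodule.smul_mem _ c h
  -- the shift by `‖S‖` makes the operator nonnegative
  set s := ‖S‖
  have hS' : S + (s : 𝕜) • 1 ∈ M := hM.add_mem hS (hM.smul_mem s hM.one_mem)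
  have hform : ∀ y, RCLike.re ⟪(S + (s : 𝕜) • (1 : H →L[𝕜] H)) y, y⟫_𝕜
      = RCLike.re ⟪S y, y⟫_𝕜 + s * ‖y‖ ^ 2 := by
    intro y
    rw [_root_.add_apply, inner_add_left, map_add, _root_.smul_apply, inner_smul_left,
      RCLike.conj_ofReal, RCLike.re_ofReal_mul, one_apply_eq_self, inner_self_eq_norm_sq]
  have hSy : ∀ y, |RCLike.re ⟪S y, y⟫_𝕜| ≤ s * ‖y‖ ^ 2 := by
    intro y
    calc |RCLike.re ⟪S y, y⟫_𝕜| ≤ ‖⟪S y, y⟫_𝕜‖ := RCLike.abs_re_le_norm _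
      _ ≤ ‖S y‖ * ‖y‖ := norm_inner_le_norm _ _
      _ ≤ (s * ‖y‖) * ‖y‖ := by gcongr; exact S.le_opNorm y
      _ = s * ‖y‖ ^ 2 := by ring
  have hre : ∀ y ∈ Kᗮ, RCLike.re ⟪S x, y⟫_𝕜 = 0 := by
    intro y hy
    have hle : ∀ n : ℕ, |2 * RCLike.re ⟪S x, y⟫_𝕜|
        ≤ (2 * s * (‖x‖ ^ 2 + ‖y‖ ^ 2)) * (1 / 2 : ℝ) ^ n := by
      intro n
      obtain ⟨D, hDspan, hDM, hD0, hD1⟩ := exists_dyadic_approx hM n hS' (t := 2 * s)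
        (fun z => by rw [hform]; linarith [(abs_le.1 (hSy z)).1])
        (fun z => by rw [hform]; linarith [(abs_le.1 (hSy z)).2])
      set B := S + (s : 𝕜) • 1 - D
      have h1 : ⟪S x, y⟫_𝕜 = ⟪B x, y⟫_𝕜 := by
        have h2 : ⟪D x, y⟫_𝕜 = 0 := hy _ (hD D hDspan)
        have h3 : ⟪x, y⟫_𝕜 = 0 := hy _ (hD 1 (Submodule.subset_span (reflections hM).one_mem))
        simp [B, inner_add_left, inner_sub_left, inner_smul_left, h2, h3]
      have hB : ⟪B y, x⟫_𝕜 = (starRingEnd 𝕜) ⟪B x, y⟫_𝕜 := by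
        rw [inner_conj_symm, (hM.isSelfAdjoint B hDM).inner_apply_left]
      have hp := hD0 (x + y)
      have hm := hD0 (x - y)
      rw [map_add, inner_add_left, inner_add_right, inner_add_right, hB, map_add, map_add,
        map_add, RCLike.conj_re] at hp
      rw [map_sub, inner_sub_left, inner_sub_right, inner_sub_right, hB, map_sub, map_sub,
        map_sub, RCLike.conj_re] at hm
      have e : (2 * s * (‖x‖ ^ 2 + ‖y‖ ^ 2)) * (1 / 2 : ℝ) ^ n
          = 2 * s / 2 ^ n * ‖x‖ ^ 2 + 2 * s / 2 ^ n * ‖y‖ ^ 2 := by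
        rw [one_div, inv_pow]
        ring
      rw [h1, e, abs_le]
      constructor <;> linarith [hD1 x, hD1 y]
    have hlim : Filter.Tendsto (fun n : ℕ => (2 * s * (‖x‖ ^ 2 + ‖y‖ ^ 2)) * (1 / 2 : ℝ) ^ n)
        Filter.atTop (𝓝 0) := by
      simpa using (tendsto_pow_atTop_nhds_zero_of_lt_one (by norm_num : (0 : ℝ) ≤ 1 / 2)
        (by norm_num)).const_mul (2 * s * (‖x‖ ^ 2 + ‖y‖ ^ 2))
    have h0 := abs_nonpos_iff.1 (ge_of_tendsto' hlim hle)
    linarith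
  intro y hy
  have h1 := hre (⟪y, S x⟫_𝕜 • y) (Submodule.smul_mem _ _ hy)
  rw [inner_smul_right, ← inner_conj_symm, RCLike.conj_mul, ← RCLike.ofReal_pow,
    RCLike.ofReal_re] at h1
  rw [← inner_conj_symm, norm_eq_zero.1 (pow_eq_zero_iff two_ne_zero |>.1 h1), map_zero]

theorem self_mem_cyclicSubspace (x : H) : x ∈ cyclicSubspace hM x := by
  simpa using apply_mem_cyclicSubspace hM hM.one_mem x

theorem map_mem_cyclicSubspace {S : H →L[𝕜] H} (hS : S ∈ M) {x y : H}
    (hy : y ∈ cyclicSubspace hM x) : S y ∈ cyclicSubspace hM x := by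
  have hmaps : Set.MapsTo S
      (Submodule.span 𝕜 ((fun R : H →L[𝕜] H => R x) '' reflections hM) : Set H)
      (cyclicSubspace hM x : Set H) := by
    intro z hz
    induction hz using Submodule.span_induction with
    | mem z hz =>
      obtain ⟨R, hR, rfl⟩ := hz
      exact apply_mem_cyclicSubspace hM (hM.mul_mem hS hR.1) x
    | zero => simp
    | add a b _ _ ha hb => rw [map_add]; exact Submodule.add_mem _ ha hb
    | smul c a _ ha => rw [map_smul]; exact Submodule.smul_mem _ c ha
  have h := hmaps.closure S.continuous
  rw [(isClosed_cyclicSubspace hM x).closure_eq] at h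
  exact h hy

theorem cyclicSubspace_le {x z : H} (hx : x ∈ cyclicSubspace hM z) :
    cyclicSubspace hM x ≤ cyclicSubspace hM z := by
  refine Submodule.topologicalClosure_minimal _ (Submodule.span_le.2 ?_)
    (isClosed_cyclicSubspace hM z)
  rintro _ ⟨R, hR, rfl⟩
  exact map_mem_cyclicSubspace hM hR.1 hx

theorem starProjection_cyclicSubspace_mem (x : H) : (cyclicSubspace hM x).starProjection ∈ M :=
  hM.mem_of_commute _ (isSelfAdjoint_starProjection _) fun L hL =>
    (hM.isSelfAdjoint L hL).commute_starProjection _ fun _ hy => map_mem_cyclicSubspace hM hL hy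

/-- On a separable space a maximal commuting family has a cyclic vector: the limit of vectors
`z n`, where `z (n + 1) - z n` is a small multiple of the component of the `n`-th point of a dense
sequence orthogonal to the subspace generated by `z n`. -/
theorem exists_cyclicSubspace_eq_top [TopologicalSpace.SeparableSpace H] :
    ∃ z : H, cyclicSubspace hM z = ⊤ := by
  let h : ℕ → H := TopologicalSpace.denseSeq H
  let E : H → H →L[𝕜] H := fun z => (cyclicSubspace hM z).starProjection
  let w : ℕ → H → H := fun n z => h n - E z (h n)
  let c : ℕ → H → ℝ := fun n z => (1 / 2) ^ n / (1 + ‖w n z‖)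
  have hc : ∀ n z, 0 < c n z := fun n z => by positivity
  obtain ⟨z, hz⟩ : ∃ z : ℕ → H, ∀ n, z (n + 1) = z n + (c n (z n) : 𝕜) • w n (z n) :=
    ⟨fun n => Nat.rec 0 (fun n z => z + (c n z : 𝕜) • w n z) n, fun _ => rfl⟩
  have hEself : ∀ y, E y y = y := fun y =>
    Submodule.starProjection_eq_self_iff.2 (self_mem_cyclicSubspace hM y)
  have hEmem : ∀ u x, E u x ∈ cyclicSubspace hM u := fun u x =>
    Submodule.starProjection_apply_mem (cyclicSubspace hM u) x
  have horth : ∀ n y, ∀ u ∈ cyclicSubspace hM y, ⟪w n y, u⟫_𝕜 = 0 := fun n y u hu =>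
    Submodule.starProjection_inner_eq_zero (h n) u hu
  have hEw : ∀ n y u, u ∈ cyclicSubspace hM y → E u (w n y) = 0 := by
    intro n y u hu
    refine (Submodule.eq_starProjection_of_mem_of_inner_eq_zero (Submodule.zero_mem _)
      fun x hx => ?_)
    rw [sub_zero]
    exact horth n y x (cyclicSubspace_le hM hu hx)
  have hzmem : ∀ n, z n ∈ cyclicSubspace hM (z (n + 1)) := by
    intro n
    have h1 : E (z n) (z (n + 1)) = z n := by
      rw [hz, map_add, map_smul, hEself, hEw n _ _ (self_mem_cyclicSubspace hM _), smul_zero,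
        add_zero]
    rw [← h1]
    exact apply_mem_cyclicSubspace hM (starProjection_cyclicSubspace_mem hM (z n)) _
  have hmono : Monotone fun n => cyclicSubspace hM (z n) :=
    monotone_nat_of_le_succ fun n => cyclicSubspace_le hM (hzmem n)
  have hEz : ∀ n m, n ≤ m → E (z n) (z m) = z n := by
    intro n m hnm
    induction m, hnm using Nat.le_induction with
    | base => exact hEself _
    | succ m hnm ih =>
      rw [hz, map_add, map_smul, ih,
        hEw m _ _ (hmono hnm (self_mem_cyclicSubspace hM _)), smul_zero, add_zero]
  have hcauchy : CauchySeq z := by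
    refine cauchySeq_of_le_geometric (1 / 2) 1 (by norm_num) fun n => ?_
    rw [hz, dist_self_add_right, norm_smul, RCLike.norm_ofReal, abs_of_pos (hc n _), one_mul,
      div_mul_eq_mul_div]
    exact (div_le_iff₀ (by positivity)).2 (by gcongr; linarith)
  obtain ⟨y, hy⟩ := cauchySeq_tendsto_of_complete hcauchy
  have hEy : ∀ n, E (z n) y = z n := fun n =>
    tendsto_nhds_unique (((E (z n)).continuous.tendsto y).comp hy)
      (tendsto_const_nhds.congr' ((Filter.eventually_ge_atTop n).mono fun m hm =>
        (hEz n m hm).symm))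
  have hle : ∀ n, cyclicSubspace hM (z n) ≤ cyclicSubspace hM y := fun n => by
    refine cyclicSubspace_le hM ?_
    rw [← hEy n]
    exact apply_mem_cyclicSubspace hM (starProjection_cyclicSubspace_mem hM (z n)) _
  refine ⟨y, ?_⟩
  have hmem : ∀ n, h n ∈ cyclicSubspace hM y := by
    intro n
    have h1 : w n (z n) ∈ cyclicSubspace hM (z (n + 1)) := by
      have h2 := Submodule.sub_mem _ (self_mem_cyclicSubspace hM (z (n + 1))) (hzmem n)
      have h3 : z (n + 1) - z n = (c n (z n) : 𝕜) • w n (z n) := by rw [hz, add_sub_cancel_left]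
      rw [h3] at h2
      exact (Submodule.smul_mem_iff _ (RCLike.ofReal_ne_zero.2 (hc n (z n)).ne')).1 h2
    have h3 : E (z n) (h n) ∈ cyclicSubspace hM y :=
      hle n (hEmem (z n) (h n))
    have h4 := Submodule.add_mem _ (hle (n + 1) h1) h3
    rwa [sub_add_cancel] at h4
  rw [Submodule.eq_top_iff']
  intro x
  have hd : DenseRange h := TopologicalSpace.denseRange_denseSeq H
  exact (isClosed_cyclicSubspace hM y).closure_subset_iff.2 (Set.range_subset_iff.2 hmem) (hd x)

end MaximalCommuting

/-! ### The bounded transform of a self-adjoint operator -/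

section BoundedTransform

variable {𝕜 H : Type*} [RCLike 𝕜] [NormedAddCommGroup H] [InnerProductSpace 𝕜 H] [CompleteSpace H]

/-- Self-adjointness says that the graph is its own adjoint relation. -/
theorem LinearPMap.mem_graph_iff_of_isSelfAdjoint {A : H →ₗ.[𝕜] H} (hA : IsSelfAdjoint A)
    {x y : H} : (x, y) ∈ A.graph ↔ ∀ u v, (u, v) ∈ A.graph → ⟪y, u⟫_𝕜 = ⟪x, v⟫_𝕜 := by
  have h : A.graph = A.graph.adjoint := by
    conv_lhs => rw [← LinearPMap.isSelfAdjoint_def.1 hA]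
    exact LinearPMap.adjoint_graph_eq_graph_adjoint hA.dense_domain
  conv_lhs => rw [h]
  rw [Submodule.mem_adjoint_iff]
  refine forall₂_congr fun u v => forall_congr' fun _ => ?_
  rw [sub_eq_zero, ← inner_conj_symm, ← inner_conj_symm u y, (starRingEnd 𝕜).injective.eq_iff]
  exact eq_comm

/-- For self-adjoint `A`, the operators `T = (1 + A²)⁻¹` and `C = A T` are bounded, self-adjoint
and commute; moreover `T` is injective and its range is a core for `A`. They are the components of
the orthogonal projection of `(h, 0)` onto the graph of `A`. -/
theorem exists_boundedTransform {A : H →ₗ.[𝕜] H} (hA : IsSelfAdjoint A) :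
    ∃ T C : H →L[𝕜] H, IsSelfAdjoint T ∧ IsSelfAdjoint C ∧ Commute T C ∧
      (∀ h, (T h, C h) ∈ A.graph) ∧ (∀ h, T h = 0 → h = 0) ∧
      ∀ x y, (x, y) ∈ A.graph → ∀ ε > 0, ∃ h, ‖T h - x‖ < ε ∧ ‖C h - y‖ < ε := by
  let Γ : Submodule 𝕜 (WithLp 2 (H × H)) :=
    A.graph.comap (WithLp.linearEquiv 2 𝕜 (H × H) : WithLp 2 (H × H) →ₗ[𝕜] H × H)
  have hΓ : ∀ p, p ∈ Γ ↔ (p.fst, p.snd) ∈ A.graph := fun p => Iff.rfl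
  have hΓc : IsClosed (Γ : Set (WithLp 2 (H × H))) :=
    hA.isClosed.preimage (WithLp.prod_continuous_ofLp 2 H H)
  have : CompleteSpace Γ := hΓc.completeSpace_coe
  let J : H →L[𝕜] WithLp 2 (H × H) :=
    ((WithLp.prodContinuousLinearEquiv 2 𝕜 H H).symm : (H × H) →L[𝕜] WithLp 2 (H × H)) ∘L
      ContinuousLinearMap.inl 𝕜 H H
  let T : H →L[𝕜] H := WithLp.fstL 2 𝕜 H H ∘L Γ.starProjection ∘L J
  let C : H →L[𝕜] H := WithLp.sndL 2 𝕜 H H ∘L Γ.starProjection ∘L J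
  have hTC : ∀ h, (T h, C h) ∈ A.graph := fun h =>
    (hΓ _).1 (Submodule.starProjection_apply_mem Γ (J h))
  have hsymm : ∀ {x y u v : H}, (x, y) ∈ A.graph → (u, v) ∈ A.graph → ⟪y, u⟫_𝕜 = ⟪x, v⟫_𝕜 :=
    fun h h' => (LinearPMap.mem_graph_iff_of_isSelfAdjoint hA).1 h _ _ h'
  have horth : ∀ h u v, (u, v) ∈ A.graph → ⟪h - T h, u⟫_𝕜 = ⟪C h, v⟫_𝕜 := by
    intro h u v huv
    have h1 : ⟪J h - Γ.starProjection (J h), WithLp.toLp 2 (u, v)⟫_𝕜 = 0 :=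
      Submodule.starProjection_inner_eq_zero (J h) _ ((hΓ _).2 huv)
    rw [WithLp.prod_inner_apply] at h1
    have h2 : ⟪h - T h, u⟫_𝕜 + ⟪0 - C h, v⟫_𝕜 = 0 := h1
    rw [zero_sub, inner_neg_left] at h2
    exact eq_of_sub_eq_zero (by rw [sub_eq_add_neg]; exact h2)
  have hC : ∀ h, (C h, h - T h) ∈ A.graph := fun h =>
    (LinearPMap.mem_graph_iff_of_isSelfAdjoint hA).2 (horth h)
  have huniq : ∀ x y, (x, y) ∈ A.graph → (y, -x) ∈ A.graph → x = 0 := by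
    intro x y h h'
    have h1 := hsymm h h'
    rw [inner_neg_right] at h1
    have h2 : ‖y‖ ^ 2 = -‖x‖ ^ 2 := by
      have := congrArg RCLike.re h1
      rwa [map_neg, inner_self_eq_norm_sq, inner_self_eq_norm_sq] at this
    have h3 : ‖x‖ ^ 2 = 0 := by nlinarith [sq_nonneg ‖x‖, sq_nonneg ‖y‖]
    exact norm_eq_zero.1 (pow_eq_zero_iff two_ne_zero |>.1 h3)
  have hTsa : IsSelfAdjoint T := by
    rw [ContinuousLinearMap.isSelfAdjoint_iff_isSymmetric]
    intro h k
    change ⟪T h, k⟫_𝕜 = ⟪h, T k⟫_𝕜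
    have h1 := horth k _ _ (hTC h)
    have h2 := horth h _ _ (hTC k)
    rw [inner_sub_left] at h1 h2
    have h3 := congrArg (starRingEnd 𝕜) h1
    rw [map_sub, inner_conj_symm, inner_conj_symm, inner_conj_symm] at h3
    rw [← sub_eq_zero]
    linear_combination h3 - h2
  have hCsa : IsSelfAdjoint C := by
    rw [ContinuousLinearMap.isSelfAdjoint_iff_isSymmetric]
    intro h k
    change ⟪C h, k⟫_𝕜 = ⟪h, C k⟫_𝕜
    have h1 := hsymm (hTC h) (hTC k)
    have h2 := hsymm (hC h) (hC k)
    rw [inner_sub_left, inner_sub_right] at h2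
    linear_combination h1 - h2
  refine ⟨T, C, hTsa, hCsa, ?_, hTC, fun h hh => ?_, ?_⟩
  · ext h
    change T (C h) = C (T h)
    have h1 : (T (C h) - C (T h), C (C h) - (T h - T (T h))) ∈ A.graph :=
      A.graph.sub_mem (hTC (C h)) (hC (T h))
    have h2 : (C (C h) - (T h - T (T h)), -(T (C h) - C (T h))) ∈ A.graph := by
      have := A.graph.sub_mem (hC (C h)) (A.graph.sub_mem (hTC h) (hTC (T h)))
      convert this using 1
      ext <;> simp
    exact sub_eq_zero.1 (huniq _ _ h1 h2)
  · have h1 : C h = 0 := by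
      have := hTC h
      rw [hh] at this
      exact LinearPMap.graph_fst_eq_zero_snd A this rfl
    have h2 := hC h
    rw [h1, hh, sub_zero] at h2
    exact LinearPMap.graph_fst_eq_zero_snd A h2 rfl
  · intro x y hxy ε hε
    let K : Submodule 𝕜 (WithLp 2 (H × H)) := LinearMap.range
      (Γ.starProjection ∘L J : H →ₗ[𝕜] WithLp 2 (H × H))
    have hmem : WithLp.toLp 2 (x, y) ∈ K.topologicalClosure := by
      rw [← Submodule.orthogonal_orthogonal_eq_closure]
      intro z hz
      have h1 : ∀ h, ⟪J h, Γ.starProjection z⟫_𝕜 = 0 := by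
        intro h
        rw [← (isSelfAdjoint_starProjection Γ).inner_apply_left]
        exact hz _ ⟨h, rfl⟩
      have h2 : (Γ.starProjection z).fst = 0 := by
        have := h1 (Γ.starProjection z).fst
        rw [WithLp.prod_inner_apply] at this
        simpa [J] using this
      have h3 : (Γ.starProjection z).snd = 0 :=
        LinearPMap.graph_fst_eq_zero_snd A ((hΓ _).1 (Submodule.starProjection_apply_mem Γ z)) h2
      have h4 : Γ.starProjection z = 0 := by
        apply (WithLp.linearEquiv 2 𝕜 (H × H)).injective
        exact Prod.ext h2 h3
      have h5 := Submodule.starProjection_inner_eq_zero z (WithLp.toLp 2 (x, y)) ((hΓ _).2 hxy)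
      rwa [h4, sub_zero] at h5
    obtain ⟨_, ⟨h, rfl⟩, hh⟩ := Metric.mem_closure_iff.1 hmem ε hε
    rw [dist_comm, dist_eq_norm] at hh
    refine ⟨h, lt_of_le_of_lt ?_ hh, lt_of_le_of_lt ?_ hh⟩
    · exact WithLp.norm_fst_le (p := 2) (x := Γ.starProjection (J h) - WithLp.toLp 2 (x, y))
    · exact WithLp.norm_snd_le (p := 2) (x := Γ.starProjection (J h) - WithLp.toLp 2 (x, y))

end BoundedTransform

/-! ### Sign systems: the standard data behind the sampling -/

section JointPartition

variable {𝕜 H : Type*} [RCLike 𝕜] [NormedAddCommGroup H] [InnerProductSpace 𝕜 H] [CompleteSpace H]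

/-- The finite set `B` consists of the nonzero components of `v` under a finite partition of unity
by projections in `M`. -/
structure IsJointPartition (M : Set (H →L[𝕜] H)) (v : H) (B : Finset H) : Prop where
  orthogonal : ∀ a ∈ B, ∀ b ∈ B, a ≠ b → ∀ L ∈ M, ⟪L a, b⟫_𝕜 = 0
  inner_eq : ∀ a ∈ B, ∀ L ∈ M, ⟪L a, v⟫_𝕜 = ⟪L a, a⟫_𝕜
  zero_notMem : (0 : H) ∉ B
  mem_span : v ∈ Submodule.span 𝕜 (B : Set H)

variable {M : Set (H →L[𝕜] H)} (hM : IsMaximalCommuting M)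
include hM

/-- Splitting every piece by the two eigenspaces of a reflection `R`. -/
theorem IsJointPartition.exists_refinement {v : H} {B : Finset H} (hB : IsJointPartition M v B)
    {R : H →L[𝕜] H} (hR : R ∈ reflections hM) :
    ∃ B', IsJointPartition M v B' ∧ (∀ a ∈ B', R a = a ∨ R a = -a) ∧
      ∀ a ∈ B', ∃ P ∈ M, ∃ b ∈ B, a = P b := by
  classical
  let P : Bool → H →L[𝕜] H := fun s => ((1 / 2 : ℝ) : 𝕜) • (if s then 1 + R else 1 - R)
  have hPM : ∀ s, P s ∈ M := by
    rintro (_ | _)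
    · exact hM.smul_mem _ (hM.sub_mem hM.one_mem hR.1)
    · exact hM.smul_mem _ (hM.add_mem hM.one_mem hR.1)
  have hhalf : (((1 / 2 : ℝ) : 𝕜)) = 1 / 2 := by
    rw [RCLike.ofReal_div, RCLike.ofReal_one, RCLike.ofReal_ofNat]
  have hPP : ∀ s, P s * P s = P s := by
    rintro (_ | _)
    · simp only [P, Bool.false_eq_true, if_false, smul_mul_smul_comm, sub_mul, mul_sub, hR.2,
        one_mul, mul_one, hhalf]
      module
    · simp only [P, if_true, smul_mul_smul_comm, add_mul, mul_add, hR.2, one_mul, mul_one, hhalf]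
      module
  have hPP' : ∀ s t, s ≠ t → P s * P t = 0 := by
    rintro (_ | _) (_ | _) hst
    · exact absurd rfl hst
    · simp only [P, Bool.false_eq_true, if_false, if_true, smul_mul_smul_comm, sub_mul, mul_add,
        hR.2, one_mul, mul_one, hhalf]
      module
    · simp only [P, Bool.false_eq_true, if_false, if_true, smul_mul_smul_comm, add_mul, mul_sub,
        hR.2, one_mul, mul_one, hhalf]
      module
    · exact absurd rfl hst
  have hsa : ∀ s x y, ⟪P s x, y⟫_𝕜 = ⟪x, P s y⟫_𝕜 := fun s =>
    (hM.isSelfAdjoint _ (hPM s)).inner_apply_left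
  have hRP : ∀ s x, R (P s x) = P s x ∨ R (P s x) = -P s x := by
    have hRR : ∀ x, R (R x) = x := fun x => by rw [← mul_apply_eq_comp, hR.2]; rfl
    rintro (_ | _) x
    · refine Or.inr ?_
      simp [P, hRR, ← smul_neg]
    · refine Or.inl ?_
      simp [P, hRR, add_comm]
  have hsum : ∀ x, x = P true x + P false x := by
    intro x
    simp only [P, Bool.false_eq_true, if_false, if_true, hhalf, _root_.smul_apply,
      _root_.add_apply, _root_.sub_apply, one_apply_eq_self]
    module
  let B' : Finset H := ((Finset.univ ×ˢ B).image fun q : Bool × H => P q.1 q.2).erase 0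
  have hmem : ∀ a ∈ B', ∃ s, ∃ b ∈ B, a = P s b := by
    intro a ha
    obtain ⟨-, h⟩ := Finset.mem_erase.1 ha
    obtain ⟨⟨s, b⟩, hq, rfl⟩ := Finset.mem_image.1 h
    exact ⟨s, b, (Finset.mem_product.1 hq).2, rfl⟩
  have hspan : ∀ s, ∀ b ∈ B, P s b ∈ Submodule.span 𝕜 (B' : Set H) := by
    intro s b hb
    by_cases h : P s b = 0
    · rw [h]; exact Submodule.zero_mem _
    · exact Submodule.subset_span (Finset.mem_erase.2 ⟨h, Finset.mem_image.2
        ⟨(s, b), Finset.mem_product.2 ⟨Finset.mem_univ _, hb⟩, rfl⟩⟩)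
  refine ⟨B', ⟨?_, ?_, by simp [B'], ?_⟩, ?_, ?_⟩
  · intro a ha b hb hab L hL
    obtain ⟨s, a, ha', rfl⟩ := hmem a ha
    obtain ⟨t, b, hb', rfl⟩ := hmem b hb
    have h1 : ⟪L (P s a), P t b⟫_𝕜 = ⟪(P t * (L * P s)) a, b⟫_𝕜 := by
      rw [← hsa]; rfl
    rw [h1]
    by_cases h : a = b
    · subst h
      have hst : t ≠ s := fun h => hab (by rw [h])
      have h2 : P t * (L * P s) = 0 := by
        rw [(hM.commute L hL _ (hPM s)).eq, ← mul_assoc, hPP' t s hst, zero_mul]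
      rw [h2, _root_.zero_apply, inner_zero_left]
    · exact hB.orthogonal a ha' b hb' h _ (hM.mul_mem (hPM t) (hM.mul_mem hL (hPM s)))
  · intro a ha L hL
    obtain ⟨s, a, ha', rfl⟩ := hmem a ha
    have h1 := hB.inner_eq a ha' _ (hM.mul_mem hL (hPM s))
    rw [mul_apply_eq_comp] at h1
    have h2 : P s * (L * P s) = L * P s := by
      rw [(hM.commute L hL _ (hPM s)).eq, ← mul_assoc, hPP]
    rw [h1, ← hsa]
    exact congrArg (fun X : H →L[𝕜] H => ⟪X a, a⟫_𝕜) h2.symm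
  · have h := hB.mem_span
    refine (Submodule.span_le (p := Submodule.span 𝕜 (B' : Set H))).2 (fun b hb => ?_) h
    rw [hsum b]
    exact Submodule.add_mem _ (hspan _ _ hb) (hspan _ _ hb)
  · intro a ha
    obtain ⟨s, a, -, rfl⟩ := hmem a ha
    exact hRP s a
  · intro a ha
    obtain ⟨s, b, hb, h⟩ := hmem a ha
    exact ⟨P s, hPM s, b, hb, h⟩

/-- The pieces of `v` in the joint eigenspaces of the reflections `R 0, …, R (n - 1)`. -/
theorem exists_jointPartition {v : H} (hv : v ≠ 0) (R : ℕ → H →L[𝕜] H)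
    (hR : ∀ j, R j ∈ reflections hM) (n : ℕ) :
    ∃ B, IsJointPartition M v B ∧ ∀ j < n, ∀ a ∈ B, R j a = a ∨ R j a = -a := by
  induction n with
  | zero =>
    refine ⟨{v}, ⟨?_, ?_, ?_, Submodule.subset_span (by simp)⟩, by simp⟩
    · intro a ha b hb hab
      exact absurd ((Finset.mem_singleton.1 ha).trans (Finset.mem_singleton.1 hb).symm) hab
    · intro a ha L _
      rw [Finset.mem_singleton.1 ha]
    · simpa using hv.symm
  | succ n ih =>
    obtain ⟨B, hB, hsign⟩ := ih
    obtain ⟨B', hB', hR', hsub⟩ := hB.exists_refinement hM (hR n)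
    refine ⟨B', hB', fun j hj a ha => ?_⟩
    rcases Nat.lt_succ_iff_lt_or_eq.1 hj with hj | rfl
    · obtain ⟨P, hP, b, hb, rfl⟩ := hsub a ha
      have h : R j (P b) = P (R j b) := by
        rw [← mul_apply_eq_comp, (hM.commute _ (hR j).1 P hP).eq, mul_apply_eq_comp]
      rw [h]
      rcases hsign j hj b hb with h | h <;> rw [h]
      · exact Or.inl rfl
      · exact Or.inr (map_neg P b)
    · exact hR' a ha

/-- Countably many reflections, closed under multiplication, already generate. -/
theorem exists_seq_reflections [TopologicalSpace.SeparableSpace H] (v : H) :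
    ∃ R : ℕ → H →L[𝕜] H, (∀ j, R j ∈ reflections hM) ∧ R 0 = 1 ∧
      (∀ i j, ∃ k, R i * R j = R k) ∧
      cyclicSubspace hM v ≤ (Submodule.span 𝕜 (Set.range fun j => R j v)).topologicalClosure := by
  have : SecondCountableTopology H := UniformSpace.secondCountable_of_separable H
  obtain ⟨t, hts, htc, hdense⟩ := (TopologicalSpace.IsSeparable.of_separableSpace
    ((fun R : H →L[𝕜] H => R v) '' reflections hM)).exists_countable_dense_subset
  have hts' : ∀ x ∈ t, ∃ R ∈ reflections hM, R v = x := hts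
  choose! g hg hgv using hts'
  let G : Submonoid (H →L[𝕜] H) := Submonoid.closure (g '' t)
  have hG : G ≤ reflections hM := by
    refine Submonoid.closure_le.2 ?_
    rintro _ ⟨x, hx, rfl⟩
    exact hg x hx
  have hGc : (G : Set (H →L[𝕜] H)).Countable := by
    have : Countable (g '' t) := (htc.image g).to_subtype
    have hG' : G = MonoidHom.mrange (FreeMonoid.lift ((↑) : (g '' t) → H →L[𝕜] H)) :=
      Submonoid.closure_eq_mrange _
    rw [hG', MonoidHom.coe_mrange]
    have : Countable (FreeMonoid (g '' t)) := inferInstanceAs (Countable (List _))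
    exact Set.countable_range _
  obtain ⟨r, hr⟩ := hGc.exists_eq_range ⟨1, G.one_mem⟩
  have hrG : ∀ j, r j ∈ G := fun j => by
    have : r j ∈ (G : Set (H →L[𝕜] H)) := hr ▸ Set.mem_range_self j
    exact this
  let R : ℕ → H →L[𝕜] H := fun j => Nat.casesOn j 1 r
  have hRG : ∀ j, R j ∈ G := by
    rintro (_ | j)
    exacts [G.one_mem, hrG j]
  refine ⟨R, fun j => hG (hRG j), rfl, fun i j => ?_, ?_⟩
  · have h : R i * R j ∈ (G : Set (H →L[𝕜] H)) := G.mul_mem (hRG i) (hRG j)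
    rw [hr] at h
    obtain ⟨k, hk⟩ := h
    exact ⟨k + 1, hk.symm⟩
  · refine Submodule.topologicalClosure_minimal _ (Submodule.span_le.2 ?_)
      (Submodule.isClosed_topologicalClosure _)
    refine hdense.trans (closure_mono fun x hx => Submodule.subset_span ?_)
    have h : g x ∈ (G : Set (H →L[𝕜] H)) := Submonoid.subset_closure ⟨x, hx, rfl⟩
    rw [hr] at h
    obtain ⟨k, hk⟩ := h
    exact ⟨k + 1, by simp only [R, hk]; exact hgv x hx⟩

end JointPartition

/-- A sequence of vectors `e j` with a core of `A` as linear span, and finite orthonormal sets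
`Ω n` adapted to `A` and to `e 0, …, e n`: with respect to `Ω n`, the coordinates of `e j` differ
from those of the unit vector `e 0` by signs, and these sign functions are closed under
multiplication. In the model where `H` is an `L²` space and `e 0` is the constant `1`, the `e j`
are functions with values `±1` and `Ω n` consists of multiples of indicator functions. -/
structure SignSystem {𝕜 H : Type*} [RCLike 𝕜] [NormedAddCommGroup H] [InnerProductSpace 𝕜 H]
    (A : H →ₗ.[𝕜] H) where
  e : ℕ → H
  Ω : ℕ → Finset H
  norm_e_zero : ‖e 0‖ = 1
  orthonormal : ∀ n, Orthonormal 𝕜 (fun f : Ω n => (f : H))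
  inner_e_zero : ∀ n, ∀ f ∈ Ω n, ⟪f, e 0⟫_𝕜 = (‖⟪f, e 0⟫_𝕜‖ : 𝕜)
  inner_e_zero_ne : ∀ n, ∀ f ∈ Ω n, ⟪f, e 0⟫_𝕜 ≠ 0
  inner_e : ∀ n, ∀ j ≤ n, ∀ f ∈ Ω n, ⟪f, e j⟫_𝕜 = ⟪f, e 0⟫_𝕜 ∨ ⟪f, e j⟫_𝕜 = -⟪f, e 0⟫_𝕜
  e_mem : ∀ n, ∀ j ≤ n, e j ∈ Submodule.span 𝕜 (Ω n : Set H)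
  exists_mul : ∀ i j, ∃ k, ∀ n, i ≤ n → j ≤ n → k ≤ n → ∀ f ∈ Ω n,
    ⟪f, e i⟫_𝕜 * ⟪f, e j⟫_𝕜 = ⟪f, e k⟫_𝕜 * ⟪f, e 0⟫_𝕜
  mem_domain : ∀ n, ∀ f ∈ Ω n, f ∈ A.domain
  inner_apply_eq_zero : ∀ n, ∀ f ∈ Ω n, ∀ g ∈ Ω n, f ≠ g → ∀ y, (g, y) ∈ A.graph → ⟪f, y⟫_𝕜 = 0
  core : ∀ x y, (x, y) ∈ A.graph → ∀ ε > 0, ∃ u v, (u, v) ∈ A.graph ∧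
    u ∈ Submodule.span 𝕜 (Set.range e) ∧ ‖u - x‖ < ε ∧ ‖v - y‖ < ε

/-- The coordinate of `T (R v)` along `T a`, for a piece `a` of `v` on which `R` acts as the
scalar `r`. -/
theorem IsJointPartition.inner_map_map {𝕜 H : Type*} [RCLike 𝕜] [NormedAddCommGroup H]
    [InnerProductSpace 𝕜 H] [CompleteSpace H] {M : Set (H →L[𝕜] H)} (hM : IsMaximalCommuting M)
    {v : H} {B : Finset H} (hB : IsJointPartition M v B) {T R : H →L[𝕜] H} (hT : T ∈ M)
    (hR : R ∈ M) {a : H} (ha : a ∈ B) {r : ℝ} (hr : R a = (r : 𝕜) • a) :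
    ⟪T a, T (R v)⟫_𝕜 = ((r * ‖T a‖ ^ 2 : ℝ) : 𝕜) := by
  have hTs := (hM.isSelfAdjoint T hT).inner_apply_left
  have hRs := (hM.isSelfAdjoint R hR).inner_apply_left
  have h1 : R (T (T a)) = (r : 𝕜) • T (T a) := by
    have : R * (T * T) = T * T * R := (hM.commute R hR _ (hM.mul_mem hT hT)).eq
    have := congrArg (fun X : H →L[𝕜] H => X a) this
    simpa [hr] using this
  have h2 : ⟪T (T a), v⟫_𝕜 = ⟪T (T a), a⟫_𝕜 := hB.inner_eq a ha _ (hM.mul_mem hT hT)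
  rw [← hTs, ← hRs, h1, inner_smul_left, RCLike.conj_ofReal, h2, hTs, inner_self_eq_norm_sq_to_K]
  push_cast
  rfl

/-- With `z` a cyclic vector and `T = (1 + A²)⁻¹`, the vectors are `e j = c T (R j z)` for a
sequence of reflections `R j`, and `Ω n` consists of the normalised vectors `T a`, where `a` runs through the
pieces of `z` in the joint eigenspaces of `R 0, …, R n`. Applying `T` moves all vectors into the
domain of `A` and makes the span of the `e j` a core. -/
theorem nonempty_signSystem {𝕜 H : Type*} [RCLike 𝕜] [NormedAddCommGroup H]
    [InnerProductSpace 𝕜 H] [CompleteSpace H] [TopologicalSpace.SeparableSpace H] [Nontrivial H]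
    {A : H →ₗ.[𝕜] H} (hA : IsSelfAdjoint A) : Nonempty (SignSystem A) := by
  classical
  obtain ⟨T, C, hT, hC, hTC, hgraph, hinj, hcore⟩ := exists_boundedTransform hA
  obtain ⟨M, hM0, hM⟩ := exists_isMaximalCommuting_superset (M₀ := {T, C})
    (by rintro S (rfl | rfl) <;> assumption)
    (by rintro S (rfl | rfl) L (rfl | rfl); exacts [Commute.refl _, hTC, hTC.symm, Commute.refl _])
  have hTM : T ∈ M := hM0 (by simp)
  have hCM : C ∈ M := hM0 (by simp)
  obtain ⟨z, hz⟩ := exists_cyclicSubspace_eq_top hM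
  have hz0 : z ≠ 0 := by
    rintro rfl
    obtain ⟨x, hx⟩ := exists_ne (0 : H)
    have h : x ∈ cyclicSubspace hM (0 : H) := hz ▸ Submodule.mem_top
    have h' : cyclicSubspace hM (0 : H) ≤ ⊥ :=
      Submodule.topologicalClosure_minimal _ (Submodule.span_le.2 (by
        rintro _ ⟨R, -, rfl⟩
        simp)) (by simp)
    exact hx (by simpa using h' h)
  obtain ⟨R, hR, hR0, hRmul, hspan⟩ := exists_seq_reflections hM z
  have hdense : ∀ x, x ∈ closure (Submodule.span 𝕜 (Set.range fun j => R j z) : Set H) := by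
    intro x
    rw [hz] at hspan
    exact hspan (Submodule.mem_top : x ∈ ⊤)
  have hT0 : ∀ a, a ≠ 0 → ‖T a‖ ≠ 0 := fun a ha h => ha (hinj a (norm_eq_zero.1 h))
  have hpart := fun n => exists_jointPartition hM hz0 R hR (n + 1)
  choose B hB hsign using hpart
  have hB0 : ∀ n, ∀ a ∈ B n, a ≠ 0 := fun n a ha h => (hB n).zero_notMem (h ▸ ha)
  have hBsign : ∀ n, ∀ j ≤ n, ∀ a ∈ B n, ∃ r : ℝ, (r = 1 ∨ r = -1) ∧ R j a = (r : 𝕜) • a := by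
    intro n j hj a ha
    rcases hsign n j (Nat.lt_succ_of_le hj) a ha with h | h
    · exact ⟨1, Or.inl rfl, by simpa using h⟩
    · exact ⟨-1, Or.inr rfl, by simpa using h⟩
  set c : ℝ := ‖T z‖⁻¹ with hc
  have hcpos : 0 < c := inv_pos.2 (lt_of_le_of_ne (norm_nonneg _) (hT0 z hz0).symm)
  let F : H → H := fun a => ((‖T a‖⁻¹ : ℝ) : 𝕜) • T a
  let e : ℕ → H := fun j => (c : 𝕜) • T (R j z)
  let Ω : ℕ → Finset H := fun n => (B n).image F
  have hΩ : ∀ n, ∀ f ∈ Ω n, ∃ a ∈ B n, f = F a := fun n f hf => by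
    obtain ⟨a, ha, rfl⟩ := Finset.mem_image.1 hf
    exact ⟨a, ha, rfl⟩
  have hinner : ∀ n, ∀ j, ∀ a ∈ B n, ∀ r : ℝ, R j a = (r : 𝕜) • a →
      ⟪F a, e j⟫_𝕜 = ((r * (c * ‖T a‖) : ℝ) : 𝕜) := by
    intro n j a ha r hr
    simp only [F, e, inner_smul_left, inner_smul_right,
      (hB n).inner_map_map hM hTM (hR j).1 ha hr, RCLike.conj_ofReal]
    rw [← RCLike.ofReal_mul, ← RCLike.ofReal_mul]
    congr 1
    have := hT0 a (hB0 n a ha)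
    field_simp
  have hinner0 : ∀ n, ∀ a ∈ B n, ⟪F a, e 0⟫_𝕜 = ((c * ‖T a‖ : ℝ) : 𝕜) := by
    intro n a ha
    rw [hinner n 0 a ha 1 (by simp [hR0]), one_mul]
  have hpos : ∀ n, ∀ a ∈ B n, 0 < c * ‖T a‖ := fun n a ha =>
    mul_pos hcpos (lt_of_le_of_ne (norm_nonneg _) (hT0 a (hB0 n a ha)).symm)
  have hFgraph : ∀ a, (F a, ((‖T a‖⁻¹ : ℝ) : 𝕜) • C a) ∈ A.graph := fun a =>
    A.graph.smul_mem _ (hgraph a)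
  refine ⟨⟨e, Ω, ?_, fun n => ⟨?_, ?_⟩, ?_, ?_, ?_, ?_, ?_, ?_, ?_, ?_⟩⟩
  · have : e 0 = (c : 𝕜) • T z := by simp [e, hR0]
    rw [this, norm_smul, RCLike.norm_ofReal, abs_of_pos hcpos, hc, inv_mul_cancel₀ (hT0 z hz0)]
  · rintro ⟨f, hf⟩
    obtain ⟨a, ha, rfl⟩ := hΩ n f hf
    simp only [F, norm_smul, RCLike.norm_ofReal, abs_inv, abs_norm]
    exact inv_mul_cancel₀ (hT0 a (hB0 n a ha))
  · rintro ⟨f, hf⟩ ⟨g, hg⟩ hfg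
    obtain ⟨a, ha, rfl⟩ := hΩ n f hf
    obtain ⟨b, hb, rfl⟩ := hΩ n g hg
    have hab : a ≠ b := fun h => hfg (by subst h; rfl)
    have h := (hB n).orthogonal a ha b hb hab _ (hM.mul_mem hTM hTM)
    rw [mul_apply_eq_comp, hT.inner_apply_left] at h
    simp only [F, inner_smul_left, inner_smul_right, h, mul_zero]
  · intro n f hf
    obtain ⟨a, ha, rfl⟩ := hΩ n f hf
    rw [hinner0 n a ha, RCLike.norm_ofReal, abs_of_pos (hpos n a ha)]
  · intro n f hf
    obtain ⟨a, ha, rfl⟩ := hΩ n f hf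
    rw [hinner0 n a ha]
    exact RCLike.ofReal_ne_zero.2 (hpos n a ha).ne'
  · intro n j hj f hf
    obtain ⟨a, ha, rfl⟩ := hΩ n f hf
    obtain ⟨r, hr, hra⟩ := hBsign n j hj a ha
    rw [hinner0 n a ha, hinner n j a ha r hra]
    rcases hr with rfl | rfl
    · left; rw [one_mul]
    · right; rw [neg_one_mul, RCLike.ofReal_neg]
  · intro n j hj
    have hRz : R j z ∈ Submodule.span 𝕜 (B n : Set H) := by
      have h := Submodule.mem_map_of_mem (f := (R j : H →ₗ[𝕜] H)) (hB n).mem_span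
      refine (Submodule.map_span_le _ _ _).2 (fun a ha => ?_) h
      obtain ⟨r, -, hra⟩ := hBsign n j hj a ha
      change R j a ∈ _
      rw [hra]
      exact Submodule.smul_mem _ _ (Submodule.subset_span ha)
    have h := Submodule.mem_map_of_mem (f := (T : H →ₗ[𝕜] H)) hRz
    refine Submodule.smul_mem _ _ ((Submodule.map_span_le _ _ _).2 (fun a ha => ?_) h)
    have h2 : T a = (‖T a‖ : 𝕜) • F a := by
      simp only [F]
      rw [smul_smul, ← RCLike.ofReal_mul, mul_inv_cancel₀ (hT0 a (hB0 n a ha)), RCLike.ofReal_one,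
        one_smul]
    change T a ∈ _
    rw [h2]
    exact Submodule.smul_mem _ _ (Submodule.subset_span (Finset.mem_image_of_mem F ha))
  · intro i j
    obtain ⟨k, hk⟩ := hRmul i j
    refine ⟨k, fun n hi hj _ f hf => ?_⟩
    obtain ⟨a, ha, rfl⟩ := hΩ n f hf
    obtain ⟨r, -, hra⟩ := hBsign n i hi a ha
    obtain ⟨s, -, hsa⟩ := hBsign n j hj a ha
    have hka : R k a = ((s * r : ℝ) : 𝕜) • a := by
      rw [← hk, mul_apply_eq_comp, hsa, map_smul, hra, smul_smul, RCLike.ofReal_mul]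
    rw [hinner0 n a ha, hinner n i a ha r hra, hinner n j a ha s hsa, hinner n k a ha _ hka]
    push_cast
    ring
  · intro n f hf
    obtain ⟨a, ha, rfl⟩ := hΩ n f hf
    exact LinearPMap.mem_domain_of_mem_graph (hFgraph a)
  · intro n f hf g hg hfg y hy
    obtain ⟨a, ha, rfl⟩ := hΩ n f hf
    obtain ⟨b, hb, rfl⟩ := hΩ n g hg
    have hab : a ≠ b := fun h => hfg (by subst h; rfl)
    rw [A.mem_graph_snd_inj hy (hFgraph b) rfl]
    have h := (hB n).orthogonal a ha b hb hab _ (hM.mul_mem hCM hTM)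
    rw [mul_apply_eq_comp, hC.inner_apply_left] at h
    simp only [F, inner_smul_left, inner_smul_right, h, mul_zero]
  · intro x y hxy ε hε
    obtain ⟨h, hx, hy⟩ := hcore x y hxy (ε / 2) (by positivity)
    -- `T` and `C` are continuous, so `h` may be replaced by a vector in the span of the `R j z`
    obtain ⟨h', hh', hd⟩ := Metric.mem_closure_iff.1 (hdense h) (ε / 2 / (‖T‖ + ‖C‖ + 1))
      (by positivity)
    rw [dist_comm, dist_eq_norm, lt_div_iff₀ (by positivity)] at hd
    refine ⟨T h', C h', hgraph h', ?_, ?_, ?_⟩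
    · have h1 := Submodule.mem_map_of_mem (f := (T : H →ₗ[𝕜] H)) hh'
      refine (Submodule.map_span_le _ _ _).2 ?_ h1
      rintro _ ⟨j, rfl⟩
      have h2 : T (R j z) = (c : 𝕜)⁻¹ • e j := by
        rw [smul_smul, inv_mul_cancel₀ (RCLike.ofReal_ne_zero.2 hcpos.ne'), one_smul]
      change T (R j z) ∈ _
      rw [h2]
      exact Submodule.smul_mem _ _ (Submodule.subset_span ⟨j, rfl⟩)
    · have h1 : ‖T h' - T h‖ ≤ ‖h' - h‖ * (‖T‖ + ‖C‖ + 1) := by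
        rw [← map_sub]
        refine (T.le_opNorm _).trans ?_
        rw [mul_comm]
        gcongr
        linarith [norm_nonneg C]
      linarith [norm_sub_le_norm_sub_add_norm_sub (T h') (T h) x]
    · have h1 : ‖C h' - C h‖ ≤ ‖h' - h‖ * (‖T‖ + ‖C‖ + 1) := by
        rw [← map_sub]
        refine (C.le_opNorm _).trans ?_
        rw [mul_comm]
        gcongr
        linarith [norm_nonneg T]
      linarith [norm_sub_le_norm_sub_add_norm_sub (C h') (C h) y]

/-! ### Finite samplings and scales of a sign system -/

section Parseval

variable {𝕜 H : Type*} [RCLike 𝕜] [NormedAddCommGroup H] [InnerProductSpace 𝕜 H]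

theorem Orthonormal.inner_eq_sum_finset {Ω : Finset H}
    (h : Orthonormal 𝕜 (fun f : Ω => (f : H))) (x : H) {y : H}
    (hy : y ∈ Submodule.span 𝕜 (Ω : Set H)) :
    ⟪x, y⟫_𝕜 = ∑ f ∈ Ω, ⟪x, f⟫_𝕜 * ⟪f, y⟫_𝕜 := by
  induction hy using Submodule.span_induction with
  | mem g hg =>
    have h1 : ∀ f ∈ Ω, f ≠ g → ⟪f, g⟫_𝕜 = 0 := fun f hf hfg =>
      h.2 (i := ⟨f, hf⟩) (j := ⟨g, hg⟩) (fun h => hfg (congrArg Subtype.val h))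
    have h2 : ⟪g, g⟫_𝕜 = 1 := by
      rw [inner_self_eq_norm_sq_to_K, h.1 ⟨g, hg⟩]
      simp
    rw [Finset.sum_eq_single_of_mem g hg fun f hf hfg => by rw [h1 f hf hfg, mul_zero], h2, mul_one]
  | zero => simp
  | add a b _ _ ha hb => simp only [inner_add_right, ha, hb, mul_add, Finset.sum_add_distrib]
  | smul c a _ ha =>
    rw [inner_smul_right, ha, Finset.mul_sum]
    refine Finset.sum_congr rfl fun f _ => ?_
    rw [inner_smul_right]
    ring

theorem Orthonormal.norm_sq_eq_sum_finset {Ω : Finset H}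
    (h : Orthonormal 𝕜 (fun f : Ω => (f : H))) {y : H}
    (hy : y ∈ Submodule.span 𝕜 (Ω : Set H)) : ‖y‖ ^ 2 = ∑ f ∈ Ω, ‖⟪f, y⟫_𝕜‖ ^ 2 := by
  have h1 := h.inner_eq_sum_finset y hy
  rw [inner_self_eq_norm_sq_to_K] at h1
  have h2 : ∀ f ∈ Ω, ⟪y, f⟫_𝕜 * ⟪f, y⟫_𝕜 = ((‖⟪f, y⟫_𝕜‖ ^ 2 : ℝ) : 𝕜) := fun f _ => by
    rw [← inner_conj_symm, RCLike.conj_mul, RCLike.ofReal_pow]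
  rw [Finset.sum_congr rfl h2, ← RCLike.ofReal_sum, ← RCLike.ofReal_pow] at h1
  exact RCLike.ofReal_injective h1

theorem Orthonormal.sum_finset_le {Ω : Finset H}
    (h : Orthonormal 𝕜 (fun f : Ω => (f : H))) (x : H) :
    ∑ f ∈ Ω, ‖⟪f, x⟫_𝕜‖ ^ 2 ≤ ‖x‖ ^ 2 := by
  rw [← Finset.sum_coe_sort Ω fun f => ‖⟪f, x⟫_𝕜‖ ^ 2]
  exact h.sum_inner_products_le x

end Parseval

namespace SignSystem

variable {𝕜 H : Type} [RCLike 𝕜] [NormedAddCommGroup H] [InnerProductSpace 𝕜 H]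
  {A : H →ₗ.[𝕜] H} (E : SignSystem A)

theorem norm_inner_e {n j : ℕ} (hj : j ≤ n) {f : H} (hf : f ∈ E.Ω n) :
    ‖⟪f, E.e j⟫_𝕜‖ = ‖⟪f, E.e 0⟫_𝕜‖ := by
  rcases E.inner_e n j hj f hf with h | h <;> rw [h]
  exact norm_neg _

theorem sum_norm_inner_e_zero (n : ℕ) : ∑ f ∈ E.Ω n, ‖⟪f, E.e 0⟫_𝕜‖ ^ 2 = 1 := by
  rw [← (E.orthonormal n).norm_sq_eq_sum_finset (E.e_mem n 0 (Nat.zero_le n)), E.norm_e_zero,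
    one_pow]

theorem norm_e (j : ℕ) : ‖E.e j‖ = 1 := by
  have h : ‖E.e j‖ ^ 2 = 1 := by
    rw [(E.orthonormal j).norm_sq_eq_sum_finset (E.e_mem j j le_rfl), ← E.sum_norm_inner_e_zero j]
    exact Finset.sum_congr rfl fun f hf => by rw [E.norm_inner_e le_rfl hf]
  nlinarith [norm_nonneg (E.e j)]

theorem inner_self_eq_one {n : ℕ} {f : H} (hf : f ∈ E.Ω n) : ⟪f, f⟫_𝕜 = 1 := by
  rw [inner_self_eq_norm_sq_to_K, (E.orthonormal n).1 ⟨f, hf⟩]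
  simp

theorem inner_eq_zero {n : ℕ} {f g : H} (hf : f ∈ E.Ω n) (hg : g ∈ E.Ω n) (hfg : f ≠ g) :
    ⟪f, g⟫_𝕜 = 0 :=
  (E.orthonormal n).2 (i := ⟨f, hf⟩) (j := ⟨g, hg⟩) fun h => hfg (congrArg Subtype.val h)

/-- The weights of the scale with `n + 1` terms: `2⁻¹, 2⁻², …, 2⁻ⁿ, 2⁻ⁿ`, where the last
one is repeated to make the sum `1`. -/
def weight (n j : ℕ) : ℝ≥0 := if j < n then (1 / 2) ^ (j + 1) else (1 / 2) ^ n

theorem weight_of_lt {n j : ℕ} (h : j < n) : (weight n j : ℝ) = (1 / 2) ^ (j + 1) := by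
  simp [weight, h]

theorem weight_self (n : ℕ) : (weight n n : ℝ) = (1 / 2) ^ n := by
  simp [weight]

theorem weight_le (n j : ℕ) (h : j ≤ n) : (weight n j : ℝ) ≤ 1 := by
  rcases h.lt_or_eq with h | rfl
  · rw [weight_of_lt h]
    exact pow_le_one₀ (by norm_num) (by norm_num)
  · rw [weight_self]
    exact pow_le_one₀ (by norm_num) (by norm_num)

theorem sum_weight_of_le {n m : ℕ} (h : m ≤ n) :
    ∑ j ∈ Finset.range m, (weight n j : ℝ) = 1 - (1 / 2) ^ m := by
  induction m with
  | zero => simp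
  | succ m ih =>
    rw [Finset.sum_range_succ, ih (by omega), weight_of_lt (by omega)]
    ring

theorem sum_weight (n : ℕ) : ∑ j ∈ Finset.range (n + 1), (weight n j : ℝ) = 1 := by
  rw [Finset.sum_range_succ, sum_weight_of_le le_rfl, weight_self]
  ring

theorem sum_Ico_weight_le (n m : ℕ) :
    ∑ j ∈ Finset.Ico m (n + 1), (weight n j : ℝ) ≤ (1 / 2) ^ m := by
  rcases le_or_gt m n with h | h
  · have h1 := Finset.sum_range_add_sum_Ico (fun j => (weight n j : ℝ)) (h.trans (Nat.le_succ n))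
    rw [sum_weight_of_le h, sum_weight] at h1
    linarith
  · rw [Finset.Ico_eq_empty (by omega), Finset.sum_empty]
    positivity

/-- The `n`-th finite scale. All its vectors are unit vectors. -/
def scale (n : ℕ) : FiniteScale H where
  N := n + 1
  e := E.e
  c := weight n
  sum_eq_one := by simp only [E.norm_e, one_pow, mul_one, sum_weight]

/-- All `e j` have the same absolute coordinates, so the mass does not involve the weights. -/
theorem mass_scale {n : ℕ} {F : Finset H} (hF : F ⊆ E.Ω n) :
    (E.scale n).mass 𝕜 F = ∑ f ∈ F, ‖⟪f, E.e 0⟫_𝕜‖ ^ 2 := by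
  have h : ∀ j ∈ Finset.range (n + 1), (weight n j : ℝ) * ∑ f ∈ F, ‖⟪f, E.e j⟫_𝕜‖ ^ 2
      = weight n j * ∑ f ∈ F, ‖⟪f, E.e 0⟫_𝕜‖ ^ 2 := fun j hj => by
    congr 1
    exact Finset.sum_congr rfl fun f hf => by
      rw [E.norm_inner_e (Nat.lt_succ_iff.1 (Finset.mem_range.1 hj)) (hF hf)]
  rw [FiniteScale.mass]
  change ∑ j ∈ Finset.range (n + 1), (weight n j : ℝ) * ∑ f ∈ F, ‖⟪f, E.e j⟫_𝕜‖ ^ 2 = _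
  rw [Finset.sum_congr rfl h, ← Finset.sum_mul, sum_weight, one_mul]

theorem mass_scale_self (n : ℕ) : (E.scale n).mass 𝕜 (E.Ω n) = 1 := by
  rw [E.mass_scale subset_rfl, E.sum_norm_inner_e_zero]

theorem mass_scale_mono {n : ℕ} {F G : Finset H} (hFG : F ⊆ G) (hG : G ⊆ E.Ω n) :
    (E.scale n).mass 𝕜 F ≤ (E.scale n).mass 𝕜 G := by
  rw [E.mass_scale hG, E.mass_scale (hFG.trans hG)]
  exact Finset.sum_le_sum_of_subset_of_nonneg hFG fun _ _ _ => by positivity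

theorem mass_scale_mem_Icc {n : ℕ} {F : Finset H} (hF : F ⊆ E.Ω n) :
    (E.scale n).mass 𝕜 F ∈ Set.Icc (0 : ℝ) 1 := by
  refine ⟨?_, (E.mass_scale_mono hF subset_rfl).trans (E.mass_scale_self n).le⟩
  rw [E.mass_scale hF]
  exact Finset.sum_nonneg fun _ _ => by positivity

theorem transform_scale {n : ℕ} {f : H} (hf : f ∈ E.Ω n) (x : H) :
    (E.scale n).transform 𝕜 x f = ⟪f, x⟫_𝕜 / ⟪f, E.e 0⟫_𝕜 := by
  rw [FiniteScale.transform, E.mass_scale (Finset.singleton_subset_iff.2 hf), Finset.sum_singleton,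
    Real.sqrt_sq (norm_nonneg _), ← E.inner_e_zero n f hf]

theorem transform_scale_e {n j : ℕ} (hj : j ≤ n) {f : H} (hf : f ∈ E.Ω n) :
    (E.scale n).transform 𝕜 (E.e j) f = 1 ∨ (E.scale n).transform 𝕜 (E.e j) f = -1 := by
  have h0 := E.inner_e_zero_ne n f hf
  rw [E.transform_scale hf]
  rcases E.inner_e n j hj f hf with h | h <;> rw [h]
  · exact Or.inl (div_self h0)
  · exact Or.inr (by rw [neg_div, div_self h0])

/-- Chebyshev's inequality for the internal transform. -/
theorem mass_filter_transform_le {n : ℕ} (x : H) {ε : ℝ} (hε : 0 < ε) {F : Finset H}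
    (hF : F ⊆ E.Ω n) (h : ∀ f ∈ F, ε ≤ ‖(E.scale n).transform 𝕜 x f‖) :
    (E.scale n).mass 𝕜 F ≤ ‖x‖ ^ 2 / ε ^ 2 := by
  rw [E.mass_scale hF, le_div_iff₀ (by positivity), Finset.sum_mul]
  calc ∑ f ∈ F, ‖⟪f, E.e 0⟫_𝕜‖ ^ 2 * ε ^ 2 ≤ ∑ f ∈ F, ‖⟪f, x⟫_𝕜‖ ^ 2 := by
        refine Finset.sum_le_sum fun f hf => ?_
        have h1 := h f hf
        rw [E.transform_scale (hF hf), norm_div,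
          le_div_iff₀ (norm_pos_iff.2 (E.inner_e_zero_ne n f (hF hf)))] at h1
        rw [← mul_pow, mul_comm]
        exact pow_le_pow_left₀ (by positivity) h1 2
    _ ≤ ∑ f ∈ E.Ω n, ‖⟪f, x⟫_𝕜‖ ^ 2 :=
        Finset.sum_le_sum_of_subset_of_nonneg hF fun _ _ _ => by positivity
    _ ≤ ‖x‖ ^ 2 := (E.orthonormal n).sum_finset_le x

theorem span_le_domain (n : ℕ) : Submodule.span 𝕜 (E.Ω n : Set H) ≤ A.domain :=
  Submodule.span_le.2 fun f hf => E.mem_domain n f hf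

/-- The compression of `A` to the span of `Ω n`. -/
def compression (n : ℕ) :
    Submodule.span 𝕜 (E.Ω n : Set H) →ₗ[𝕜] Submodule.span 𝕜 (E.Ω n : Set H) :=
  ((Submodule.span 𝕜 (E.Ω n : Set H)).orthogonalProjectionOnto : H →ₗ[𝕜] _) ∘ₗ A.toFun ∘ₗ
    Submodule.inclusion (E.span_le_domain n)

theorem coe_compression (n : ℕ) (x : Submodule.span 𝕜 (E.Ω n : Set H)) :
    (E.compression n x : H)
      = (Submodule.span 𝕜 (E.Ω n : Set H)).starProjection (A ⟨x, E.span_le_domain n x.2⟩) :=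
  rfl

variable [CompleteSpace H] (hA : IsSelfAdjoint A)
include hA

theorem compression_isSymmetric (n : ℕ) : (E.compression n).IsSymmetric := by
  intro x y
  have h := (LinearPMap.mem_graph_iff_of_isSelfAdjoint hA).1
    (A.mem_graph ⟨x, E.span_le_domain n x.2⟩) _ _ (A.mem_graph ⟨y, E.span_le_domain n y.2⟩)
  rw [Submodule.coe_inner, Submodule.coe_inner, coe_compression, coe_compression,
    (isSelfAdjoint_starProjection _).inner_apply_left,
    Submodule.starProjection_eq_self_iff.2 y.2, h,
    ← (isSelfAdjoint_starProjection _).inner_apply_left,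
    Submodule.starProjection_eq_self_iff.2 x.2]

omit [CompleteSpace H] hA in
theorem compression_apply (n : ℕ) {f : H} (hf : f ∈ E.Ω n)
    (hf' : f ∈ Submodule.span 𝕜 (E.Ω n : Set H)) :
    E.compression n ⟨f, hf'⟩ = ⟪f, A ⟨f, E.mem_domain n f hf⟩⟫_𝕜 • ⟨f, hf'⟩ := by
  ext
  rw [coe_compression]
  refine Submodule.eq_starProjection_of_mem_of_inner_eq_zero
    (Submodule.smul_mem _ _ hf') fun g hg => ?_
  induction hg using Submodule.span_induction with
  | mem g hg =>
    rw [← inner_conj_symm, inner_sub_right]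
    simp only [SetLike.val_smul, inner_smul_right]
    by_cases h : f = g
    · subst h
      rw [E.inner_self_eq_one hg, mul_one, sub_self, map_zero]
    · rw [E.inner_apply_eq_zero n g hg f hf (Ne.symm h) _ (A.mem_graph ⟨f, E.mem_domain n f hf⟩),
        E.inner_eq_zero hg hf (Ne.symm h), mul_zero, sub_zero, map_zero]
  | zero => exact inner_zero_right _
  | add a b _ _ ha hb => rw [inner_add_right, ha, hb, add_zero]
  | smul c a _ ha => rw [inner_smul_right, ha, mul_zero]

/-- The `n`-th finite sampling: the span of `Ω n` with the compression of `A`. -/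
def sampling (n : ℕ) : FiniteSampling 𝕜 H where
  V := Submodule.span 𝕜 (E.Ω n : Set H)
  finiteDimensional := inferInstance
  A := E.compression n
  isSymmetric := E.compression_isSymmetric hA n
  Ω := E.Ω n
  orthonormal := E.orthonormal n
  span_eq := rfl
  hasEigenvector f hf hfΩ := by
    refine ⟨_, Module.End.mem_eigenspace_iff.2 (E.compression_apply n hfΩ hf), fun h => ?_⟩
    have h1 := E.inner_e_zero_ne n f hfΩ
    rw [show f = 0 from congrArg Subtype.val h, inner_zero_left] at h1
    exact h1 rfl

omit [CompleteSpace H] hA in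
theorem dense_span_e (hdense : Dense (A.domain : Set H)) :
    Dense (Submodule.span 𝕜 (Set.range E.e) : Set H) := by
  refine dense_closure.1 (hdense.mono fun x hx => Metric.mem_closure_iff.2 fun ε hε => ?_)
  obtain ⟨u, -, -, hu, h, -⟩ := E.core x _ (A.mem_graph ⟨x, hx⟩) ε hε
  exact ⟨u, hu, by rwa [dist_comm, dist_eq_norm]⟩

omit [CompleteSpace H] hA in
theorem eventually_mem_span {x : H} (hx : x ∈ Submodule.span 𝕜 (Set.range E.e)) :
    ∀ᶠ n in Filter.atTop, x ∈ Submodule.span 𝕜 (E.Ω n : Set H) := by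
  induction hx using Submodule.span_induction with
  | mem x hx =>
    obtain ⟨j, rfl⟩ := hx
    exact (Filter.eventually_ge_atTop j).mono fun n hn => E.e_mem n j hn
  | zero => exact Filter.Eventually.of_forall fun _ => Submodule.zero_mem _
  | add a b _ _ ha hb => exact (ha.and hb).mono fun n h => Submodule.add_mem _ h.1 h.2
  | smul c a _ ha => exact ha.mono fun n h => Submodule.smul_mem _ c h

omit [CompleteSpace H] hA in
theorem tendsto_starProjection (hdense : Dense (A.domain : Set H)) (y : H) :
    Filter.Tendsto (fun n => (Submodule.span 𝕜 (E.Ω n : Set H)).starProjection y) Filter.atTop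
      (𝓝 y) := by
  rw [Metric.tendsto_nhds]
  intro ε hε
  obtain ⟨u, hu, hd⟩ := Metric.mem_closure_iff.1 (E.dense_span_e hdense y) (ε / 2) (by positivity)
  filter_upwards [E.eventually_mem_span hu] with n hn
  set P := (Submodule.span 𝕜 (E.Ω n : Set H)).starProjection
  have h1 : P u = u := Submodule.starProjection_eq_self_iff.2 hn
  calc dist (P y) y ≤ dist (P y) (P u) + dist (P u) y := dist_triangle _ _ _
    _ ≤ dist y u + dist u y := by
        rw [h1, dist_eq_norm (P y) u, dist_eq_norm y u]
        gcongr
        conv_lhs => rw [← h1, ← map_sub]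
        exact Submodule.norm_starProjection_apply_le _ _
    _ < ε := by rw [dist_comm u y]; linarith

omit [CompleteSpace H] hA in
/-- On a fixed vector of the finite subspaces, the compressions converge to `A`. The vector is given
as an eventually constant sequence because it lies in these subspaces only from some index on. -/
theorem tendsto_compression (hdense : Dense (A.domain : Set H)) {u v : H}
    (huv : (u, v) ∈ A.graph) (x : ∀ n, Submodule.span 𝕜 (E.Ω n : Set H))
    (hx : ∀ᶠ n in Filter.atTop, (x n : H) = u) :
    Filter.Tendsto (fun n => (E.compression n (x n) : H)) Filter.atTop (𝓝 v) := by
  refine (E.tendsto_starProjection hdense v).congr' (hx.mono fun n hn => ?_)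
  change _ = (E.compression n (x n) : H)
  rw [coe_compression, A.mem_graph_snd_inj huv
    (A.mem_graph ⟨x n, E.span_le_domain n (x n).2⟩) hn.symm]

/-- Every point of the graph of `A` is a limit of points of the graphs of the finite samplings. -/
theorem exists_graph_tendsto {x y : H} (hxy : (x, y) ∈ A.graph) :
    ∃ a b : ℕ → H, (∀ n, (a n, b n) ∈ (E.sampling hA n).graph) ∧
      Filter.Tendsto a Filter.atTop (𝓝 x) ∧ Filter.Tendsto b Filter.atTop (𝓝 y) := by
  have hne : ∀ n, (E.sampling hA n).graph.Nonempty := fun n => ⟨_, 0, rfl⟩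
  -- nearest points up to `1 / (n + 1)`; their distances tend to `0` because `span e` is a core
  have hpick : ∀ n : ℕ, ∃ p ∈ (E.sampling hA n).graph,
      dist (x, y) p < Metric.infDist (x, y) (E.sampling hA n).graph + 1 / ((n : ℝ) + 1) :=
    fun n => (Metric.infDist_lt_iff (hne n)).1 (lt_add_of_pos_right _ (by positivity))
  choose p hp hd using hpick
  have hinf : Filter.Tendsto (fun n => Metric.infDist (x, y) (E.sampling hA n).graph)
      Filter.atTop (𝓝 0) := by
    rw [Metric.tendsto_nhds]
    intro ε hε
    obtain ⟨u, v, huv, hu, hux, hvy⟩ := E.core x y hxy (ε / 2) (by positivity)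
    classical
    have hmem := E.eventually_mem_span hu
    let z : ∀ n, Submodule.span 𝕜 (E.Ω n : Set H) := fun n =>
      if h : u ∈ Submodule.span 𝕜 (E.Ω n : Set H) then ⟨u, h⟩ else 0
    have hz : ∀ᶠ n in Filter.atTop, (z n : H) = u := hmem.mono fun n hn => by simp [z, hn]
    have hlim := E.tendsto_compression hA.dense_domain huv z hz
    filter_upwards [hz, Metric.tendsto_nhds.1 hlim (ε / 2) (by positivity)] with n h1 h2
    rw [Real.dist_0_eq_abs, abs_of_nonneg Metric.infDist_nonneg]
    refine lt_of_le_of_lt (Metric.infDist_le_dist_of_mem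
      (y := ((z n : H), (E.compression n (z n) : H)))
      ⟨z n, rfl⟩) ?_
    rw [Prod.dist_eq, max_lt_iff]
    constructor
    · change dist x (z n : H) < ε
      rw [h1, dist_comm, dist_eq_norm]
      linarith
    · change dist y (E.compression n (z n) : H) < ε
      rw [← dist_eq_norm] at hvy
      rw [dist_comm]
      linarith [dist_triangle (E.compression n (z n) : H) v y]
  have hlim : Filter.Tendsto p Filter.atTop (𝓝 (x, y)) := by
    rw [tendsto_iff_dist_tendsto_zero]
    refine squeeze_zero (fun _ => dist_nonneg) (fun n => ?_)
      (by simpa only [add_zero] using hinf.add tendsto_one_div_add_atTop_nhds_zero_nat)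
    rw [dist_comm]
    exact (hd n).le
  exact ⟨fun n => (p n).1, fun n => (p n).2, hp, (continuous_fst.tendsto _).comp hlim,
    (continuous_snd.tendsto _).comp hlim⟩

theorem exists_graph_e_tendsto (j : ℕ) :
    ∃ (b : ℕ → H) (y : H), (∀ n, j ≤ n → (E.e j, b n) ∈ (E.sampling hA n).graph) ∧
      Filter.Tendsto b Filter.atTop (𝓝 y) := by
  classical
  let z : ∀ n, Submodule.span 𝕜 (E.Ω n : Set H) := fun n =>
    if h : j ≤ n then ⟨E.e j, E.e_mem n j h⟩ else 0
  have hz : ∀ n, j ≤ n → (z n : H) = E.e j := fun n hn => by simp [z, hn]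
  refine ⟨fun n => (E.compression n (z n) : H), _, fun n hn => ⟨z n, ?_⟩,
    E.tendsto_compression hA.dense_domain
      (A.mem_graph ⟨E.e j, E.span_le_domain j (E.e_mem j j le_rfl)⟩) z
      ((Filter.eventually_ge_atTop j).mono hz)⟩
  rw [← hz n hn]
  rfl

end SignSystem

/-! ### Transfer along ultrafilters -/

namespace NonstandardExtension

variable (S : NonstandardExtension.{w})

theorem pair_map_map {P X Y : Type} (a : P → X) (b : P → Y) (ζ : S.star P) :
    S.pair (S.map a ζ) (S.map b ζ) = S.map (fun p => (a p, b p)) ζ := by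
  rw [← S.pair_map (S.map (fun p => (a p, b p)) ζ), S.map_map, S.map_map]

theorem pair_map_right {X Y Z : Type} (ξ : S.star X) (b : Y → Z) (η : S.star Y) :
    S.pair ξ (S.map b η) = S.map (fun p : X × Y => (p.1, b p.2)) (S.pair ξ η) := by
  rw [← S.pair_map_map, ← S.map_map b Prod.snd, S.map_snd_pair]
  congr 1
  exact (S.map_fst_pair ξ η).symm

theorem pair_map_left {X Y Z : Type} (a : X → Z) (ξ : S.star X) (η : S.star Y) :
    S.pair (S.map a ξ) η = S.map (fun p : X × Y => (a p.1, p.2)) (S.pair ξ η) := by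
  rw [← S.pair_map_map, ← S.map_map a Prod.fst, S.map_fst_pair]
  congr 1
  exact (S.map_snd_pair ξ η).symm

theorem holds₂_map_iff {P X Y : Type} (r : X → Y → Prop) (a : P → X) (b : P → Y) (ζ : S.star P) :
    S.Holds₂ r (S.map a ζ) (S.map b ζ) ↔ ∀ᶠ p in S.ultrafilter ζ, r (a p) (b p) := by
  rw [Holds₂, S.pair_map_map, S.holds_map]
  rfl

theorem tendsto_ultrafilter_map_iff {X Y Z : Type} {l : Filter Z} (g : X → Y) (φ : Y → Z)
    (ζ : S.star X) : Filter.Tendsto φ (S.ultrafilter (S.map g ζ)) l ↔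
      Filter.Tendsto (fun x => φ (g x)) (S.ultrafilter ζ) l := by
  refine forall₂_congr fun u _ => ?_
  exact S.holds_map g (fun y => φ y ∈ u) ζ

theorem eventually_ultrafilter_map_iff {X Y : Type} (g : X → Y) (p : Y → Prop)
    (ζ : S.star X) : (∀ᶠ y in S.ultrafilter (S.map g ζ), p y) ↔ ∀ᶠ x in S.ultrafilter ζ, p (g x) :=
  S.holds_map g p ζ

theorem eventually_of_map_eq {X Y : Type} {g : X → Y} {ζ : S.star X} {η : S.star Y}
    (h : S.map g ζ = η) {p : Y → Prop} (hp : ∀ᶠ y in S.ultrafilter η, p y) :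
    ∀ᶠ x in S.ultrafilter ζ, p (g x) := by
  rw [← h] at hp
  exact (S.eventually_ultrafilter_map_iff g p ζ).1 hp

variable {S}

theorem IsSt.unique {X : Type} [TopologicalSpace X] [T2Space X] {ξ : S.star X} {x y : X}
    (hx : S.IsSt ξ x) (hy : S.IsSt ξ y) : x = y := by
  have e : S.map (fun x => x) ξ = ξ := S.map_id ξ
  rw [← e] at hx hy
  exact tendsto_nhds_unique ((S.isSt_map_iff _ ξ x).1 hx) ((S.isSt_map_iff _ ξ y).1 hy)

theorem IsSt.st_eq {X : Type} [TopologicalSpace X] [T2Space X] [Zero X] {ξ : S.star X} {x : X}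
    (hx : S.IsSt ξ x) : S.st ξ = x :=
  (S.isSt_st ⟨x, hx⟩).unique hx

theorem IsInfinite.tendsto {K : S.star ℕ} (hK : S.IsInfinite K) :
    Filter.Tendsto (fun n => n) (S.ultrafilter K : Filter ℕ) Filter.atTop :=
  Filter.tendsto_atTop.2 fun n => (hK n).mono fun _ h => h.le

theorem IsInfinite.tendsto_map {K : S.star ℕ} (hK : S.IsInfinite K) {P : Type} {n : P → ℕ}
    {ζ : S.star P} (hn : S.map n ζ = K) :
    Filter.Tendsto n (S.ultrafilter ζ : Filter P) Filter.atTop := by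
  rw [← hn] at hK
  exact (S.tendsto_ultrafilter_map_iff n (fun m => m) ζ).1 hK.tendsto

theorem IsInfinite.eventually_ge {K : S.star ℕ} (hK : S.IsInfinite K) {P : Type} {n : P → ℕ}
    {ζ : S.star P} (hn : S.map n ζ = K) (m : ℕ) : ∀ᶠ p in S.ultrafilter ζ, m ≤ n p :=
  (hK.tendsto_map hn).eventually_ge_atTop m

theorem IsInfinite.isSt_map {K : S.star ℕ} (hK : S.IsInfinite K) {X : Type} [TopologicalSpace X]
    {a : ℕ → X} {x : X} (ha : Filter.Tendsto a Filter.atTop (𝓝 x)) : S.IsSt (S.map a K) x :=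
  (S.isSt_map_iff a K x).2 (ha.comp hK.tendsto)

theorem isSt_std {X : Type} [TopologicalSpace X] {Y : Type} (η : S.star Y) (x : X) :
    S.IsSt (S.std x) x := by
  rw [← S.map_const x η, S.isSt_map_iff]
  exact tendsto_const_nhds

theorem IsSaturated.exists_isInfinite (hS : S.IsSaturated) : ∃ K : S.star ℕ, S.IsInfinite K := by
  have hmem : ∀ (ξ : S.star ℕ) (b : Set ℕ),
      S.Holds₂ (fun x b => x ∈ b) ξ (S.std b) ↔ S.Holds (fun x => x ∈ b) ξ := by
    intro ξ b
    rw [← S.map_const b ξ]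
    conv_lhs => rw [← S.map_id ξ]
    rw [S.map_map, S.holds₂_map_iff]
    rfl
  obtain ⟨K, hK⟩ := hS ℕ (fun n => S.std {k | n < k}) fun n =>
    ⟨S.std n, fun k hk => by
      rw [hmem, ← S.map_const n (S.std 0), S.holds_map]
      exact S.holds_of_forall (fun _ => hk) _⟩
  exact ⟨K, fun n => (hmem K _).1 (hK n)⟩

/-- A hyperreal that is bounded by standard numbers is nearstandard. -/
theorem isNearstandard_map_of_eventually_mem_Icc {X : Type} {f : X → ℝ}
    {ξ : S.star X} {a b : ℝ} (h : ∀ᶠ x in S.ultrafilter ξ, f x ∈ Set.Icc a b) :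
    S.IsNearstandard (S.map f ξ) := by
  obtain ⟨y, -, hy⟩ := (isCompact_Icc (a := a) (b := b)).ultrafilter_le_nhds
    ((S.ultrafilter ξ).map f) (Filter.le_principal_iff.2 h)
  exact ⟨y, (S.isSt_map_iff f ξ y).2 hy⟩

end NonstandardExtension

/-! ### The Loeb measure of a sign system -/

namespace SignSystem

variable {𝕜 H : Type} [RCLike 𝕜] [NormedAddCommGroup H] [InnerProductSpace 𝕜 H] [CompleteSpace H]
  {A : H →ₗ.[𝕜] H} (E : SignSystem A) (hA : IsSelfAdjoint A) {S : NonstandardExtension.{w}}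
  (K : S.star ℕ)

/-- The internal sampling at the hypernatural `K`. -/
abbrev iSampling : S.star (FiniteSampling 𝕜 H) := S.map (E.sampling hA) K

/-- The internal scale at the hypernatural `K`. -/
abbrev iScale : S.star (FiniteScale H) := S.map E.scale K

/-- The Loeb space over the hyperfinite orthonormal set `Ω K`. -/
abbrev Loeb : Type w := LoebSpace S (E.iSampling hA K) (E.iScale K)

variable {hA K}

/-- The subset of the Loeb space given by an internal set. -/
def ext (F : S.star (Finset H)) : Set (E.Loeb hA K) :=
  {f | S.Holds₂ (fun f F => f ∈ F) f.1 F}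

theorem eventually_mem (f : E.Loeb hA K) :
    ∀ᶠ p : H × ℕ in S.ultrafilter (S.pair f.1 K), p.1 ∈ E.Ω p.2 := by
  have h := f.2
  rw [NonstandardExtension.Holds₂, S.pair_map_right, S.holds_map] at h
  exact h

theorem eventually_mem_of_map {f : E.Loeb hA K} {P : Type} {ζ : S.star P} {a : P → H} {n : P → ℕ}
    (ha : S.map a ζ = f.1) (hn : S.map n ζ = K) : ∀ᶠ p in S.ultrafilter ζ, a p ∈ E.Ω (n p) := by
  refine S.eventually_of_map_eq (g := fun p => (a p, n p)) (η := S.pair f.1 K) ?_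
    (E.eventually_mem f)
  rw [← S.pair_map_map, ha, hn]

theorem mem_ext (F : S.star (Finset H)) (f : E.Loeb hA K) :
    f ∈ E.ext F ↔ S.Holds₂ (fun f F => f ∈ F) f.1 F :=
  Iff.rfl

theorem mem_ext_map {P : Type} (ζ : S.star P) (F : P → Finset H) (f : E.Loeb hA K) :
    f ∈ E.ext (S.map F ζ) ↔ ∀ᶠ q : H × P in S.ultrafilter (S.pair f.1 ζ), q.1 ∈ F q.2 := by
  rw [mem_ext, NonstandardExtension.Holds₂, S.pair_map_right, S.holds_map]
  rfl

theorem holds_subset_iff {P : Type} {ζ : S.star P} {n : P → ℕ} (hn : S.map n ζ = K)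
    (F : P → Finset H) :
    S.Holds₂ (fun F τ => F ⊆ FiniteSampling.Ω τ) (S.map F ζ) (E.iSampling hA K) ↔
      ∀ᶠ p in S.ultrafilter ζ, F p ⊆ E.Ω (n p) := by
  rw [iSampling, ← hn, S.map_map, S.holds₂_map_iff]
  rfl

/-- Inclusions between internal sets can be tested on points. -/
theorem eventually_subset_of_ext_subset {P : Type} {ζ : S.star P} {n : P → ℕ}
    (hn : S.map n ζ = K) {F G : P → Finset H} (hF : ∀ᶠ p in S.ultrafilter ζ, F p ⊆ E.Ω (n p))
    (h : (E.ext (S.map F ζ) : Set (E.Loeb hA K)) ⊆ E.ext (S.map G ζ)) :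
    ∀ᶠ p in S.ultrafilter ζ, F p ⊆ G p := by
  classical
  by_contra hcon
  rw [← Ultrafilter.eventually_not] at hcon
  have hpick : ∀ p, ∃ f : H, ¬ F p ⊆ G p → f ∈ F p ∧ f ∉ G p := by
    intro p
    by_cases hp : F p ⊆ G p
    · exact ⟨0, fun h => absurd hp h⟩
    · obtain ⟨f, hf⟩ := Finset.not_subset.1 hp
      exact ⟨f, fun _ => hf⟩
  -- otherwise a choice of points in `F p \ G p` defines a point of the Loeb space
  choose pick hpick using hpick
  have hmem : ∀ᶠ p in S.ultrafilter ζ, pick p ∈ E.Ω (n p) := by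
    filter_upwards [hcon, hF] with p h1 h2
    exact h2 (hpick p h1).1
  let f : E.Loeb hA K := ⟨S.map pick ζ, by
    rw [iSampling, ← hn, S.map_map, S.holds₂_map_iff]
    exact hmem⟩
  have h1 : f ∈ E.ext (S.map F ζ) := by
    refine (S.holds₂_map_iff (fun f F => f ∈ F) pick F ζ).2 ?_
    exact hcon.mono fun p hp => (hpick p hp).1
  have h2 := (S.holds₂_map_iff (fun f F => f ∈ F) pick G ζ).1 (h h1)
  obtain ⟨p, h3, h4⟩ := (hcon.and h2).exists
  exact (hpick p h3).2 h4

variable (hA K)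

/-- The standard part of the internal mass of an internal set. -/
def loebMass (F : S.star (Finset H)) : ℝ :=
  S.st (S.map (fun p : FiniteScale H × Finset H => p.1.mass 𝕜 p.2) (S.pair (E.iScale K) F))

variable {hA K}

omit [CompleteSpace H] in
theorem tendsto_loebMass {P : Type} {ζ : S.star P} {n : P → ℕ} (hn : S.map n ζ = K)
    {F : P → Finset H} (hF : ∀ᶠ p in S.ultrafilter ζ, F p ⊆ E.Ω (n p)) :
    Filter.Tendsto (fun p => (E.scale (n p)).mass 𝕜 (F p)) (S.ultrafilter ζ)
      (𝓝 (E.loebMass K (S.map F ζ))) := by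
  have e : S.map (fun p : FiniteScale H × Finset H => p.1.mass 𝕜 p.2)
      (S.pair (E.iScale K) (S.map F ζ)) = S.map (fun p => (E.scale (n p)).mass 𝕜 (F p)) ζ := by
    rw [iScale, ← hn, S.map_map, S.pair_map_map, S.map_map]
  rw [loebMass, e, ← S.isSt_map_iff]
  exact S.isSt_st (S.isNearstandard_map_of_eventually_mem_Icc
    (hF.mono fun p hp => E.mass_scale_mem_Icc hp))

omit [CompleteSpace H] in
theorem loebMass_eq {P : Type} {ζ : S.star P} {n : P → ℕ} (hn : S.map n ζ = K)
    {F : P → Finset H} (hF : ∀ᶠ p in S.ultrafilter ζ, F p ⊆ E.Ω (n p)) {a : ℝ}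
    (h : Filter.Tendsto (fun p => (E.scale (n p)).mass 𝕜 (F p)) (S.ultrafilter ζ) (𝓝 a)) :
    E.loebMass K (S.map F ζ) = a :=
  tendsto_nhds_unique (E.tendsto_loebMass hn hF) h

omit [CompleteSpace H] in
theorem loebMass_nonneg {P : Type} {ζ : S.star P} {n : P → ℕ} (hn : S.map n ζ = K)
    {F : P → Finset H} (hF : ∀ᶠ p in S.ultrafilter ζ, F p ⊆ E.Ω (n p)) :
    0 ≤ E.loebMass K (S.map F ζ) :=
  ge_of_tendsto (E.tendsto_loebMass hn hF) (hF.mono fun _ hp => (E.mass_scale_mem_Icc hp).1)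

theorem loebMass_le_of_ext_subset {P : Type} {ζ : S.star P} {n : P → ℕ}
    (hn : S.map n ζ = K) {F G : P → Finset H} (hF : ∀ᶠ p in S.ultrafilter ζ, F p ⊆ E.Ω (n p))
    (hG : ∀ᶠ p in S.ultrafilter ζ, G p ⊆ E.Ω (n p))
    (h : (E.ext (S.map F ζ) : Set (E.Loeb hA K)) ⊆ E.ext (S.map G ζ)) :
    E.loebMass K (S.map F ζ) ≤ E.loebMass K (S.map G ζ) := by
  refine le_of_tendsto_of_tendsto (E.tendsto_loebMass hn hF) (E.tendsto_loebMass hn hG) ?_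
  filter_upwards [E.eventually_subset_of_ext_subset hn hF h, hG] with p h1 h2
  exact E.mass_scale_mono h1 h2

/-- The set function on all subsets of the Loeb space that generates the Loeb outer measure. -/
def premeasure (X : Set (E.Loeb hA K)) : ℝ≥0∞ :=
  ⨅ (F : S.star (Finset H))
    (_ : S.Holds₂ (fun F τ => F ⊆ FiniteSampling.Ω τ) F (E.iSampling hA K))
    (_ : X = E.ext F), ENNReal.ofReal (E.loebMass K F)

theorem outerMeasure_eq_boundedBy :
    LoebSpace.outerMeasure (E.iSampling hA K) (E.iScale K)
      = OuterMeasure.boundedBy (E.premeasure : Set (E.Loeb hA K) → ℝ≥0∞) :=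
  rfl

omit [NormedAddCommGroup H] [CompleteSpace H] in
/-- Two internal sets and the index `K` are images of one point of the extension. -/
theorem exists_common_index (F G : S.star (Finset H)) :
    ∃ ζ : S.star (Finset H × Finset H × ℕ), S.map (fun p => p.1) ζ = F ∧
      S.map (fun p => p.2.1) ζ = G ∧ S.map (fun p => p.2.2) ζ = K := by
  refine ⟨S.pair F (S.pair G K), S.map_fst_pair _ _, ?_, ?_⟩
  · rw [← S.map_map Prod.fst Prod.snd, S.map_snd_pair, S.map_fst_pair]
  · rw [← S.map_map Prod.snd Prod.snd, S.map_snd_pair, S.map_snd_pair]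

/-- The infimum in the definition of the Loeb outer measure is attained, since an internal set is
determined by its points. -/
theorem premeasure_ext {F : S.star (Finset H)}
    (hF : S.Holds₂ (fun F τ => F ⊆ FiniteSampling.Ω τ) F (E.iSampling hA K)) :
    E.premeasure (E.ext F : Set (E.Loeb hA K)) = ENNReal.ofReal (E.loebMass K F) := by
  refine le_antisymm (iInf₂_le_of_le F hF (iInf_le _ rfl)) ?_
  refine le_iInf₂ fun G hG => le_iInf fun hFG => ENNReal.ofReal_le_ofReal ?_
  obtain ⟨ζ, rfl, rfl, hn⟩ := exists_common_index (K := K) F G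
  exact E.loebMass_le_of_ext_subset hn ((E.holds_subset_iff hn _).1 hF)
    ((E.holds_subset_iff hn _).1 hG) hFG.le

/-- Internal sets are Loeb measurable: the test sets for Carathéodory's criterion may be taken
internal, and the internal mass is additive. -/
theorem measurableSet_ext {F : S.star (Finset H)}
    (hF : S.Holds₂ (fun F τ => F ⊆ FiniteSampling.Ω τ) F (E.iSampling hA K)) :
    MeasurableSet (E.ext F : Set (E.Loeb hA K)) := by
  classical
  refine OuterMeasure.boundedBy_caratheodory (m := E.premeasure) fun t => ?_
  refine le_iInf₂ fun G hG => le_iInf fun ht => ?_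
  obtain ⟨ζ, rfl, rfl, hn⟩ := exists_common_index (K := K) F G
  have hF' := (E.holds_subset_iff hn _).1 hF
  have hG' := (E.holds_subset_iff hn _).1 hG
  have h1 : ∀ᶠ p : Finset H × Finset H × ℕ in S.ultrafilter ζ, p.2.1 ∩ p.1 ⊆ E.Ω p.2.2 :=
    hG'.mono fun p hp => Finset.inter_subset_left.trans hp
  have h2 : ∀ᶠ p : Finset H × Finset H × ℕ in S.ultrafilter ζ, p.2.1 \ p.1 ⊆ E.Ω p.2.2 :=
    hG'.mono fun p hp => Finset.sdiff_subset.trans hp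
  have e1 : t ∩ E.ext (S.map (fun p => p.1) ζ) = E.ext (S.map (fun p => p.2.1 ∩ p.1) ζ) := by
    rw [ht]
    ext f
    rw [Set.mem_inter_iff, mem_ext_map, mem_ext_map, mem_ext_map, ← Filter.eventually_and]
    simp only [Finset.mem_inter]
  have e2 : t \ E.ext (S.map (fun p => p.1) ζ) = E.ext (S.map (fun p => p.2.1 \ p.1) ζ) := by
    rw [ht]
    ext f
    rw [Set.mem_sdiff, mem_ext_map, mem_ext_map, mem_ext_map, ← Ultrafilter.eventually_not,
      ← Filter.eventually_and]
    simp only [Finset.mem_sdiff]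
  rw [e1, e2, E.premeasure_ext ((E.holds_subset_iff hn _).2 h1),
    E.premeasure_ext ((E.holds_subset_iff hn _).2 h2),
    ← ENNReal.ofReal_add (E.loebMass_nonneg hn h1) (E.loebMass_nonneg hn h2)]
  refine ENNReal.ofReal_le_ofReal (le_of_eq ?_)
  refine tendsto_nhds_unique ((E.tendsto_loebMass hn h1).add (E.tendsto_loebMass hn h2))
    ((E.tendsto_loebMass hn hG').congr' ?_)
  filter_upwards [h1, h2, hG'] with p a1 a2 a3
  rw [E.mass_scale a1, E.mass_scale a2, E.mass_scale a3, add_comm,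
    ← Finset.sum_sdiff (Finset.inter_subset_left : p.2.1 ∩ p.1 ⊆ p.2.1),
    Finset.sdiff_inter_self_left]

end SignSystem

namespace SignSystem

variable {𝕜 H : Type} [RCLike 𝕜] [NormedAddCommGroup H] [InnerProductSpace 𝕜 H] [CompleteSpace H]
  {A : H →ₗ.[𝕜] H} (E : SignSystem A) {hA : IsSelfAdjoint A} {S : NonstandardExtension.{w}}
  {K : S.star ℕ}

theorem ext_std_empty : (E.ext (S.std ∅) : Set (E.Loeb hA K)) = ∅ := by
  rw [← S.map_const (∅ : Finset H) K]
  ext f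
  rw [mem_ext_map]
  simpa using (S.ultrafilter (S.pair f.1 K)).neBot.ne

theorem holds_std_empty_subset : S.Holds₂ (fun F τ => F ⊆ FiniteSampling.Ω τ) (S.std ∅)
    (E.iSampling hA K) := by
  rw [← S.map_const (∅ : Finset H) K, E.holds_subset_iff (S.map_id K)]
  simp

open Classical in
/-- The internal union of finitely many internal sets. -/
def partialUnion (F : ℕ → S.star (Finset H)) (m : ℕ) : S.star (Finset H) :=
  Nat.rec (S.std ∅) (fun k G => S.map (fun p : Finset H × Finset H => p.1 ∪ p.2) (S.pair G (F k))) m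

/-- Finite subadditivity of the Loeb mass. -/
theorem partialUnion_spec {F : ℕ → S.star (Finset H)}
    (hF : ∀ k, S.Holds₂ (fun F τ => F ⊆ FiniteSampling.Ω τ) (F k) (E.iSampling hA K)) (m : ℕ) :
    S.Holds₂ (fun F τ => F ⊆ FiniteSampling.Ω τ) (partialUnion F m) (E.iSampling hA K) ∧
      (∀ k < m, (E.ext (F k) : Set (E.Loeb hA K)) ⊆ E.ext (partialUnion F m)) ∧
      E.loebMass K (partialUnion F m) ≤ ∑ k ∈ Finset.range m, E.loebMass K (F k) := by
  classical
  induction m with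
  | zero =>
    refine ⟨E.holds_std_empty_subset, by simp, ?_⟩
    have : E.loebMass K (S.std ∅) = 0 := by
      rw [← S.map_const (∅ : Finset H) K]
      refine E.loebMass_eq (S.map_id K) (by simp) ?_
      simp only [FiniteScale.mass, Finset.sum_empty, mul_zero, Finset.sum_const_zero]
      exact tendsto_const_nhds
    rw [Finset.range_zero, Finset.sum_empty]
    exact this.le
  | succ m ih =>
    obtain ⟨h1, h2, h3⟩ := ih
    have hsucc : partialUnion F (m + 1)
        = S.map (fun p : Finset H × Finset H => p.1 ∪ p.2) (S.pair (partialUnion F m) (F m)) := by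
      simp only [partialUnion]
    rw [Finset.sum_range_succ]
    obtain ⟨ζ, hζ1, hζ2, hn⟩ := exists_common_index (K := K) (partialUnion F m) (F m)
    have hu : partialUnion F (m + 1) = S.map (fun p => p.1 ∪ p.2.1) ζ := by
      rw [hsucc, ← hζ1, ← hζ2, S.pair_map_map, S.map_map]
    have h4 := hF m
    have h5 := h2
    rw [← hζ1] at h1 h3
    rw [← hζ2] at h4
    have h1' := (E.holds_subset_iff hn _).1 h1
    have h4' := (E.holds_subset_iff hn _).1 h4
    have h6 : ∀ᶠ p : Finset H × Finset H × ℕ in S.ultrafilter ζ, p.1 ∪ p.2.1 ⊆ E.Ω p.2.2 := by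
      filter_upwards [h1', h4'] with p a b using Finset.union_subset a b
    refine ⟨?_, fun k hk => ?_, ?_⟩
    · rw [hu]
      exact (E.holds_subset_iff hn _).2 h6
    · rw [hu]
      rcases Nat.lt_succ_iff_lt_or_eq.1 hk with hk | rfl
      · refine (h2 k hk).trans ?_
        rw [← hζ1]
        intro f hf
        rw [mem_ext_map] at hf ⊢
        exact hf.mono fun q hq => Finset.mem_union_left _ hq
      · rw [← hζ2]
        intro f hf
        rw [mem_ext_map] at hf ⊢
        exact hf.mono fun q hq => Finset.mem_union_right _ hq
    · rw [hu, ← hζ2]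
      refine le_trans ?_ (add_le_add_left h3 _)
      refine le_of_tendsto_of_tendsto (E.tendsto_loebMass hn h6)
        ((E.tendsto_loebMass hn h1').add (E.tendsto_loebMass hn h4')) ?_
      filter_upwards [h1', h4', h6] with p a b c
      rw [E.mass_scale a, E.mass_scale b, E.mass_scale c, ← Finset.sum_union_inter]
      exact le_add_of_nonneg_right (Finset.sum_nonneg fun _ _ => by positivity)

theorem holds_Ω_subset : S.Holds₂ (fun F τ => F ⊆ FiniteSampling.Ω τ) (S.map E.Ω K)
    (E.iSampling hA K) :=
  (E.holds_subset_iff (S.map_id K) _).2 (Filter.Eventually.of_forall fun _ => subset_rfl)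

theorem ext_Ω : (E.ext (S.map E.Ω K) : Set (E.Loeb hA K)) = Set.univ := by
  ext f
  simp only [mem_ext_map, Set.mem_univ, iff_true]
  exact E.eventually_mem f

omit [CompleteSpace H] in
theorem loebMass_Ω : E.loebMass K (S.map E.Ω K) = 1 := by
  refine E.loebMass_eq (S.map_id K) (Filter.Eventually.of_forall fun _ => subset_rfl) ?_
  simp only [E.mass_scale_self]
  exact tendsto_const_nhds

/-- By saturation, a countable cover of the Loeb space by internal sets has a finite subcover. -/
theorem exists_finite_subcover (hS : S.IsSaturated) {F : ℕ → S.star (Finset H)}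
    (hcover : (⋃ k, E.ext (F k) : Set (E.Loeb hA K)) = Set.univ) :
    ∃ m : ℕ, ∀ f : E.Loeb hA K, ∃ k < m, f ∈ E.ext (F k) := by
  by_contra! hcon
  -- the internal sets `Ω \ F k`
  let B : ℕ → S.star (Set H) := fun k =>
    S.map (fun p : Finset H × ℕ => {f | f ∈ E.Ω p.2 ∧ f ∉ p.1}) (S.pair (F k) K)
  have hB : ∀ (ξ : S.star H) (k : ℕ), S.Holds₂ (fun x b => x ∈ b) ξ (B k) ↔
      S.Holds₂ (fun f τ => f ∈ FiniteSampling.Ω τ) ξ (E.iSampling hA K) ∧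
        ¬ S.Holds₂ (fun f F => f ∈ F) ξ (F k) := by
    intro ξ k
    obtain ⟨ζ, h1, h2, h3⟩ : ∃ ζ : S.star (H × Finset H × ℕ), S.map (fun p => p.1) ζ = ξ ∧
        S.map (fun p => p.2.1) ζ = F k ∧ S.map (fun p => p.2.2) ζ = K := by
      refine ⟨S.pair ξ (S.pair (F k) K), S.map_fst_pair _ _, ?_, ?_⟩
      · rw [← S.map_map Prod.fst Prod.snd, S.map_snd_pair, S.map_fst_pair]
      · rw [← S.map_map Prod.snd Prod.snd, S.map_snd_pair, S.map_snd_pair]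
    have h4 : B k = S.map (fun p : H × Finset H × ℕ => {f | f ∈ E.Ω p.2.2 ∧ f ∉ p.2.1}) ζ := by
      simp only [B]
      rw [← h2, ← h3, S.pair_map_map, S.map_map]
    have h5 : E.iSampling hA K = S.map (fun p : H × Finset H × ℕ => E.sampling hA p.2.2) ζ := by
      rw [iSampling, ← h3, S.map_map]
    rw [h4, h5, ← h2, ← h1, S.holds₂_map_iff, S.holds₂_map_iff, S.holds₂_map_iff,
      ← Ultrafilter.eventually_not, ← Filter.eventually_and]
    rfl
  obtain ⟨ξ, hξ⟩ := hS H B fun m => by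
    obtain ⟨f, hf⟩ := hcon m
    exact ⟨f.1, fun k hk => (hB _ _).2 ⟨f.2, hf k hk⟩⟩
  let f : E.Loeb hA K := ⟨ξ, ((hB ξ 0).1 (hξ 0)).1⟩
  have hf : f ∈ (⋃ k, E.ext (F k) : Set (E.Loeb hA K)) := hcover ▸ Set.mem_univ f
  obtain ⟨k, hk⟩ := Set.mem_iUnion.1 hf
  exact ((hB ξ k).1 (hξ k)).2 hk

/-- A countable internal cover of the Loeb space has a finite subcover, and finite covers have total
mass at least `1`. -/
theorem one_le_outerMeasure_univ (hS : S.IsSaturated) :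
    1 ≤ LoebSpace.outerMeasure (E.iSampling hA K) (E.iScale K) Set.univ := by
  rw [E.outerMeasure_eq_boundedBy, OuterMeasure.boundedBy_apply]
  refine le_iInf₂ fun t ht => ?_
  by_cases hint : ∀ k, ∃ F : S.star (Finset H),
      S.Holds₂ (fun F τ => F ⊆ FiniteSampling.Ω τ) F (E.iSampling hA K) ∧ t k = E.ext F
  · choose F hF htF using hint
    have hterm : ∀ k, ENNReal.ofReal (E.loebMass K (F k))
        ≤ ⨆ _ : (t k).Nonempty, E.premeasure (t k) := by
      intro k
      rcases (t k).eq_empty_or_nonempty with h | h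
      · have h1 : E.loebMass K (F k) ≤ 0 := by
          obtain ⟨ζ, h1, h2, hn⟩ := exists_common_index (K := K) (F k) (S.std ∅)
          have h3 := E.loebMass_le_of_ext_subset (hA := hA) hn (F := fun p => p.1)
            (G := fun p => p.2.1)
            ((E.holds_subset_iff (hA := hA) hn _).1 (h1.symm ▸ hF k))
            ((E.holds_subset_iff (hA := hA) hn _).1 (h2.symm ▸ E.holds_std_empty_subset))
            (by rw [h1, ← htF, h]; exact Set.empty_subset _)
          rw [h1, h2] at h3
          exact h3.trans (E.partialUnion_spec hF 0).2.2
        rw [ENNReal.ofReal_of_nonpos h1]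
        exact bot_le
      · rw [iSup_pos h, htF k, E.premeasure_ext (hF k)]
    obtain ⟨m, hm⟩ := E.exists_finite_subcover (hA := hA) hS (F := F)
      ((Set.iUnion_congr htF).symm.trans (Set.eq_univ_of_univ_subset ht))
    obtain ⟨h1, h2, h3⟩ := E.partialUnion_spec hF m
    have h4 : 1 ≤ E.loebMass K (partialUnion F m) := by
      obtain ⟨ζ, e1, e2, hn⟩ := exists_common_index (K := K) (S.map E.Ω K) (partialUnion F m)
      have h5 := E.loebMass_le_of_ext_subset (hA := hA) hn (F := fun p => p.1)
        (G := fun p => p.2.1)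
        ((E.holds_subset_iff (hA := hA) hn _).1 (e1.symm ▸ E.holds_Ω_subset))
        ((E.holds_subset_iff (hA := hA) hn _).1 (e2.symm ▸ h1))
        (fun f _ => by
          obtain ⟨k, hk, hf⟩ := hm f
          rw [e2]
          exact h2 k hk hf)
      rwa [e1, e2, E.loebMass_Ω] at h5
    calc (1 : ℝ≥0∞) ≤ ENNReal.ofReal (∑ k ∈ Finset.range m, E.loebMass K (F k)) := by
          rw [← ENNReal.ofReal_one]
          exact ENNReal.ofReal_le_ofReal (h4.trans h3)
      _ ≤ ∑ k ∈ Finset.range m, ENNReal.ofReal (E.loebMass K (F k)) := by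
          rw [ENNReal.ofReal_sum_of_nonneg]
          intro k _
          obtain ⟨ζ, e1, -, hn⟩ := exists_common_index (K := K) (F k) (F k)
          rw [← e1]
          exact E.loebMass_nonneg hn ((E.holds_subset_iff (hA := hA) hn _).1 (e1.symm ▸ hF k))
      _ ≤ ∑ k ∈ Finset.range m, ⨆ _ : (t k).Nonempty, E.premeasure (t k) :=
          Finset.sum_le_sum fun k _ => hterm k
      _ ≤ _ := ENNReal.sum_le_tsum _
  · push Not at hint
    obtain ⟨k, hk⟩ := hint
    have hne : (t k).Nonempty := by
      rw [Set.nonempty_iff_ne_empty, ← E.ext_std_empty (K := K) (hA := hA)]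
      exact hk _ E.holds_std_empty_subset
    have htop : E.premeasure (t k) = ⊤ := by
      simp only [premeasure, iInf_eq_top]
      exact fun F hF h => absurd h (hk F hF)
    refine le_trans ?_ (ENNReal.le_tsum k)
    rw [iSup_pos hne, htop]
    exact le_top

theorem measure_le {X : Set (E.Loeb hA K)} (hX : MeasurableSet X) :
    LoebSpace.measure (E.iSampling hA K) (E.iScale K) X ≤ E.premeasure X := by
  rw [LoebSpace.measure, toMeasure_apply _ _ hX]
  exact OuterMeasure.boundedBy_le X

/-- The Loeb measure of an internal set is the standard part of its internal mass. -/
theorem measure_ext (hS : S.IsSaturated) {F : S.star (Finset H)}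
    (hF : S.Holds₂ (fun F τ => F ⊆ FiniteSampling.Ω τ) F (E.iSampling hA K)) :
    LoebSpace.measure (E.iSampling hA K) (E.iScale K) (E.ext F)
      = ENNReal.ofReal (E.loebMass K F) := by
  classical
  obtain ⟨ζ, rfl, -, hn⟩ := exists_common_index (K := K) F F
  have hm := E.measurableSet_ext hF
  refine le_antisymm ((E.measure_le hm).trans_eq (E.premeasure_ext hF)) ?_
  -- the upper bound for the complement and the total mass `1` give the lower bound
  have hF' := (E.holds_subset_iff hn _).1 hF
  have hG' : ∀ᶠ p : Finset H × Finset H × ℕ in S.ultrafilter ζ, E.Ω p.2.2 \ p.1 ⊆ E.Ω p.2.2 :=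
    Filter.Eventually.of_forall fun p => Finset.sdiff_subset
  have hG := (E.holds_subset_iff (hA := hA) hn _).2 hG'
  have hcompl : (E.ext (S.map (fun p => p.1) ζ) : Set (E.Loeb hA K))ᶜ
      = E.ext (S.map (fun p => E.Ω p.2.2 \ p.1) ζ) := by
    ext f
    rw [Set.mem_compl_iff, mem_ext_map, mem_ext_map, ← Ultrafilter.eventually_not]
    have hmem : ∀ᶠ q : H × Finset H × Finset H × ℕ in S.ultrafilter (S.pair f.1 ζ),
        q.1 ∈ E.Ω q.2.2.2 :=
      E.eventually_mem_of_map (S.map_fst_pair _ _) (by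
        rw [← S.map_map (fun p : Finset H × Finset H × ℕ => p.2.2) Prod.snd, S.map_snd_pair, hn])
    constructor
    · intro h
      filter_upwards [h, hmem] with q h1 h2 using Finset.mem_sdiff.2 ⟨h2, h1⟩
    · intro h
      exact h.mono fun q hq => (Finset.mem_sdiff.1 hq).2
  have hsum : E.loebMass K (S.map (fun p => p.1) ζ)
      + E.loebMass K (S.map (fun p => E.Ω p.2.2 \ p.1) ζ) = 1 := by
    refine tendsto_nhds_unique ((E.tendsto_loebMass hn hF').add (E.tendsto_loebMass hn hG'))
      (tendsto_const_nhds.congr' ?_)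
    filter_upwards [hF', hG'] with p a b
    rw [E.mass_scale a, E.mass_scale b, add_comm, Finset.sum_sdiff a, E.sum_norm_inner_e_zero]
  have h1 : (1 : ℝ≥0∞) ≤ LoebSpace.measure (E.iSampling hA K) (E.iScale K)
      (E.ext (S.map (fun p => p.1) ζ))
      + ENNReal.ofReal (E.loebMass K (S.map (fun p => E.Ω p.2.2 \ p.1) ζ)) := by
    calc (1 : ℝ≥0∞) ≤ LoebSpace.measure (E.iSampling hA K) (E.iScale K) Set.univ :=
          (E.one_le_outerMeasure_univ hS).trans (le_toMeasure_apply _ _ _)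
      _ = _ := (measure_add_measure_compl hm).symm
      _ ≤ _ := by
          rw [hcompl]
          gcongr
          exact (E.measure_le (E.measurableSet_ext hG)).trans_eq (E.premeasure_ext hG)
  have h2 := E.loebMass_nonneg hn hF'
  have h3 := E.loebMass_nonneg hn hG'
  refine (ENNReal.add_le_add_iff_right ENNReal.ofReal_ne_top).1 (le_trans (le_of_eq ?_) h1)
  rw [← ENNReal.ofReal_add h2 h3, hsum, ENNReal.ofReal_one]

theorem isProbabilityMeasure (hS : S.IsSaturated) :
    IsProbabilityMeasure (LoebSpace.measure (E.iSampling hA K) (E.iScale K)) := by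
  refine ⟨?_⟩
  have h := E.measure_ext (hA := hA) (K := K) hS E.holds_Ω_subset
  rwa [E.ext_Ω, E.loebMass_Ω, ENNReal.ofReal_one] at h

end SignSystem

/-! ### Signs on the hull space -/

/-- The number `1` or `-1` encoded by a truth value. -/
def signValue (𝕜 : Type*) [RCLike 𝕜] (b : Bool) : 𝕜 := if b then 1 else -1

section SignValue

variable {𝕜 : Type*} [RCLike 𝕜]

theorem norm_signValue (b : Bool) : ‖signValue 𝕜 b‖ = 1 := by
  cases b <;> simp [signValue]

theorem conj_signValue (b : Bool) : (starRingEnd 𝕜) (signValue 𝕜 b) = signValue 𝕜 b := by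
  cases b <;> simp [signValue]

theorem norm_signValue_sub {a b : Bool} (h : a ≠ b) : ‖signValue 𝕜 a - signValue 𝕜 b‖ = 2 := by
  have h2 : ‖(1 : 𝕜) + 1‖ = 2 := by rw [one_add_one_eq_two, RCLike.norm_ofNat]
  rcases a with _ | _ <;> rcases b with _ | _
  · exact absurd rfl h
  · simp only [signValue, if_true, Bool.false_eq_true, if_false]
    rw [← neg_add', norm_neg, h2]
  · simp only [signValue, if_true, Bool.false_eq_true, if_false]
    rw [sub_neg_eq_add, h2]
  · exact absurd rfl h

end SignValue

namespace SignSystem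

variable {𝕜 H : Type} [RCLike 𝕜] [NormedAddCommGroup H] [InnerProductSpace 𝕜 H] [CompleteSpace H]
  {A : H →ₗ.[𝕜] H} (E : SignSystem A) {hA : IsSelfAdjoint A} {S : NonstandardExtension.{w}}
  {K : S.star ℕ}

open Classical in
/-- The sign of the transform of `e j` at a point of the Loeb space: `true` if the coordinates of
`e j` and `e 0` at the point agree, and `false` if, for infinite `K`, they are opposite. -/
def sign (j : ℕ) (f : E.Loeb hA K) : Bool :=
  decide (∀ᶠ p : H × ℕ in S.ultrafilter (S.pair f.1 K), ⟪p.1, E.e j⟫_𝕜 = ⟪p.1, E.e 0⟫_𝕜)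

theorem eventually_inner_e (hK : S.IsInfinite K) (j : ℕ) {f : E.Loeb hA K} {P : Type}
    {ζ : S.star P} {a : P → H} {n : P → ℕ} (ha : S.map a ζ = f.1) (hn : S.map n ζ = K) :
    ∀ᶠ p in S.ultrafilter ζ, ⟪a p, E.e j⟫_𝕜 = signValue 𝕜 (E.sign j f) * ⟪a p, E.e 0⟫_𝕜 := by
  refine S.eventually_of_map_eq (g := fun p => (a p, n p)) (η := S.pair f.1 K)
    (p := fun q : H × ℕ => ⟪q.1, E.e j⟫_𝕜 = signValue 𝕜 (E.sign j f) * ⟪q.1, E.e 0⟫_𝕜)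
    (by rw [← S.pair_map_map, ha, hn]) ?_
  by_cases h : ∀ᶠ p : H × ℕ in S.ultrafilter (S.pair f.1 K), ⟪p.1, E.e j⟫_𝕜 = ⟪p.1, E.e 0⟫_𝕜
  · simp only [sign, h, decide_true, signValue, if_true, one_mul]
  · have h' := Ultrafilter.eventually_not.2 h
    filter_upwards [h', E.eventually_mem f, hK.eventually_ge (S.map_snd_pair f.1 K) j]
      with p h1 h2 h3
    rw [(E.inner_e p.2 j h3 p.1 h2).resolve_left h1]
    simp [sign, h, signValue]

theorem eventually_transform_e (hK : S.IsInfinite K) (j : ℕ) {f : E.Loeb hA K} {P : Type}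
    {ζ : S.star P} {a : P → H} {n : P → ℕ} (ha : S.map a ζ = f.1) (hn : S.map n ζ = K) :
    ∀ᶠ p in S.ultrafilter ζ,
      (E.scale (n p)).transform 𝕜 (E.e j) (a p) = signValue 𝕜 (E.sign j f) := by
  filter_upwards [E.eventually_inner_e hK j ha hn, E.eventually_mem_of_map ha hn] with p h1 h2
  rw [E.transform_scale h2, h1, mul_div_assoc, div_self (E.inner_e_zero_ne _ _ h2), mul_one]

theorem sign_mul (hK : S.IsInfinite K) {i j k : ℕ}
    (h : ∀ n, i ≤ n → j ≤ n → k ≤ n → ∀ f ∈ E.Ω n,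
      ⟪f, E.e i⟫_𝕜 * ⟪f, E.e j⟫_𝕜 = ⟪f, E.e k⟫_𝕜 * ⟪f, E.e 0⟫_𝕜) (f : E.Loeb hA K) :
    signValue 𝕜 (E.sign i f) * signValue 𝕜 (E.sign j f) = signValue 𝕜 (E.sign k f) := by
  have hn := S.map_snd_pair f.1 K
  have ha := S.map_fst_pair f.1 K
  obtain ⟨p, h1, h2, h3, h4, h5, h6, h7⟩ := ((E.eventually_inner_e hK i ha hn).and
    ((E.eventually_inner_e hK j ha hn).and ((E.eventually_inner_e hK k ha hn).and
    ((E.eventually_mem f).and ((hK.eventually_ge hn i).and ((hK.eventually_ge hn j).and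
    (hK.eventually_ge hn k))))))).exists
  have h8 := h p.2 h5 h6 h7 p.1 h4
  rw [h1, h2, h3] at h8
  have h0 := E.inner_e_zero_ne _ _ h4
  refine mul_right_cancel₀ (mul_ne_zero h0 h0) ?_
  linear_combination h8

theorem sign_zero (f : E.Loeb hA K) : E.sign 0 f = true := by
  simp [sign]

theorem exists_common_points (f g : E.Loeb hA K) : ∃ ζ : S.star (H × H × ℕ),
    S.map (fun p => p.1) ζ = f.1 ∧ S.map (fun p => p.2.1) ζ = g.1 ∧
      S.map (fun p => p.2.2) ζ = K := by
  refine ⟨S.pair f.1 (S.pair g.1 K), S.map_fst_pair _ _, ?_, ?_⟩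
  · rw [← S.map_map Prod.fst Prod.snd, S.map_snd_pair, S.map_fst_pair]
  · rw [← S.map_map Prod.snd Prod.snd, S.map_snd_pair, S.map_snd_pair]

/-- The `j`-th term alone contributes this much to the distance. -/
theorem le_dist_of_sign_ne (hK : S.IsInfinite K) {j : ℕ} {f g : E.Loeb hA K}
    (h : E.sign j f ≠ E.sign j g) : ((1 / 2 : ℝ) ^ (j + 1)) ^ (3 / 2 : ℝ) * 2 ≤ dist f g := by
  obtain ⟨ζ, hf, hg, hn⟩ := E.exists_common_points f g
  refine ge_of_tendsto (LoebSpace.isSt_idist f g ζ (fun p => E.scale p.2.2) _ _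
    (by rw [← S.map_map E.scale (fun p : H × H × ℕ => p.2.2), hn]) hf hg) ?_
  filter_upwards [E.eventually_transform_e hK j hf hn, E.eventually_transform_e hK j hg hn,
    hK.eventually_ge hn (j + 1)] with p h1 h2 h3
  have h4 : ((E.scale p.2.2).c j : ℝ) ^ (3 / 2 : ℝ) * ‖(E.scale p.2.2).e j‖ ^ 2 *
      ‖(E.scale p.2.2).transform 𝕜 ((E.scale p.2.2).e j) p.1
        - (E.scale p.2.2).transform 𝕜 ((E.scale p.2.2).e j) p.2.1‖
      = ((1 / 2 : ℝ) ^ (j + 1)) ^ (3 / 2 : ℝ) * 2 := by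
    change (weight p.2.2 j : ℝ) ^ (3 / 2 : ℝ) * ‖E.e j‖ ^ 2 *
      ‖(E.scale p.2.2).transform 𝕜 (E.e j) p.1 - (E.scale p.2.2).transform 𝕜 (E.e j) p.2.1‖ = _
    rw [h1, h2, norm_signValue_sub h, weight_of_lt h3, E.norm_e, one_pow, mul_one]
  rw [← h4]
  exact Finset.single_le_sum (f := fun j => ((E.scale p.2.2).c j : ℝ) ^ (3 / 2 : ℝ) *
      ‖(E.scale p.2.2).e j‖ ^ 2 * ‖(E.scale p.2.2).transform 𝕜 ((E.scale p.2.2).e j) p.1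
        - (E.scale p.2.2).transform 𝕜 ((E.scale p.2.2).e j) p.2.1‖)
    (fun i _ => by positivity) (Finset.mem_range.2 (by change j < p.2.2 + 1; omega))

/-- The first `m` terms of the distance vanish, and the weights of the others sum to at most
`2⁻ᵐ`. -/
theorem dist_le_of_sign_eq (hK : S.IsInfinite K) {m : ℕ} {f g : E.Loeb hA K}
    (h : ∀ j < m, E.sign j f = E.sign j g) : dist f g ≤ 2 * (1 / 2 : ℝ) ^ m := by
  obtain ⟨ζ, hf, hg, hn⟩ := E.exists_common_points f g
  refine le_of_tendsto (LoebSpace.isSt_idist f g ζ (fun p => E.scale p.2.2) _ _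
    (by rw [← S.map_map E.scale (fun p : H × H × ℕ => p.2.2), hn]) hf hg) ?_
  have hlow : ∀ᶠ p : H × H × ℕ in S.ultrafilter ζ, ∀ j ∈ Finset.range m,
      (E.scale p.2.2).transform 𝕜 (E.e j) p.1 = (E.scale p.2.2).transform 𝕜 (E.e j) p.2.1 := by
    rw [Filter.eventually_all_finset]
    intro j hj
    filter_upwards [E.eventually_transform_e hK j hf hn, E.eventually_transform_e hK j hg hn]
      with p h1 h2
    rw [h1, h2, h j (Finset.mem_range.1 hj)]
  filter_upwards [hlow, E.eventually_mem_of_map hf hn, E.eventually_mem_of_map hg hn,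
    hK.eventually_ge hn m] with p h1 h2 h3 h4
  change ∑ j ∈ Finset.range (p.2.2 + 1), (weight p.2.2 j : ℝ) ^ (3 / 2 : ℝ) * ‖E.e j‖ ^ 2 *
    ‖(E.scale p.2.2).transform 𝕜 (E.e j) p.1 - (E.scale p.2.2).transform 𝕜 (E.e j) p.2.1‖ ≤ _
  rw [← Finset.sum_range_add_sum_Ico _ (h4.trans (Nat.le_succ _)),
    Finset.sum_eq_zero fun j hj => by rw [h1 j hj, sub_self, norm_zero, mul_zero], zero_add]
  calc _ ≤ ∑ j ∈ Finset.Ico m (p.2.2 + 1), 2 * (weight p.2.2 j : ℝ) := by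
        refine Finset.sum_le_sum fun j hj => ?_
        have hj' : j ≤ p.2.2 := Nat.lt_succ_iff.1 (Finset.mem_Ico.1 hj).2
        have h5 : (weight p.2.2 j : ℝ) ^ (3 / 2 : ℝ) ≤ weight p.2.2 j := by
          conv_rhs => rw [← Real.rpow_one (weight p.2.2 j : ℝ)]
          exact Real.rpow_le_rpow_of_exponent_ge' (NNReal.coe_nonneg _) (weight_le _ _ hj')
            (by norm_num) (by norm_num)
        have h6 : ∀ f ∈ E.Ω p.2.2, ‖(E.scale p.2.2).transform 𝕜 (E.e j) f‖ ≤ 1 := fun f hf => by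
          rcases E.transform_scale_e hj' hf with h | h <;> rw [h] <;> simp
        have h7 : ‖(E.scale p.2.2).transform 𝕜 (E.e j) p.1
            - (E.scale p.2.2).transform 𝕜 (E.e j) p.2.1‖ ≤ 2 := by
          refine (norm_sub_le _ _).trans ?_
          linarith [h6 _ h2, h6 _ h3]
        rw [E.norm_e, one_pow, mul_one, mul_comm]
        exact mul_le_mul h7 h5 (by positivity) (by norm_num)
    _ = 2 * ∑ j ∈ Finset.Ico m (p.2.2 + 1), (weight p.2.2 j : ℝ) := by rw [Finset.mul_sum]
    _ ≤ 2 * (1 / 2 : ℝ) ^ m := by gcongr; exact sum_Ico_weight_le _ _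

variable (hA K)

/-- The hull space of the sampling and the scale at `K`. -/
abbrev Hull : Type w := HullSpace S (E.iSampling hA K) (E.iScale K)

variable {hA K}

theorem proj_surjective : Function.Surjective (HullSpace.proj : E.Loeb hA K → E.Hull hA K) :=
  SeparationQuotient.surjective_mk

theorem dist_proj (f g : E.Loeb hA K) :
    dist (HullSpace.proj f : E.Hull hA K) (HullSpace.proj g) = dist f g :=
  rfl

/-- The sign functions, as functions on the hull space. They are defined by a choice of
representatives, which is irrelevant since points at distance `0` have equal signs
(`hullSign_proj`). -/
def hullSign (j : ℕ) (x : E.Hull hA K) : Bool :=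
  E.sign j (Function.surjInv E.proj_surjective x)

theorem hullSign_proj (hK : S.IsInfinite K) (j : ℕ) (f : E.Loeb hA K) :
    E.hullSign j (HullSpace.proj f) = E.sign j f := by
  by_contra h
  have h1 := E.le_dist_of_sign_ne hK h
  rw [← dist_proj, Function.surjInv_eq E.proj_surjective, dist_self] at h1
  have h2 : (0 : ℝ) < ((1 / 2 : ℝ) ^ (j + 1)) ^ (3 / 2 : ℝ) * 2 := by positivity
  linarith

/-- The hull space carries the topology induced by its embedding into the Cantor space. -/
theorem isInducing_hullSign (hK : S.IsInfinite K) :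
    Topology.IsInducing (fun (x : E.Hull hA K) (j : ℕ) => E.hullSign j x) := by
  refine Topology.isInducing_iff_nhds.2 fun x => le_antisymm ?_ ?_
  · rw [← Filter.tendsto_iff_comap, tendsto_pi_nhds]
    intro j
    refine tendsto_const_nhds.congr' ?_
    filter_upwards [Metric.ball_mem_nhds x
      (by positivity : (0 : ℝ) < ((1 / 2 : ℝ) ^ (j + 1)) ^ (3 / 2 : ℝ) * 2)] with y hy
    by_contra h
    obtain ⟨f, rfl⟩ := E.proj_surjective x
    obtain ⟨g, rfl⟩ := E.proj_surjective y
    rw [E.hullSign_proj hK, E.hullSign_proj hK] at h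
    have h1 := E.le_dist_of_sign_ne hK h
    rw [Metric.mem_ball, dist_comm, dist_proj] at hy
    linarith
  · rw [Metric.nhds_basis_ball.ge_iff]
    intro ε hε
    obtain ⟨m, hm⟩ := exists_pow_lt_of_lt_one (half_pos hε) (by norm_num : (1 / 2 : ℝ) < 1)
    refine ⟨{b | ∀ j < m, b j = E.hullSign j x}, ?_, fun y hy => ?_⟩
    · have h1 : ∀ᶠ b : ℕ → Bool in 𝓝 (fun j => E.hullSign j x), ∀ j ∈ Finset.range m,
          b j = E.hullSign j x := by
        rw [Filter.eventually_all_finset]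
        intro j _
        exact ((isOpen_discrete {E.hullSign j x}).preimage (continuous_apply (A := fun _ => Bool) j)
          |>.mem_nhds rfl)
      filter_upwards [h1] with b hb j hj using hb j (Finset.mem_range.2 hj)
    · obtain ⟨f, rfl⟩ := E.proj_surjective x
      obtain ⟨g, rfl⟩ := E.proj_surjective y
      rw [Metric.mem_ball, dist_proj]
      refine lt_of_le_of_lt (E.dist_le_of_sign_eq hK (m := m) fun j hj => ?_) (by linarith)
      have := hy j hj
      simp only [E.hullSign_proj hK] at this
      exact this

theorem measurableSpace_hull_eq (hK : S.IsInfinite K) :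
    (inferInstance : MeasurableSpace (E.Hull hA K))
      = MeasurableSpace.comap (fun (x : E.Hull hA K) (j : ℕ) => E.hullSign j x)
        MeasurableSpace.pi := by
  have h1 : (inferInstance : MeasurableSpace (E.Hull hA K)) = borel _ := rfl
  have h2 : (MeasurableSpace.pi : MeasurableSpace (ℕ → Bool)) = borel _ := BorelSpace.measurable_eq
  rw [h1, h2, ← borel_comap, (E.isInducing_hullSign hK).eq_induced]

theorem measurable_hullSign (hK : S.IsInfinite K) (j : ℕ) :
    Measurable (E.hullSign j : E.Hull hA K → Bool) := by
  have h : Measurable (fun (x : E.Hull hA K) (j : ℕ) => E.hullSign j x) := by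
    rw [measurable_iff_comap_le]
    exact (E.measurableSpace_hull_eq hK).ge
  exact (measurable_pi_apply j).comp h

open Classical in
theorem setOf_sign_eq_ext (j : ℕ) : {f : E.Loeb hA K | E.sign j f = true}
    = E.ext (S.map (fun n => (E.Ω n).filter fun f => ⟪f, E.e j⟫_𝕜 = ⟪f, E.e 0⟫_𝕜) K) := by
  ext f
  rw [mem_ext_map, Set.mem_ofPred_eq, sign, decide_eq_true_iff]
  simp only [Finset.mem_filter, Filter.eventually_and]
  exact ⟨fun h => ⟨E.eventually_mem f, h⟩, fun h => h.2⟩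

theorem holds_filter_subset (φ : ℕ → H → Prop) [∀ n, DecidablePred (φ n)] :
    S.Holds₂ (fun F τ => F ⊆ FiniteSampling.Ω τ) (S.map (fun n => (E.Ω n).filter (φ n)) K)
      (E.iSampling hA K) :=
  (E.holds_subset_iff (S.map_id K) _).2
    (Filter.Eventually.of_forall fun _ => Finset.filter_subset _ _)

theorem measurable_proj (hK : S.IsInfinite K) :
    Measurable (HullSpace.proj : E.Loeb hA K → E.Hull hA K) := by
  have h : Measurable[_, MeasurableSpace.comap (fun (x : E.Hull hA K) (j : ℕ) => E.hullSign j x)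
      MeasurableSpace.pi] (HullSpace.proj : E.Loeb hA K → E.Hull hA K) := by
    rw [measurable_comap_iff, measurable_pi_iff]
    intro j
    refine measurable_to_bool ?_
    have e : ((fun f : E.Loeb hA K => (((fun (x : E.Hull hA K) (j : ℕ) => E.hullSign j x) ∘
        HullSpace.proj) f) j) ⁻¹' {true}) = {f | E.sign j f = true} := by
      ext f
      simp [E.hullSign_proj hK]
    rw [e, setOf_sign_eq_ext]
    exact E.measurableSet_ext (E.holds_filter_subset fun _ f => ⟪f, E.e j⟫_𝕜 = ⟪f, E.e 0⟫_𝕜)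
  rw [← E.measurableSpace_hull_eq hK] at h
  exact h

end SignSystem

/-! ### Walsh functions -/

section LinearIsometry

variable {𝕜 H F : Type*} [RCLike 𝕜] [NormedAddCommGroup H] [InnerProductSpace 𝕜 H]
  [NormedAddCommGroup F] [InnerProductSpace 𝕜 F]

theorem Finsupp.inner_linearCombination_linearCombination {ι : Type*} (v : ι → H) (a b : ι →₀ 𝕜) :
    ⟪Finsupp.linearCombination 𝕜 v a, Finsupp.linearCombination 𝕜 v b⟫_𝕜
      = a.sum fun i x => b.sum fun j y => (starRingEnd 𝕜) x * (y * ⟪v i, v j⟫_𝕜) := by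
  rw [Finsupp.linearCombination_apply, Finsupp.linearCombination_apply, Finsupp.sum_inner]
  refine Finsupp.sum_congr fun i _ => ?_
  rw [Finsupp.inner_sum]
  refine Finsupp.sum_congr fun j _ => ?_
  rw [inner_smul_left, inner_smul_right]

/-- A family with dense span can be mapped isometrically to any family with the same Gram matrix. -/
theorem exists_linearIsometry_of_inner_eq [CompleteSpace F] {ι : Type*} {v : ι → H} {u : ι → F}
    (hv : Dense (Submodule.span 𝕜 (Set.range v) : Set H))
    (h : ∀ i j, ⟪u i, u j⟫_𝕜 = ⟪v i, v j⟫_𝕜) : ∃ U : H →ₗᵢ[𝕜] F, ∀ i, U (v i) = u i := by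
  have hdense : DenseRange (Finsupp.linearCombination 𝕜 v) := by
    rw [← Finsupp.range_linearCombination] at hv
    exact hv
  have hnorm : ∀ a : ι →₀ 𝕜,
      ‖Finsupp.linearCombination 𝕜 u a‖ = ‖Finsupp.linearCombination 𝕜 v a‖ := fun a => by
    have h1 : ⟪Finsupp.linearCombination 𝕜 u a, Finsupp.linearCombination 𝕜 u a⟫_𝕜
        = ⟪Finsupp.linearCombination 𝕜 v a, Finsupp.linearCombination 𝕜 v a⟫_𝕜 := by
      simp only [Finsupp.inner_linearCombination_linearCombination, h]
    rw [@norm_eq_sqrt_re_inner 𝕜, @norm_eq_sqrt_re_inner 𝕜, h1]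
  have hU := LinearMap.extendOfNorm_eq hdense ⟨1, fun a => by rw [one_mul, hnorm]⟩
  refine ⟨⟨((Finsupp.linearCombination 𝕜 u).extendOfNorm (Finsupp.linearCombination 𝕜 v) :
    H →ₗ[𝕜] F), fun x => ?_⟩, fun i => ?_⟩
  · refine hdense.induction_on (p := fun x => ‖(Finsupp.linearCombination 𝕜 u).extendOfNorm
      (Finsupp.linearCombination 𝕜 v) x‖ = ‖x‖) x
      (isClosed_eq (ContinuousLinearMap.continuous _).norm continuous_norm) fun a => ?_
    rw [hU, hnorm]
  · have := hU (Finsupp.single i 1)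
    rw [Finsupp.linearCombination_single, Finsupp.linearCombination_single, one_smul,
      one_smul] at this
    exact this

end LinearIsometry

namespace SignSystem

variable {𝕜 H : Type} [RCLike 𝕜] [NormedAddCommGroup H] [InnerProductSpace 𝕜 H] [CompleteSpace H]
  {A : H →ₗ.[𝕜] H} (E : SignSystem A) {hA : IsSelfAdjoint A} {S : NonstandardExtension.{w}}
  {K : S.star ℕ}

omit [CompleteSpace H] in
theorem conj_inner_e {n j : ℕ} (hj : j ≤ n) {f : H} (hf : f ∈ E.Ω n) :
    (starRingEnd 𝕜) ⟪f, E.e j⟫_𝕜 = ⟪f, E.e j⟫_𝕜 := by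
  have h0 : (starRingEnd 𝕜) ⟪f, E.e 0⟫_𝕜 = ⟪f, E.e 0⟫_𝕜 := by
    rw [E.inner_e_zero n f hf, RCLike.conj_ofReal]
  rcases E.inner_e n j hj f hf with h | h <;> rw [h]
  · exact h0
  · rw [map_neg, h0]

omit [CompleteSpace H] in
theorem inner_e_e_eq_sum {n i j : ℕ} (hi : i ≤ n) (hj : j ≤ n) :
    ⟪E.e i, E.e j⟫_𝕜 = ∑ f ∈ E.Ω n, ⟪f, E.e i⟫_𝕜 * ⟪f, E.e j⟫_𝕜 := by
  rw [(E.orthonormal n).inner_eq_sum_finset (E.e i) (E.e_mem n j hj)]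
  refine Finset.sum_congr rfl fun f hf => ?_
  rw [← inner_conj_symm, E.conj_inner_e hi hf]

omit [CompleteSpace H] in
/-- Both sides are the same sum of products of coordinates, as the sign functions multiply. -/
theorem inner_e_e {i j k : ℕ} (h : ∀ n, i ≤ n → j ≤ n → k ≤ n → ∀ f ∈ E.Ω n,
      ⟪f, E.e i⟫_𝕜 * ⟪f, E.e j⟫_𝕜 = ⟪f, E.e k⟫_𝕜 * ⟪f, E.e 0⟫_𝕜) :
    ⟪E.e i, E.e j⟫_𝕜 = ⟪E.e k, E.e 0⟫_𝕜 := by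
  rw [E.inner_e_e_eq_sum (n := i + j + k) (by omega) (by omega),
    E.inner_e_e_eq_sum (n := i + j + k) (by omega) (by omega)]
  exact Finset.sum_congr rfl fun f hf => h _ (by omega) (by omega) (by omega) f hf

omit [CompleteSpace H] in
open Classical in
/-- The inner product is the mass of the points where the signs agree minus the mass of the
others. -/
theorem inner_e_zero_eq_mass {n j : ℕ} (hj : j ≤ n) :
    ⟪E.e j, E.e 0⟫_𝕜 = ((2 * (E.scale n).mass 𝕜
      ((E.Ω n).filter fun f => ⟪f, E.e j⟫_𝕜 = ⟪f, E.e 0⟫_𝕜) - 1 : ℝ) : 𝕜) := by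
  rw [E.inner_e_e_eq_sum hj (Nat.zero_le n), E.mass_scale (Finset.filter_subset _ _),
    ← E.sum_norm_inner_e_zero n, Finset.sum_filter, Finset.mul_sum, ← Finset.sum_sub_distrib,
    RCLike.ofReal_sum]
  refine Finset.sum_congr rfl fun f hf => ?_
  have h0 : ⟪f, E.e 0⟫_𝕜 * ⟪f, E.e 0⟫_𝕜 = ((‖⟪f, E.e 0⟫_𝕜‖ ^ 2 : ℝ) : 𝕜) := by
    conv_lhs => rw [E.inner_e_zero n f hf]
    push_cast
    ring
  split_ifs with h
  · rw [h, h0]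
    congr 1
    ring
  · rw [(E.inner_e n j hj f hf).resolve_left h, neg_mul, h0, ← RCLike.ofReal_neg]
    congr 1
    ring

theorem measure_sign (hS : S.IsSaturated) (hK : S.IsInfinite K) (j : ℕ) :
    LoebSpace.measure (E.iSampling hA K) (E.iScale K) {f : E.Loeb hA K | E.sign j f = true}
      = ENNReal.ofReal ((1 + RCLike.re ⟪E.e j, E.e 0⟫_𝕜) / 2) := by
  classical
  rw [E.setOf_sign_eq_ext j,
    E.measure_ext hS (E.holds_filter_subset fun _ f => ⟪f, E.e j⟫_𝕜 = ⟪f, E.e 0⟫_𝕜),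
    E.loebMass_eq (S.map_id K) (Filter.Eventually.of_forall fun _ => Finset.filter_subset _ _)]
  refine tendsto_const_nhds.congr' ?_
  filter_upwards [hK.eventually_ge (S.map_id K) j] with n hn
  rw [E.inner_e_zero_eq_mass hn, RCLike.ofReal_re]
  ring

/-- The `j`-th Walsh function on the hull space. -/
def walsh (j : ℕ) (x : E.Hull hA K) : 𝕜 := signValue 𝕜 (E.hullSign j x)

theorem measurable_walsh (hK : S.IsInfinite K) (j : ℕ) :
    Measurable (E.walsh j : E.Hull hA K → 𝕜) :=
  (measurable_of_finite (signValue 𝕜)).comp (E.measurable_hullSign hK j)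

theorem walsh_proj (hK : S.IsInfinite K) (j : ℕ) (f : E.Loeb hA K) :
    E.walsh j (HullSpace.proj f) = signValue 𝕜 (E.sign j f) := by
  rw [walsh, E.hullSign_proj hK]

theorem walsh_mul (hK : S.IsInfinite K) {i j k : ℕ}
    (h : ∀ n, i ≤ n → j ≤ n → k ≤ n → ∀ f ∈ E.Ω n,
      ⟪f, E.e i⟫_𝕜 * ⟪f, E.e j⟫_𝕜 = ⟪f, E.e k⟫_𝕜 * ⟪f, E.e 0⟫_𝕜) (x : E.Hull hA K) :
    E.walsh i x * E.walsh j x = E.walsh k x := by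
  obtain ⟨f, rfl⟩ := E.proj_surjective x
  simp only [E.walsh_proj hK, E.sign_mul hK h]

theorem isProbabilityMeasure_hull (hS : S.IsSaturated) (hK : S.IsInfinite K) :
    IsProbabilityMeasure (HullSpace.measure (E.iSampling hA K) (E.iScale K)) := by
  have := E.isProbabilityMeasure (hA := hA) (K := K) hS
  exact Measure.isProbabilityMeasure_map (E.measurable_proj hK).aemeasurable

theorem integral_walsh (hS : S.IsSaturated) (hK : S.IsInfinite K) (j : ℕ) :
    ∫ x, E.walsh j x ∂(HullSpace.measure (E.iSampling hA K) (E.iScale K)) = ⟪E.e j, E.e 0⟫_𝕜 := by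
  have := E.isProbabilityMeasure_hull (hA := hA) hS hK
  have hm : MeasurableSet {x : E.Hull hA K | E.hullSign j x = true} :=
    E.measurable_hullSign hK j (measurableSet_singleton true)
  have h1 : (fun x : E.Hull hA K => E.walsh j x)
      = fun x => {x : E.Hull hA K | E.hullSign j x = true}.indicator (fun _ => (2 : 𝕜)) x - 1 := by
    funext x
    cases h : E.hullSign j x <;> simp [walsh, signValue, h]
    norm_num
  have h2 : (HullSpace.measure (E.iSampling hA K) (E.iScale K)).real
      {x : E.Hull hA K | E.hullSign j x = true} = (1 + RCLike.re ⟪E.e j, E.e 0⟫_𝕜) / 2 := by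
    have h3 : (HullSpace.proj : E.Loeb hA K → E.Hull hA K) ⁻¹' {x | E.hullSign j x = true}
        = {f | E.sign j f = true} := by
      ext f
      simp [E.hullSign_proj hK]
    rw [Measure.real, HullSpace.measure, Measure.map_apply (E.measurable_proj hK) hm, h3,
      E.measure_sign hS hK, ENNReal.toReal_ofReal]
    have := (abs_le.1 ((RCLike.abs_re_le_norm _).trans (norm_inner_le_norm (𝕜 := 𝕜)
      (E.e j) (E.e 0)))).1
    rw [E.norm_e, E.norm_e] at this
    linarith
  have h4 : ⟪E.e j, E.e 0⟫_𝕜 = ((RCLike.re ⟪E.e j, E.e 0⟫_𝕜 : ℝ) : 𝕜) := by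
    rw [E.inner_e_zero_eq_mass le_rfl, RCLike.ofReal_re]
  rw [h1, integral_sub ((integrable_const _).indicator hm) (integrable_const _),
    integral_indicator_const _ hm, h2, integral_const, probReal_univ, one_smul, h4,
    RCLike.real_smul_eq_coe_mul, RCLike.ofReal_re]
  push_cast
  ring

theorem memLp_walsh (hS : S.IsSaturated) (hK : S.IsInfinite K) (j : ℕ) :
    MemLp (E.walsh j) 2 (HullSpace.measure (E.iSampling hA K) (E.iScale K)) := by
  have := E.isProbabilityMeasure_hull (hA := hA) hS hK
  exact MemLp.of_bound (E.measurable_walsh hK j).aestronglyMeasurable 1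
    (Filter.Eventually.of_forall fun x => (norm_signValue _).le)

/-- The Walsh functions have the same Gram matrix as the vectors `e j`. -/
theorem inner_walsh (hS : S.IsSaturated) (hK : S.IsInfinite K) (i j : ℕ) :
    ⟪(E.memLp_walsh (hA := hA) hS hK i).toLp, (E.memLp_walsh hS hK j).toLp⟫_𝕜
      = ⟪E.e i, E.e j⟫_𝕜 := by
  obtain ⟨k, hk⟩ := E.exists_mul i j
  rw [E.inner_e_e hk, ← E.integral_walsh (hA := hA) hS hK k, L2.inner_def]
  refine integral_congr_ae ?_
  filter_upwards [(E.memLp_walsh (hA := hA) hS hK i).coeFn_toLp,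
    (E.memLp_walsh (hA := hA) hS hK j).coeFn_toLp] with x h1 h2
  rw [h1, h2, ← E.walsh_mul hK hk, RCLike.inner_apply, mul_comm]
  exact congrArg (· * _) (conj_signValue _)

theorem exists_linearIsometry_walsh (hdense : Dense (A.domain : Set H)) (hS : S.IsSaturated)
    (hK : S.IsInfinite K) :
    ∃ U : H →ₗᵢ[𝕜] Lp 𝕜 2 (HullSpace.measure (E.iSampling hA K) (E.iScale K)),
      ∀ j, U (E.e j) = (E.memLp_walsh hS hK j).toLp :=
  exists_linearIsometry_of_inner_eq (E.dense_span_e hdense) (E.inner_walsh hS hK)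

end SignSystem

/-! ### The induced isometry -/

/-- Chebyshev's inequality in `L²`. -/
theorem Lp.measure_le_norm_le {α F : Type*} [MeasurableSpace α] {μ : Measure α}
    [NormedAddCommGroup F] (h : Lp F 2 μ) {ε : ℝ} (hε : 0 < ε) :
    μ {x | ε ≤ ‖h x‖} ≤ ENNReal.ofReal (‖h‖ ^ 2 / ε ^ 2) := by
  have h1 := Lp.mul_meas_ge_le_pow_enorm' h two_ne_zero ENNReal.ofNat_ne_top (ENNReal.ofReal ε)
  have h2 : {x | ENNReal.ofReal ε ≤ ‖h x‖ₑ} = {x | ε ≤ ‖h x‖} := by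
    ext x
    rw [Set.mem_ofPred_eq, Set.mem_ofPred_eq, ← ofReal_norm,
      ENNReal.ofReal_le_ofReal_iff (norm_nonneg _)]
  change _ * μ {x | ENNReal.ofReal ε ≤ ‖h x‖ₑ} ≤ _ at h1
  rw [h2] at h1
  rw [ENNReal.ofReal_div_of_pos (by positivity), ENNReal.le_div_iff_mul_le
    (Or.inl (by positivity)) (Or.inl ENNReal.ofReal_ne_top), mul_comm]
  simpa [ENNReal.ofReal_pow hε.le, ENNReal.ofReal_pow (norm_nonneg h)] using h1

namespace FiniteScale

variable {𝕜 H : Type} [RCLike 𝕜] [NormedAddCommGroup H] [InnerProductSpace 𝕜 H] (t : FiniteScale H)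

theorem transform_zero (f : H) : t.transform 𝕜 0 f = 0 := by
  rw [transform, inner_zero_right, zero_div]

theorem transform_add (x y f : H) :
    t.transform 𝕜 (x + y) f = t.transform 𝕜 x f + t.transform 𝕜 y f := by
  rw [transform, inner_add_right, add_div, transform, transform]

theorem transform_sub (x y f : H) :
    t.transform 𝕜 (x - y) f = t.transform 𝕜 x f - t.transform 𝕜 y f := by
  rw [transform, inner_sub_right, sub_div, transform, transform]

theorem transform_smul (c : 𝕜) (x f : H) :
    t.transform 𝕜 (c • x) f = c * t.transform 𝕜 x f := by
  rw [transform, inner_smul_right, mul_div_assoc, transform]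

end FiniteScale

namespace SignSystem

variable {𝕜 H : Type} [RCLike 𝕜] [NormedAddCommGroup H] [InnerProductSpace 𝕜 H] [CompleteSpace H]
  {A : H →ₗ.[𝕜] H} (E : SignSystem A) {hA : IsSelfAdjoint A} {S : NonstandardExtension.{w}}
  {K : S.star ℕ}

theorem isSt_transform_std_iff (x : H) (f : E.Loeb hA K) (c : 𝕜) :
    S.IsSt (LoebSpace.transform (S.std x) f) c ↔
      Filter.Tendsto (fun p : H × ℕ => (E.scale p.2).transform 𝕜 x p.1)
        (S.ultrafilter (S.pair f.1 K)) (𝓝 c) := by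
  have h : LoebSpace.transform (S.std x) f
      = S.map (fun p : H × ℕ => (E.scale p.2).transform 𝕜 x p.1) (S.pair f.1 K) := by
    have h1 : E.iScale K = S.map (fun p : H × ℕ => E.scale p.2) (S.pair f.1 K) := by
      rw [iScale, ← S.map_map E.scale Prod.snd, S.map_snd_pair]
    have h2 : f.1 = S.map (fun p : H × ℕ => p.1) (S.pair f.1 K) := (S.map_fst_pair _ _).symm
    rw [LoebSpace.transform, ← S.map_const x (S.pair f.1 K), h1]
    conv_lhs => rw [show S.pair (S.map (fun _ => x) (S.pair f.1 K)) f.1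
      = S.map (fun p : H × ℕ => (x, p.1)) (S.pair f.1 K) by rw [← S.pair_map_map, ← h2]]
    rw [S.pair_map_map, S.map_map]
  rw [h, S.isSt_map_iff]

section

variable (hK : S.IsInfinite K)
  (U : H →ₗᵢ[𝕜] Lp 𝕜 2 (HullSpace.measure (E.iSampling hA K) (E.iScale K)))

theorem ae_comp_proj (hK : S.IsInfinite K) {p : E.Hull hA K → Prop}
    (h : ∀ᵐ x ∂(HullSpace.measure (E.iSampling hA K) (E.iScale K)), p x) :
    ∀ᵐ f ∂(LoebSpace.measure (E.iSampling hA K) (E.iScale K)), p (HullSpace.proj f) :=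
  ae_of_ae_map (E.measurable_proj hK).aemeasurable h

theorem ae_isSt_transform_of_mem_span (hS : S.IsSaturated)
    (hU : ∀ j, U (E.e j) = (E.memLp_walsh hS hK j).toLp) {x : H}
    (hx : x ∈ Submodule.span 𝕜 (Set.range E.e)) :
    ∀ᵐ f ∂(LoebSpace.measure (E.iSampling hA K) (E.iScale K)),
      S.IsSt (LoebSpace.transform (S.std x) f) (U x (HullSpace.proj f)) := by
  simp only [isSt_transform_std_iff]
  induction hx using Submodule.span_induction with
  | mem x hx =>
    obtain ⟨j, rfl⟩ := hx
    filter_upwards [E.ae_comp_proj hK (E.memLp_walsh (hA := hA) hS hK j).coeFn_toLp] with f hf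
    rw [hU, hf, E.walsh_proj hK]
    exact tendsto_const_nhds.congr' ((E.eventually_transform_e hK j (S.map_fst_pair _ _)
      (S.map_snd_pair _ _)).mono fun p hp => hp.symm)
  | zero =>
    filter_upwards [E.ae_comp_proj hK (Lp.coeFn_zero 𝕜 2
      (HullSpace.measure (E.iSampling hA K) (E.iScale K)))] with f hf
    rw [map_zero, hf]
    simp only [FiniteScale.transform_zero]
    exact tendsto_const_nhds
  | add x y _ _ hx hy =>
    filter_upwards [hx, hy, E.ae_comp_proj hK (Lp.coeFn_add (U x) (U y))] with f h1 h2 h3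
    rw [map_add, h3]
    simp only [FiniteScale.transform_add]
    exact h1.add h2
  | smul c x _ hx =>
    filter_upwards [hx, E.ae_comp_proj hK (Lp.coeFn_smul c (U x))] with f h1 h2
    rw [map_smul, h2]
    simp only [FiniteScale.transform_smul]
    exact h1.const_mul c

/-- Chebyshev's inequality on the Loeb space, for the internal transform. -/
theorem measure_not_eventually_norm_transform_lt_le (hS : S.IsSaturated) (x : H) {ε : ℝ}
    (hε : 0 < ε) :
    LoebSpace.measure (E.iSampling hA K) (E.iScale K)
      {f : E.Loeb hA K | ¬ ∀ᶠ p : H × ℕ in S.ultrafilter (S.pair f.1 K),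
        ‖(E.scale p.2).transform 𝕜 x p.1‖ < ε} ≤ ENNReal.ofReal (‖x‖ ^ 2 / ε ^ 2) := by
  classical
  have h1 : {f : E.Loeb hA K | ¬ ∀ᶠ p : H × ℕ in S.ultrafilter (S.pair f.1 K),
      ‖(E.scale p.2).transform 𝕜 x p.1‖ < ε} = E.ext (S.map (fun n => (E.Ω n).filter fun f =>
        ε ≤ ‖(E.scale n).transform 𝕜 x f‖) K) := by
    ext f
    rw [mem_ext_map, Set.mem_ofPred_eq, ← Ultrafilter.eventually_not]
    simp only [Finset.mem_filter, Filter.eventually_and, not_lt]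
    exact ⟨fun h => ⟨E.eventually_mem f, h⟩, fun h => h.2⟩
  have hsub : ∀ᶠ n in S.ultrafilter K, ((E.Ω n).filter fun f =>
      ε ≤ ‖(E.scale n).transform 𝕜 x f‖) ⊆ E.Ω n :=
    Filter.Eventually.of_forall fun _ => Finset.filter_subset _ _
  rw [h1, E.measure_ext hS (E.holds_filter_subset fun n f => ε ≤ ‖(E.scale n).transform 𝕜 x f‖)]
  refine ENNReal.ofReal_le_ofReal (le_of_tendsto (E.tendsto_loebMass (S.map_id K) hsub) ?_)
  exact Filter.Eventually.of_forall fun n => E.mass_filter_transform_le x hε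
    (Finset.filter_subset _ _) fun f hf => (Finset.mem_filter.1 hf).2

/-- The transforms of the vectors of `span e` determine the isometry: by Chebyshev's inequality,
both sides of the defining equation depend continuously in measure on the vector. -/
theorem isInducedIsometry (hdense : Dense (A.domain : Set H)) (hS : S.IsSaturated)
    (hU : ∀ j, U (E.e j) = (E.memLp_walsh hS hK j).toLp) :
    IsInducedIsometry S (E.iSampling hA K) (E.iScale K) U := by
  intro x
  simp only [isSt_transform_std_iff]
  set μ := LoebSpace.measure (E.iSampling hA K) (E.iScale K)
  have key : ∀ ε : ℝ, 0 < ε → ∀ᵐ f ∂μ, ∀ᶠ p : H × ℕ in S.ultrafilter (S.pair f.1 K),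
      dist ((E.scale p.2).transform 𝕜 x p.1) (U x (HullSpace.proj f)) < ε + ε + ε := by
    intro ε hε
    have hbound : ∀ y ∈ Submodule.span 𝕜 (Set.range E.e),
        μ {f | ¬ ∀ᶠ p : H × ℕ in S.ultrafilter (S.pair f.1 K),
          dist ((E.scale p.2).transform 𝕜 x p.1) (U x (HullSpace.proj f)) < ε + ε + ε}
          ≤ ENNReal.ofReal (‖x - y‖ ^ 2 / ε ^ 2) + ENNReal.ofReal (‖x - y‖ ^ 2 / ε ^ 2) := by
      intro y hy
      have h1 := E.measure_not_eventually_norm_transform_lt_le (hA := hA) (K := K) hS (x - y) hε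
      have h2 : μ {f | ε ≤ ‖U (x - y) (HullSpace.proj f)‖}
          ≤ ENNReal.ofReal (‖x - y‖ ^ 2 / ε ^ 2) := by
        have h3 := Lp.measure_le_norm_le (U (x - y)) hε
        rw [U.norm_map] at h3
        refine le_trans (le_of_eq ?_) h3
        exact (Measure.map_apply (E.measurable_proj hK) (measurableSet_le measurable_const
          (Lp.stronglyMeasurable (U (x - y))).measurable.norm)).symm
      have h4 : {f | ¬ ∀ᶠ p : H × ℕ in S.ultrafilter (S.pair f.1 K),
          dist ((E.scale p.2).transform 𝕜 x p.1) (U x (HullSpace.proj f)) < ε + ε + ε}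
          ≤ᵐ[μ] ({f : E.Loeb hA K | ¬ ∀ᶠ p : H × ℕ in S.ultrafilter (S.pair f.1 K),
              ‖(E.scale p.2).transform 𝕜 (x - y) p.1‖ < ε}
            ∪ {f | ε ≤ ‖U (x - y) (HullSpace.proj f)‖} : Set (E.Loeb hA K)) := by
        have h5 := E.ae_isSt_transform_of_mem_span hK U hS hU hy
        simp only [isSt_transform_std_iff] at h5
        filter_upwards [h5, E.ae_comp_proj hK (Lp.coeFn_sub (U x) (U y))] with f a1 a2 hf
        by_contra hcon
        change ¬ (¬ _ ∨ ε ≤ _) at hcon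
        rw [not_or, not_not, not_le, map_sub, a2] at hcon
        refine hf ?_
        filter_upwards [hcon.1, Metric.tendsto_nhds.1 a1 ε hε] with p b1 b2
        rw [FiniteScale.transform_sub] at b1
        refine (dist_triangle4 _ ((E.scale p.2).transform 𝕜 y p.1)
          (U y (HullSpace.proj f)) _).trans_lt ?_
        have b3 : dist (U y (HullSpace.proj f)) (U x (HullSpace.proj f)) < ε := by
          rw [dist_comm, dist_eq_norm]
          exact hcon.2
        rw [← dist_eq_norm] at b1
        linarith
      exact (measure_mono_ae h4).trans ((measure_union_le _ _).trans (add_le_add h1 h2))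
    have hlim : Filter.Tendsto (fun y => ENNReal.ofReal (‖x - y‖ ^ 2 / ε ^ 2)
        + ENNReal.ofReal (‖x - y‖ ^ 2 / ε ^ 2))
        (𝓝[(Submodule.span 𝕜 (Set.range E.e) : Set H)] x) (𝓝 0) := by
      have hc : Continuous fun y => ENNReal.ofReal (‖x - y‖ ^ 2 / ε ^ 2)
          + ENNReal.ofReal (‖x - y‖ ^ 2 / ε ^ 2) := by
        have : Continuous fun y => ENNReal.ofReal (‖x - y‖ ^ 2 / ε ^ 2) :=
          ENNReal.continuous_ofReal.comp (by fun_prop)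
        exact this.add this
      have := hc.tendsto x
      simp only [sub_self, norm_zero, ne_eq, OfNat.ofNat_ne_zero, not_false_eq_true, zero_pow,
        zero_div, ENNReal.ofReal_zero, add_zero] at this
      exact this.mono_left nhdsWithin_le_nhds
    have := mem_closure_iff_nhdsWithin_neBot.1 (E.dense_span_e hdense x)
    rw [ae_iff]
    refine le_antisymm (ge_of_tendsto hlim ?_) bot_le
    filter_upwards [self_mem_nhdsWithin] with y hy using hbound y hy
  have hall : ∀ᵐ f ∂μ, ∀ m : ℕ, ∀ᶠ p : H × ℕ in S.ultrafilter (S.pair f.1 K),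
      dist ((E.scale p.2).transform 𝕜 x p.1) (U x (HullSpace.proj f))
        < 1 / ((m : ℝ) + 1) + 1 / ((m : ℝ) + 1) + 1 / ((m : ℝ) + 1) :=
    ae_all_iff.2 fun m => key _ (by positivity)
  filter_upwards [hall] with f hf
  rw [Metric.tendsto_nhds]
  intro ε hε
  obtain ⟨m, hm⟩ := exists_nat_one_div_lt (show (0 : ℝ) < ε / 3 by positivity)
  exact (hf m).mono fun p hp => hp.trans (by linarith)

end

end SignSystem

/-! ### Completeness of the Walsh functions -/

namespace SignSystem

variable {𝕜 H : Type} [RCLike 𝕜] [NormedAddCommGroup H] [InnerProductSpace 𝕜 H] [CompleteSpace H]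
  {A : H →ₗ.[𝕜] H} (E : SignSystem A) {hA : IsSelfAdjoint A} {S : NonstandardExtension.{w}}
  {K : S.star ℕ}

/-- The Borel sets of the hull space are generated by finite intersections of events each of which
depends on one sign. -/
theorem measurableSpace_hull_eq_generateFrom (hK : S.IsInfinite K) :
    (inferInstance : MeasurableSpace (E.Hull hA K))
      = MeasurableSpace.generateFrom (piiUnionInter (fun j => {s : Set (E.Hull hA K) |
        MeasurableSet[MeasurableSpace.comap (E.hullSign j) inferInstance] s}) Set.univ) := by
  refine Eq.trans ?_ (generateFrom_piiUnionInter_measurableSet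
    (fun j => MeasurableSpace.comap (E.hullSign j) inferInstance) Set.univ).symm
  rw [E.measurableSpace_hull_eq hK, MeasurableSpace.pi, MeasurableSpace.comap_iSup]
  simp only [MeasurableSpace.comap_comp, Set.mem_univ, iSup_pos]
  rfl

/-- Every function of one sign is an affine function of it. -/
theorem exists_add_mul_signValue (φ : Bool → 𝕜) :
    ∃ α β : 𝕜, ∀ b, φ b = α + β * signValue 𝕜 b := by
  refine ⟨(φ true + φ false) / 2, (φ true - φ false) / 2, fun b => ?_⟩
  cases b <;> simp only [signValue, if_true, Bool.false_eq_true, if_false] <;> ring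

theorem integrable_walsh_mul (hK : S.IsInfinite K) (j : ℕ) {h : E.Hull hA K → 𝕜}
    (hh : Integrable h (HullSpace.measure (E.iSampling hA K) (E.iScale K))) :
    Integrable (fun x => E.walsh j x * h x)
      (HullSpace.measure (E.iSampling hA K) (E.iScale K)) :=
  hh.bdd_mul (E.measurable_walsh hK j).aestronglyMeasurable
    (Filter.Eventually.of_forall fun _ => (norm_signValue _).le)

/-- Since the Walsh functions are closed under multiplication, a function that integrates to zero
against all of them on a set does so on the part of the set cut out by one sign. -/
theorem setIntegral_walsh_mul_inter_eq_zero (hK : S.IsInfinite K) {h : E.Hull hA K → 𝕜}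
    (hh : Integrable h (HullSpace.measure (E.iSampling hA K) (E.iScale K))) {C : Set (E.Hull hA K)}
    (hC : ∀ j, ∫ x in C, E.walsh j x * h x ∂(HullSpace.measure (E.iSampling hA K) (E.iScale K)) = 0)
    (i : ℕ) (B : Set Bool) (j : ℕ) :
    ∫ x in C ∩ E.hullSign i ⁻¹' B, E.walsh j x * h x
      ∂(HullSpace.measure (E.iSampling hA K) (E.iScale K)) = 0 := by
  obtain ⟨α, β, hαβ⟩ := exists_add_mul_signValue (B.indicator (1 : Bool → 𝕜))
  obtain ⟨k, hk⟩ := E.exists_mul i j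
  have h1 : (E.hullSign i ⁻¹' B).indicator (fun x : E.Hull hA K => E.walsh j x * h x)
      = fun x => α * (E.walsh j x * h x) + β * (E.walsh k x * h x) := by
    funext x
    have h2 : (E.hullSign i ⁻¹' B).indicator (fun x : E.Hull hA K => E.walsh j x * h x) x
        = B.indicator (1 : Bool → 𝕜) (E.hullSign i x) * (E.walsh j x * h x) := by
      by_cases hx : E.hullSign i x ∈ B
      · rw [Set.indicator_of_mem hx, Set.indicator_of_mem (show x ∈ E.hullSign i ⁻¹' B from hx),
          Pi.one_apply, one_mul]
      · rw [Set.indicator_of_notMem hx,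
          Set.indicator_of_notMem (show x ∉ E.hullSign i ⁻¹' B from hx), zero_mul]
    rw [h2, hαβ, ← E.walsh_mul hK hk]
    change (α + β * E.walsh i x) * _ = _
    ring
  rw [← setIntegral_indicator (E.measurable_hullSign hK i (Set.toFinite B).measurableSet), h1,
    integral_add ((E.integrable_walsh_mul hK j hh).integrableOn.const_mul α)
      ((E.integrable_walsh_mul hK k hh).integrableOn.const_mul β),
    integral_const_mul, integral_const_mul, hC, hC, mul_zero, mul_zero, add_zero]

/-- The measurable sets `C` on which `h` integrates to zero against all Walsh functions form a
λ-system that contains all sets cut out by finitely many signs. -/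
theorem ae_eq_zero_of_integral_walsh_mul_eq_zero (hK : S.IsInfinite K) {h : E.Hull hA K → 𝕜}
    (hh : Integrable h (HullSpace.measure (E.iSampling hA K) (E.iScale K)))
    (h0 : ∀ j, ∫ x, E.walsh j x * h x ∂(HullSpace.measure (E.iSampling hA K) (E.iScale K)) = 0) :
    h =ᵐ[HullSpace.measure (E.iSampling hA K) (E.iScale K)] 0 := by
  classical
  set μ := HullSpace.measure (E.iSampling hA K) (E.iScale K)
  have key : ∀ C : Set (E.Hull hA K), MeasurableSet C →
      ∀ j, ∫ x in C, E.walsh j x * h x ∂μ = 0 := by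
    refine MeasurableSpace.induction_on_inter (E.measurableSpace_hull_eq_generateFrom hK)
      (isPiSystem_piiUnionInter _ (fun j => @MeasurableSpace.isPiSystem_measurableSet _
        (MeasurableSpace.comap (E.hullSign j) inferInstance)) _) ?_ ?_ ?_ ?_
    · intro j
      rw [Measure.restrict_empty, integral_zero_measure]
    · rintro t ⟨F, -, f, hf, rfl⟩
      induction F using Finset.induction_on with
      | empty => simpa using h0
      | insert i F hi ih =>
        obtain ⟨B, -, hB⟩ := hf i (Finset.mem_insert_self i F)
        rw [Finset.set_biInter_insert, Set.inter_comm, ← hB]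
        exact E.setIntegral_walsh_mul_inter_eq_zero hK hh
          (ih fun x hx => hf x (Finset.mem_insert_of_mem hx)) i B
    · intro C hC ih j
      have := integral_add_compl hC (E.integrable_walsh_mul hK j hh)
      rwa [ih, h0, zero_add] at this
    · intro f hd hm ih j
      rw [integral_iUnion hm hd (E.integrable_walsh_mul hK j hh).integrableOn]
      exact (tsum_congr fun k => ih k j).trans tsum_zero
  refine hh.ae_eq_zero_of_forall_setIntegral_eq_zero fun C hC _ => ?_
  have h1 : ∀ x : E.Hull hA K, E.walsh 0 x * h x = h x := fun x => by
    obtain ⟨f, rfl⟩ := E.proj_surjective x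
    rw [E.walsh_proj hK, E.sign_zero, signValue, if_pos rfl, one_mul]
  simpa only [h1] using key C hC 0

/-- The range is closed, and a function orthogonal to it is orthogonal to all Walsh functions. -/
theorem surjective_of_walsh (hS : S.IsSaturated) (hK : S.IsInfinite K)
    {U : H →ₗᵢ[𝕜] Lp 𝕜 2 (HullSpace.measure (E.iSampling hA K) (E.iScale K))}
    (hU : ∀ j, U (E.e j) = (E.memLp_walsh hS hK j).toLp) : Function.Surjective U := by
  have := E.isProbabilityMeasure_hull (hA := hA) hS hK
  have hclosed : IsClosed ((LinearMap.range U.toLinearMap : Submodule 𝕜 _) : Set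
      (Lp 𝕜 2 (HullSpace.measure (E.iSampling hA K) (E.iScale K)))) :=
    U.isometry.isClosedEmbedding.isClosed_range
  have := hclosed.completeSpace_coe
  suffices h : LinearMap.range U.toLinearMap = ⊤ from LinearMap.range_eq_top.1 h
  rw [← Submodule.orthogonal_eq_bot_iff, eq_bot_iff]
  intro h hh
  rw [Submodule.mem_bot, Lp.eq_zero_iff_ae_eq_zero]
  refine E.ae_eq_zero_of_integral_walsh_mul_eq_zero hK
    ((Lp.memLp h).integrable one_le_two) fun j => ?_
  have h1 := hh _ ⟨E.e j, rfl⟩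
  change ⟪U (E.e j), h⟫_𝕜 = 0 at h1
  rw [hU, L2.inner_def] at h1
  rw [← h1]
  refine integral_congr_ae ?_
  filter_upwards [(E.memLp_walsh (hA := hA) hS hK j).coeFn_toLp] with x hx
  rw [hx, RCLike.inner_apply, mul_comm]
  exact congrArg (_ * ·) (conj_signValue _).symm

/-! ### The sampling and the scale -/

theorem isSampling (hK : S.IsInfinite K) : IsSampling S A (E.iSampling hA K) := by
  intro x
  obtain ⟨a, b, hab, ha, hb⟩ := E.exists_graph_tendsto hA (A.mem_graph x)
  refine ⟨S.map a K, S.map b K, ?_, hK.isSt_map ha, hK.isSt_map hb⟩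
  rw [S.pair_map_map, iSampling, S.holds₂_map_iff]
  exact Filter.Eventually.of_forall hab

omit [CompleteSpace H] in
theorem map_e (j : ℕ) : S.map (fun t : FiniteScale H => t.e j) (E.iScale K) = S.std (E.e j) := by
  rw [iScale, S.map_map]
  exact S.map_const _ _

omit [CompleteSpace H] in
/-- The vectors of the internal scale with standard index are the standard vectors `e j`. -/
theorem isSt_e (j : ℕ) : S.IsSt (S.map (fun t : FiniteScale H => t.e j) (E.iScale K)) (E.e j) := by
  rw [E.map_e]
  exact NonstandardExtension.isSt_std K _

theorem tendsto_weight (j : ℕ) :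
    Filter.Tendsto (fun n => (weight n j : ℝ)) Filter.atTop (𝓝 ((1 / 2) ^ (j + 1))) :=
  tendsto_const_nhds.congr' ((Filter.eventually_gt_atTop j).mono fun _ hn => (weight_of_lt hn).symm)

omit [CompleteSpace H] in
theorem isStandardBiasedScale (hdense : Dense (A.domain : Set H)) (hK : S.IsInfinite K) :
    IsStandardBiasedScale S 𝕜 (E.iScale K) where
  infinite n := by
    rw [iScale, S.map_map, S.holds_map]
    exact (hK n).mono fun k hk => hk.trans (Nat.lt_succ_self k)
  nearstandard_e j := ⟨_, E.isSt_e j⟩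
  nearstandard_c j := by
    refine ⟨(1 / 2) ^ (j + 1), ?_⟩
    rw [iScale, S.map_map]
    exact hK.isSt_map (tendsto_weight j)
  st_ne_zero j := by
    have h : S.IsSt (S.map (fun t : FiniteScale H => ((t.c j : ℝ) : 𝕜) • t.e j) (E.iScale K))
        ((((1 / 2) ^ (j + 1) : ℝ) : 𝕜) • E.e j) := by
      rw [iScale, S.map_map]
      exact hK.isSt_map
        (((RCLike.continuous_ofReal.tendsto _).comp (tendsto_weight j)).smul_const _)
    rw [h.st_eq]
    refine smul_ne_zero (RCLike.ofReal_ne_zero.2 (by positivity)) fun h0 => ?_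
    have := E.norm_e j
    rw [h0, norm_zero] at this
    exact zero_ne_one this
  dense_span := by
    simp only [fun j => (E.isSt_e (S := S) (K := K) j).st_eq]
    exact E.dense_span_e hdense
  bias L hL := by
    have h1 : S.pair (E.iScale K) L
        = S.map (fun p : ℕ × ℕ => (E.scale p.1, p.2)) (S.pair K L) := S.pair_map_left _ _ _
    rw [h1, S.map_map, S.isSt_map_iff]
    have hL' := hL.tendsto_map (S.map_snd_pair K L)
    refine squeeze_zero (fun p => Finset.sum_nonneg fun _ _ => by positivity) (fun p => ?_)
      ((tendsto_pow_atTop_nhds_zero_of_lt_one (by norm_num : (0 : ℝ) ≤ 1 / 2)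
        (by norm_num)).comp hL')
    change ∑ j ∈ Finset.Ico p.2 (p.1 + 1), (weight p.1 j : ℝ) * ‖E.e j‖ ^ 2 ≤ (1 / 2) ^ p.2
    simp only [E.norm_e, one_pow, mul_one]
    exact sum_Ico_weight_le _ _

theorem isCompatible (hK : S.IsInfinite K) :
    IsCompatible S (E.iSampling hA K) (E.iScale K) where
  mem := by
    rw [iSampling, iScale, S.holds₂_map_iff]
    exact Filter.Eventually.of_forall fun n j hj => E.e_mem n j (Nat.lt_succ_iff.1 hj)
  nearstandard j := by
    obtain ⟨b, y, hb, hy⟩ := E.exists_graph_e_tendsto hA j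
    refine ⟨S.map b K, ?_, y, hK.isSt_map hy⟩
    rw [E.map_e, ← S.map_const (E.e j) K, S.pair_map_map, iSampling, S.holds₂_map_iff]
    exact (hK.eventually_ge (S.map_id K) j).mono fun n hn => hb n hn
  detects := by
    rw [iSampling, iScale, S.holds₂_map_iff]
    refine Filter.Eventually.of_forall fun n f hf =>
      ⟨0, Nat.succ_pos n, ?_, E.inner_e_zero_ne n f hf⟩
    change 0 < weight n 0
    unfold weight
    split_ifs <;> positivity

end SignSystem

end

theorem mainTheorem3 {𝕜 H : Type} [RCLike 𝕜] [NormedAddCommGroup H] [InnerProductSpace 𝕜 H]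
    [CompleteSpace H] [TopologicalSpace.SeparableSpace H] (hH : ¬ FiniteDimensional 𝕜 H)
    (S : NonstandardExtension.{w}) (hS : S.IsSaturated)
    (A : H →ₗ.[𝕜] H) (hdense : Dense (A.domain : Set H)) (hA : IsSelfAdjoint A) :
    ∃ (σ : S.star (FiniteSampling 𝕜 H)) (s : S.star (FiniteScale H)),
      IsSampling S A σ ∧ IsStandardBiasedScale S 𝕜 s ∧ IsCompatible S σ s ∧
        ∃ U : H →ₗᵢ[𝕜] Lp 𝕜 2 (HullSpace.measure σ s),
          IsInducedIsometry S σ s U ∧ Function.Surjective U := by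
  have : Nontrivial H := by
    by_contra h
    rw [not_nontrivial_iff_subsingleton] at h
    exact hH inferInstance
  obtain ⟨E⟩ := nonempty_signSystem hA
  obtain ⟨K, hK⟩ := hS.exists_isInfinite
  obtain ⟨U, hU⟩ := E.exists_linearIsometry_walsh (hA := hA) hdense hS hK
  exact ⟨E.iSampling hA K, E.iScale K, E.isSampling hK, E.isStandardBiasedScale hdense hK,
    E.isCompatible hK, U, E.isInducedIsometry hK U hdense hS hU, E.surjective_of_walsh hS hK hU⟩
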